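/- **Setting.** Let $n\ge 2$, $s_1,s_2\in(0,1)$, $\lambda\ge 1$, $\varrho\in(0,\infty]$ and $\sigma\in\mathbb R$. For $s\in(0,1)$, $\mathbf K(n,s,\lambda,\varrho)$ is the class of even functions $K:\mathbb R^n\setminus\{0\}\to[0,\infty)$ such that $$\frac{\chi_{B_\varrho}(\zeta)}{\lambda|\zeta|^{n+s}}\le K(\zeta)\le\frac{\lambda}{|\zeta|^{n+s}}\qquad\text{for all }\zeta\ne0\qquad(B_\infty=\mathbb R^n),$$ and $\mathbf K^h(n,s,\lambda,\varrho)$ is the class of those $K\in\mathbf K(n,s,\lambda,\varrho)\cap C^h(\mathbb R^n\setminus\{0\})$ with $|D^jK(\zeta)|\le\lambda|\zeta|^{-n-s-j}$ for all $\zeta\neq 0$ and $1\le j\le h$, where $|D^jK(\zeta)|$ is the operator norm of the $j$-th differential. Write $F^c=\mathbb R^n\setminus F$ and $I_i(E,F)=\int_E\int_F K_i(x-y)\,dx\,dy$, and for measurable $E\subseteq\Omega$ let $$\mathcal C(E)=I_1(E,E^c\cap\Omega)+\sigma I_2(E,\Omega^c)+\int_E g\,dx .$$ A measurable set $E\subseteq\Omega$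 with $|E|=m$ and $I_1(E,E^c\cap\Omega)<\infty$ is a *critical point of $\mathcal C$ among sets of measure $m$* if $\frac{d}{dt}\big|_{t=0}\mathcal C(f_t(E))$ exists and equals $0$ for every $\delta>0$ and every family $\{f_t\}_{|t|<\delta}$ of $C^\infty$ diffeomorphisms of $\mathbb R^n$, with $(t,x)\mapsto f_t(x)$ of class $C^\infty$, such that $f_0=\mathrm{Id}$ and, for each $|t|<\delta$, $f_t-\mathrm{Id}$ has compact support, $f_t(\Omega)=\Omega$ and $|f_t(E)|=|E|$. Here $\partial E$ denotes the set of points $x$ such that $|E\cap B_r(x)|>0$ and $|E^c\cap B_r(x)|>0$ for all $r>0$ (the topological boundary of $E$, once $E$ is suitably normalized up to null sets). $\mathrm{Reg}_E$ is the set of the points $x_0\in\overline{\Omega\cap\partial E}$ for which there are $\rho>0$ and $\alpha\in(s_1,1)$ such that $B_\rho(x_0)\cap\partial E$ is a hypersurface of class $C^{1,\alpha}$, possibly with boundary, the boundary (if any) being contained in $\partial\Omega$. For $x\in\Omega\cap\mathrm{Reg}_E$, $$\mathbf H^{K}_{\partial E}(x)=\mathrm{p.v.}\int_{\mathbb R^n}K(x-y)\big(\chi_{E^c}(y)-\chi_E(y)\big)\,dy=\lim_{\varepsilon\to0^+}\int_{\mathbb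 R^n\setminus B_\varepsilon(x)}K(x-y)\big(\chi_{E^c}(y)-\chi_E(y)\big)\,dy .$$ **Proposition.** Let $K_1\in\mathbf K^1(n,s_1,\lambda,\varrho)$ and $K_2\in\mathbf K^1(n,s_2,\lambda,\varrho)$. Let $\Omega\subset\mathbb R^n$ be open and bounded with $C^1$ boundary and outer unit normal $\nu_\Omega$, let $m\in(0,|\Omega|)$ and $g\in C^1(\mathbb R^n)$. Let $E$ be a critical point of $\mathcal C$ among the sets with Lebesgue measure $m$. Then there exists $c\in\mathbb R$ such that, for every $T\in C^\infty_c(\mathbb R^n;\mathbb R^n)$ with $T\cdot\nu_\Omega=0$ on $\partial\Omega$, $$\iint_{E\times(E^c\cap\Omega)}\mathrm{div}_{(x,y)}\Big(K_1(x-y)\big(T(x),T(y)\big)\Big)dx\,dy+\sigma\iint_{E\times\Omega^c}\mathrm{div}_{(x,y)}\Big(K_2(x-y)\big(T(x),T(y)\big)\Big)dx\,dy+\int_E\mathrm{div}(gT)\,dx=c\int_E\mathrm{div}\,T\,dx ,$$ all the integrands being absolutely integrable on the indicated sets. Moreover, if $K_1\in\mathbf K^2(n,s_1,\lambda,\varrho)$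 and $K_2\in\mathbf K^2(n,s_2,\lambda,\varrho)$, then, with the same $c$, for all $x\in\Omega\cap\mathrm{Reg}_E$ the principal value $\mathbf H^{K_1}_{\partial E}(x)$ exists and is finite, the integrals below converge absolutely, and $$\mathbf H^{K_1}_{\partial E}(x)-\int_{\Omega^c}K_1(x-y)\,dy+\sigma\int_{\Omega^c}K_2(x-y)\,dy+g(x)=c .$$ -/

import Mathlib

open Set Filter Topology MeasureTheory
open scoped ENNReal NNReal ContDiff Manifold

noncomputable section

namespace NonlocalCapillarity

/-- The Euclidean space `ℝⁿ`. -/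
abbrev Space (n : ℕ) : Type := EuclideanSpace ℝ (Fin n)

/-! ### Interaction kernels -/

/-- The class `𝐊(n,s,λ,ϱ)`: even nonnegative functions on `ℝⁿ ∖ {0}` with
`χ_{B_ϱ}(ζ) / (λ |ζ|^{n+s}) ≤ K(ζ) ≤ λ / |ζ|^{n+s}`, where `ϱ ∈ (0,∞]` and `B_∞ = ℝⁿ`.
A kernel is a function on all of `ℝⁿ` whose value at the origin is irrelevant. -/
structure IsKernel (n : ℕ) (s lam : ℝ) (ϱ : ℝ≥0∞) (K : Space n → ℝ) : Prop where
  even : ∀ ζ, ζ ≠ 0 → K (-ζ) = K ζ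
  nonneg : ∀ ζ, ζ ≠ 0 → 0 ≤ K ζ
  lower : ∀ ζ, ζ ≠ 0 →
    (Metric.eball (0 : Space n) ϱ).indicator 1 ζ / (lam * ‖ζ‖ ^ ((n : ℝ) + s)) ≤ K ζ
  upper : ∀ ζ, ζ ≠ 0 → K ζ ≤ lam / ‖ζ‖ ^ ((n : ℝ) + s)

/-- The class `𝐊ʰ(n,s,λ,ϱ)`: kernels of class `Cʰ` on `ℝⁿ ∖ {0}` with
`|DʲK(ζ)| ≤ λ / |ζ|^{n+s+j}` for `1 ≤ j ≤ h`. -/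
structure IsKernelOfClass (h n : ℕ) (s lam : ℝ) (ϱ : ℝ≥0∞) (K : Space n → ℝ) : Prop
    extends IsKernel n s lam ϱ K where
  contDiffOn : ContDiffOn ℝ h K {0}ᶜ
  deriv_bound : ∀ j : ℕ, 1 ≤ j → j ≤ h → ∀ ζ, ζ ≠ 0 →
    ‖iteratedFDeriv ℝ j K ζ‖ ≤ lam / ‖ζ‖ ^ ((n : ℝ) + s + j)

/-- The interaction `I_K(E,F) = ∫_E ∫_F K(x-y) dx dy ∈ [0,∞]`. -/
def interaction {n : ℕ} (K : Space n → ℝ) (E F : Set (Space n)) : ℝ≥0∞ :=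
  ∫⁻ x in E, ∫⁻ y in F, ENNReal.ofReal (K (x - y))

/-- The capillarity functional
`𝒞(E) = I₁(E, Eᶜ ∩ Ω) + σ I₂(E, Ωᶜ) + ∫_E g` (meaningful when both interactions are finite). -/
def capillarityEnergy {n : ℕ} (K₁ K₂ : Space n → ℝ) (σ : ℝ) (g : Space n → ℝ)
    (Ω E : Set (Space n)) : ℝ :=
  (interaction K₁ E (Eᶜ ∩ Ω)).toReal + σ * (interaction K₂ E Ωᶜ).toReal + ∫ x in E, g x

/-! ### Domains of class `C¹` -/

/-- `φ` is a `C¹` defining function of `Ω` near the point `x`: near `x`, `φ` is `C¹` with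
nonvanishing differential, `φ(x) = 0` and `Ω = {φ < 0}`. -/
structure IsC1DefiningFunctionAt {n : ℕ} (Ω : Set (Space n)) (x : Space n)
    (φ : Space n → ℝ) : Prop where
  contDiffAt : ContDiffAt ℝ 1 φ x
  fderiv_ne_zero : fderiv ℝ φ x ≠ 0
  apply_eq_zero : φ x = 0
  mem_iff : ∀ᶠ y in 𝓝 x, (y ∈ Ω ↔ φ y < 0)

/-- `Ω` has boundary of class `C¹`. -/
def HasC1Boundary {n : ℕ} (Ω : Set (Space n)) : Prop :=
  ∀ x ∈ frontier Ω, ∃ φ : Space n → ℝ, IsC1DefiningFunctionAt Ω x φ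

/-- `ν` is the outer unit normal `ν_Ω(x)` of `Ω` at its boundary point `x`. -/
def IsOuterUnitNormal {n : ℕ} (Ω : Set (Space n)) (x ν : Space n) : Prop :=
  ‖ν‖ = 1 ∧ ∃ φ : Space n → ℝ, IsC1DefiningFunctionAt Ω x φ ∧ ∃ a : ℝ, 0 < a ∧
    gradient φ x = a • ν

/-- `T · ν_Ω = 0` on `∂Ω`. -/
def IsTangentToBoundary {n : ℕ} (Ω : Set (Space n)) (T : Space n → Space n) : Prop :=
  ∀ x ∈ frontier Ω, ∀ ν, IsOuterUnitNormal Ω x ν → inner ℝ (T x) ν = 0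

/-! ### Critical sets -/

/-- `{f_t}_{|t| < δ}` is a smooth family of diffeomorphisms of `ℝⁿ` with `f₀ = Id`, with
`f_t - Id` compactly supported, `f_t(Ω) = Ω` and `|f_t(E)| = |E|` for all `|t| < δ`. -/
structure IsVolumePreservingVariation {n : ℕ} (Ω E : Set (Space n)) (δ : ℝ)
    (f : ℝ → (Space n ≃ₘ[ℝ] Space n)) : Prop where
  smooth : ContDiffOn ℝ ∞ (fun p : ℝ × Space n => f p.1 p.2) (Ioo (-δ) δ ×ˢ univ)
  at_zero : ∀ x, f 0 x = x
  compact_support : ∀ t ∈ Ioo (-δ) δ, HasCompactSupport (fun x => f t x - x)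
  image_domain : ∀ t ∈ Ioo (-δ) δ, f t '' Ω = Ω
  volume_image : ∀ t ∈ Ioo (-δ) δ, volume (f t '' E) = volume E

/-- The measurable set `E ⊆ Ω` is a critical point of `𝒞` among sets of Lebesgue measure `m`:
`|E| = m`, the perimeter interaction `I₁(E, Eᶜ ∩ Ω)` is finite, and the derivative at `t = 0`
of `𝒞(f_t(E))` exists and vanishes for every volume preserving variation. -/
structure IsVolumeConstrainedCritical {n : ℕ} (K₁ K₂ : Space n → ℝ) (σ : ℝ)
    (g : Space n → ℝ) (Ω : Set (Space n)) (m : ℝ) (E : Set (Space n)) : Prop where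
  measurableSet : MeasurableSet E
  subset : E ⊆ Ω
  volume_eq : volume E = ENNReal.ofReal m
  finite_interaction : interaction K₁ E (Eᶜ ∩ Ω) ≠ ⊤
  hasDerivAt : ∀ δ : ℝ, 0 < δ → ∀ f : ℝ → (Space n ≃ₘ[ℝ] Space n),
    IsVolumePreservingVariation Ω E δ f →
      HasDerivAt (fun t => capillarityEnergy K₁ K₂ σ g Ω (f t '' E)) 0 0

/-! ### The weak equation -/

/-- The divergence of a vector field on a finite-dimensional space, the trace of its
differential. -/
def divergence {W : Type*} [NormedAddCommGroup W] [NormedSpace ℝ W] (X : W → W) (z : W) : ℝ :=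
  LinearMap.trace ℝ W (fderiv ℝ X z : W →ₗ[ℝ] W)

/-- The vector field `(x,y) ↦ K(x-y) (T(x), T(y))` on `ℝⁿ × ℝⁿ`. -/
def kernelField {n : ℕ} (K : Space n → ℝ) (T : Space n → Space n) (p : Space n × Space n) :
    Space n × Space n :=
  K (p.1 - p.2) • (T p.1, T p.2)

/-! ### Regular points and nonlocal mean curvature -/

/-- The boundary `∂E` of a measurable set, for the representative of `E` that is normalized up
to null sets: the points around which both `E` and `Eᶜ` have positive measure. -/
def boundary {n : ℕ} (E : Set (Space n)) : Set (Space n) :=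
  {x | ∀ r > 0, 0 < volume (E ∩ Metric.ball x r) ∧ 0 < volume (Eᶜ ∩ Metric.ball x r)}

/-- `φ` is of class `C^{1,α}` on the open set `U`. -/
def IsC1HolderOn {n : ℕ} (α : ℝ≥0) (φ : Space n → ℝ) (U : Set (Space n)) : Prop :=
  ContDiffOn ℝ 1 φ U ∧ ∃ C : ℝ≥0, HolderOnWith C α (fderiv ℝ φ) U

/-- `M` is a hypersurface of class `C^{1,α}`, possibly with boundary, whose boundary (if any) is
contained in `Γ`. Locally `M` is `{φ = 0}`, or `{φ = 0, ψ ≥ 0}` with boundary `{φ = 0, ψ = 0}`,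
for `C^{1,α}` functions with linearly independent differentials. -/
def IsC1HolderHypersurface {n : ℕ} (α : ℝ≥0) (M Γ : Set (Space n)) : Prop :=
  ∀ p ∈ M, ∃ U : Set (Space n), IsOpen U ∧ p ∈ U ∧ ∃ φ : Space n → ℝ, IsC1HolderOn α φ U ∧
    (((∀ q ∈ U, fderiv ℝ φ q ≠ 0) ∧ M ∩ U = {q | q ∈ U ∧ φ q = 0}) ∨
      ∃ ψ : Space n → ℝ, IsC1HolderOn α ψ U ∧
        (∀ q ∈ U, LinearIndependent ℝ ![fderiv ℝ φ q, fderiv ℝ ψ q]) ∧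
        M ∩ U = {q | q ∈ U ∧ φ q = 0 ∧ 0 ≤ ψ q} ∧
        {q | q ∈ U ∧ φ q = 0 ∧ ψ q = 0} ⊆ Γ)

/-- The set `Reg_E` of the points `x₀` in the closure of `Ω ∩ ∂E` such that, for some `ρ > 0` and
`α ∈ (s₁,1)`, `B_ρ(x₀) ∩ ∂E` is a `C^{1,α}` manifold possibly with boundary, the latter being
contained in `∂Ω`. -/
def regularSet {n : ℕ} (s₁ : ℝ) (Ω E : Set (Space n)) : Set (Space n) :=
  {x₀ | x₀ ∈ closure (Ω ∩ boundary E) ∧ ∃ ρ : ℝ, 0 < ρ ∧ ∃ α : ℝ≥0, s₁ < α ∧ α < 1 ∧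
    IsC1HolderHypersurface α (Metric.ball x₀ ρ ∩ boundary E) (frontier Ω)}

/-- The integrand `K(x-y) (χ_{Eᶜ}(y) - χ_E(y))` of the nonlocal mean curvature. -/
def curvatureIntegrand {n : ℕ} (K : Space n → ℝ) (E : Set (Space n)) (x y : Space n) : ℝ :=
  K (x - y) * (Eᶜ.indicator 1 y - E.indicator 1 y)

/-- The `K`-mean curvature `𝐇^K_{∂E}(x) = p.v. ∫ K(x-y) (χ_{Eᶜ}(y) - χ_E(y)) dy` exists as a
principal value and equals `H`. -/
def HasMeanCurvature {n : ℕ} (K : Space n → ℝ) (E : Set (Space n)) (x : Space n) (H : ℝ) :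
    Prop :=
  (∀ ε > 0, IntegrableOn (curvatureIntegrand K E x) (Metric.ball x ε)ᶜ) ∧
    Tendsto (fun ε : ℝ => ∫ y in (Metric.ball x ε)ᶜ, curvatureIntegrand K E x y)
      (𝓝[>] 0) (𝓝 H)

end NonlocalCapillarity

end

open NonlocalCapillarity

/-! The weak equation is a Lagrange multiplier rule. For a smooth family with `f t '' Ω = Ω`, a
change of variables turns the energy of `f t '' E` into integrals over the fixed sets `E ×ˢ (Eᶜ ∩
Ω)`, `E ×ˢ Ωᶜ` and `E`. The time derivatives of the double integrands are of order `‖x - y‖ ^ (-(n +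
s))`: the power lost by differentiating the kernel is returned by the Lipschitz bound on the
velocity. This weight is integrable on `E ×ˢ (Eᶜ ∩ Ω)` because the interaction is finite and `K₁` is
bounded below near the origin (`IsKernel.integrableOn_rpow`), and on `Ω ×ˢ Ωᶜ` because a translation
by `h` moves only a volume `O(‖h‖)` out of a bounded `C¹` domain (`exists_volume_shift_le`). So the
energy is differentiable, and its derivative `firstVariation` is linear in the velocity.

Criticality concerns volume preserving families only. Tangential fields have flows that preserve `Ω`
(`IsFlow.image_eq`). If some tangential `T` has `∫_E div T ≠ 0`, the flow of any `S` with `∫_E div S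
= 0` is corrected by the flow of `T`, run for a time `s t` with `s'(0) = 0`, so that the volume
stays constant. Thus `firstVariation` vanishes on such `S`, and by linearity it is a multiple of
`∫_E div`. If there is no such `T`, every tangential flow preserves the volume and `c = 0` serves.

For the pointwise equation one tests with `η • e`, where `η` is supported near `x` and `e` is
transversal to `∂E`. When the singularity of `K₁` is cut off at scale `ε`, the weak equation
concerns the integral over `E` of the derivative along `e` of `η P_ε`, where `P_ε` is the
regularized left side minus `c`. On `∂E` near `x` the `P_ε` converge uniformly at the rate `ε ^ (α -
s₁)`, because reflection through the point cancels everything but a thin slab around the tangent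
plane (`IsLocalGraph.exists_cancellation`). Off `∂E` they need not converge. Hence only boundary
values may be used, which is what `IsLocalGraph.integral_fderiv_nonneg` permits: a function that is
nonnegative on `∂E` has a nonnegative flux, as seen by translating `E` along `e`, without any
surface measure. If the equation failed at `x`, `P_ε` would keep a sign and stay away from 0 on `∂E`
near `x`, and the flux of `η P_ε` could not tend to 0. The sharp truncations that define the
principal value have the same limit as the smooth ones. -/

namespace NonlocalCapillarity

/-! ### Smoothness of the superposition operator on spaces of continuous curves. -/

section Nemytskii

universe u
variable {I : Type*} [TopologicalSpace I] [CompactSpace I]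
variable {E F : Type u} [NormedAddCommGroup E] [NormedSpace ℝ E]
  [NormedAddCommGroup F] [NormedSpace ℝ F]

/-- The pointwise application `C(I, E →L F) → C(I, E) →L C(I, F)`. -/
noncomputable def pointwiseApply (I : Type*) [TopologicalSpace I] [CompactSpace I]
    (E F : Type u) [NormedAddCommGroup E] [NormedSpace ℝ E]
    [NormedAddCommGroup F] [NormedSpace ℝ F] :
    C(I, E →L[ℝ] F) →L[ℝ] C(I, E) →L[ℝ] C(I, F) :=
  LinearMap.mkContinuous₂
    (LinearMap.mk₂ ℝ
      (fun (ψ : C(I, E →L[ℝ] F)) (β : C(I, E)) =>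
        (⟨fun t => ψ t (β t), by fun_prop⟩ : C(I, F)))
      (fun _ _ _ => by ext; simp) (fun _ _ _ => by ext; simp)
      (fun _ _ _ => by ext; simp) (fun _ _ _ => by ext; simp)) 1
    (fun ψ β => by
      rw [ContinuousMap.norm_le _ (by positivity)]
      intro t
      rw [one_mul]
      exact (ContinuousLinearMap.le_opNorm _ _).trans
        (mul_le_mul (ψ.norm_coe_le_norm t) (β.norm_coe_le_norm t) (norm_nonneg _) (by positivity)))

theorem norm_pointwiseApply_le {ψ : C(I, E →L[ℝ] F)} {M : ℝ} (hM : 0 ≤ M)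
    (h : ∀ t, ‖ψ t‖ ≤ M) : ‖pointwiseApply I E F ψ‖ ≤ M := by
  refine ContinuousLinearMap.opNorm_le_bound _ hM fun β => ?_
  rw [ContinuousMap.norm_le _ (by positivity)]
  intro t
  exact (ContinuousLinearMap.le_opNorm _ _).trans
    (mul_le_mul (h t) (β.norm_coe_le_norm t) (norm_nonneg _) hM)

/-- Compact support makes the differential of `T` uniformly continuous, so the mean value inequality
bounds the remainder at every `t` by the same `ε * ‖β‖`. -/
theorem hasFDerivAt_nemytskii {T : E → F} (hT : ContDiff ℝ 1 T) (hc : HasCompactSupport T)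
    (γ : C(I, E)) :
    HasFDerivAt (fun γ : C(I, E) => (⟨fun t => T (γ t), by fun_prop⟩ : C(I, F)))
      (pointwiseApply I E F ⟨fun t => fderiv ℝ T (γ t),
        (hT.continuous_fderiv one_ne_zero).comp γ.continuous⟩) γ := by
  have huc : UniformContinuous (fderiv ℝ T) :=
    (hT.continuous_fderiv one_ne_zero).uniformContinuous_of_tendsto_cocompact (x := 0)
      (hc.fderiv (𝕜 := ℝ)).is_zero_at_infty
  rw [hasFDerivAt_iff_isLittleO_nhds_zero, Asymptotics.isLittleO_iff]
  intro ε hε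
  obtain ⟨δ, hδ, H⟩ := Metric.uniformContinuous_iff.1 huc ε hε
  filter_upwards [Metric.ball_mem_nhds (0 : C(I, E)) hδ] with β hβ
  rw [mem_ball_zero_iff] at hβ
  rw [ContinuousMap.norm_le _ (by positivity)]
  intro t
  have hβt := (β.norm_coe_le_norm t).trans_lt hβ
  have key := (convex_ball (γ t) δ).norm_image_sub_le_of_norm_hasFDerivWithin_le'
    (f := T) (f' := fderiv ℝ T) (φ := fderiv ℝ T (γ t)) (C := ε)
    (x := γ t) (y := γ t + β t)
    (fun x _ => ((hT.differentiable one_ne_zero) x).hasFDerivAt.hasFDerivWithinAt)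
    (fun x hx => by
      rw [← dist_eq_norm]
      exact (H hx).le) (Metric.mem_ball_self hδ) (by simpa using hβt)
  simp only [add_sub_cancel_left] at key
  exact key.trans (mul_le_mul_of_nonneg_left (β.norm_coe_le_norm t) hε.le)

/-- Induction on `k`: the derivative is the superposition operator of `fderiv ℝ T`, again smooth
with compact support, followed by the bounded operator `pointwiseApply`. The target `F` is
quantified inside because the inductive step replaces it by `E →L[ℝ] F`. -/
theorem contDiff_nemytskii_nat (k : ℕ) : ∀ {F : Type u} [NormedAddCommGroup F] [NormedSpace ℝ F]
    {T : E → F} (hT : ContDiff ℝ ∞ T), HasCompactSupport T →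
    ContDiff ℝ k (fun γ : C(I, E) => (⟨fun t => T (γ t), hT.continuous.comp γ.continuous⟩ : C(I, F))) := by
  induction k with
  | zero =>
    intro F _ _ T hT hc
    rw [Nat.cast_zero, contDiff_zero]
    exact continuous_iff_continuousAt.2 fun γ =>
      (hasFDerivAt_nemytskii (hT.of_le (by simp)) hc γ).continuousAt
  | succ k ih =>
    intro F _ _ T hT hc
    have hd := fun γ : C(I, E) => hasFDerivAt_nemytskii (hT.of_le (by simp)) hc γ
    rw [Nat.cast_add, Nat.cast_one, contDiff_succ_iff_fderiv]
    refine ⟨fun γ => (hd γ).differentiableAt, by simp, ?_⟩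
    have hT' : Continuous (fderiv ℝ T) := hT.continuous_fderiv (by simp)
    have : fderiv ℝ (fun γ : C(I, E) => (⟨fun t => T (γ t), hT.continuous.comp γ.continuous⟩ : C(I, F)))
      = fun γ : C(I, E) => pointwiseApply I E F ⟨fun t => fderiv ℝ T (γ t),
        hT'.comp γ.continuous⟩ := funext fun γ => (hd γ).fderiv
    rw [this]
    exact (pointwiseApply I E F).contDiff.comp
      (ih (hT.fderiv_right (m := ∞) (by simp)) (hc.fderiv (𝕜 := ℝ)))

theorem contDiff_nemytskii {T : E → F} (hT : ContDiff ℝ ∞ T) (hc : HasCompactSupport T) :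
    ContDiff ℝ ∞ (fun γ : C(I, E) => (⟨fun t => T (γ t), hT.continuous.comp γ.continuous⟩ : C(I, F))) :=
  contDiff_infty.2 fun k => contDiff_nemytskii_nat k hT hc

end Nemytskii

end NonlocalCapillarity

namespace NonlocalCapillarity

/-! ### Existence, group law and smoothness of flows. -/

section Flow

universe u
variable {E : Type u} [NormedAddCommGroup E] [NormedSpace ℝ E]

theorem integralCurve_unique {T : E → E} {L : ℝ≥0} (hL : LipschitzWith L T) {γ₁ γ₂ : ℝ → E}
    (h₁ : ∀ t, HasDerivAt γ₁ (T (γ₁ t)) t) (h₂ : ∀ t, HasDerivAt γ₂ (T (γ₂ t)) t)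
    (h : γ₁ 0 = γ₂ 0) : γ₁ = γ₂ :=
  ODE_solution_unique_univ (v := fun _ => T) (s := fun _ => univ)
    (fun _ => hL.lipschitzOnWith) (fun t => ⟨h₁ t, trivial⟩) (fun t => ⟨h₂ t, trivial⟩) h

theorem exists_integralCurve [CompleteSpace E] {T : E → E} {L M : ℝ≥0} (hL : LipschitzWith L T)
    (hM : ∀ x, ‖T x‖ ≤ M) (x : E) :
    ∃ γ : ℝ → E, γ 0 = x ∧ ∀ t, HasDerivAt γ (T (γ t)) t := by
  have loc : ∀ N : ℕ, ∃ α : ℝ → E, α 0 = x ∧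
      ∀ t ∈ Ioo (-((N : ℝ) + 1)) (N + 1), HasDerivAt α (T (α t)) t := by
    intro N
    have hN : (0 : ℝ) < N + 1 := by positivity
    have hpl : IsPicardLindelof (fun _ => T) (tmin := -((N : ℝ) + 1)) (tmax := N + 1)
        -- With speed at most `M` the ball of radius `M * (N + 1)` is not left before time `N + 1`,
        -- so a single application covers the whole interval.
        ⟨0, by constructor <;> linarith⟩ x (M * (N + 1)) 0 M L :=
      IsPicardLindelof.of_time_independent (fun y _ => hM y) hL.lipschitzOnWith (by simp)
    obtain ⟨α, h0, hα⟩ := hpl.exists_eq_forall_mem_Icc_hasDerivWithinAt₀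
    exact ⟨α, h0, fun t ht => (hα t (Ioo_subset_Icc_self ht)).hasDerivAt (Icc_mem_nhds ht.1 ht.2)⟩
  choose α h0 hα using loc
  have key : ∀ N N' : ℕ, N ≤ N' → EqOn (α N) (α N') (Ioo (-((N : ℝ) + 1)) (N + 1)) := by
    intro N N' hNN
    have hc : (N : ℝ) ≤ N' := by exact_mod_cast hNN
    have hN : (0 : ℝ) < N + 1 := by positivity
    refine ODE_solution_unique_of_mem_Ioo (v := fun _ => T) (s := fun _ => univ) (t₀ := 0)
      (fun _ _ => hL.lipschitzOnWith) (by constructor <;> linarith)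
      (fun t ht => ⟨hα N t ht, trivial⟩)
      (fun t ht => ⟨hα N' t (Ioo_subset_Ioo (by linarith) (by linarith) ht), trivial⟩) ?_
    rw [h0, h0]
  refine ⟨fun t => α ⌈|t|⌉₊ t, by simp [h0], fun t => ?_⟩
  -- One unit beyond `⌈|t|⌉₊`, so that near `t` every index used by the glued curve is at most `N`
  -- and all pieces agree with `α N`.
  set N := ⌈|t|⌉₊ + 1 with hNdef
  have hmem : ∀ r : ℝ, r ∈ Ioo (-((⌈|r|⌉₊ : ℝ) + 1)) (⌈|r|⌉₊ + 1) := fun r => by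
    rw [mem_Ioo, ← abs_lt]
    linarith [Nat.le_ceil |r|]
  have hev : (fun r => α ⌈|r|⌉₊ r) =ᶠ[𝓝 t] α N := by
    have : ∀ᶠ r in 𝓝 t, |r| < |t| + 1 := continuous_abs.continuousAt.eventually_lt_const (by simp)
    filter_upwards [this] with r hr
    refine key _ _ ?_ (hmem r)
    rw [Nat.ceil_le, hNdef, Nat.cast_add, Nat.cast_one]
    linarith [Nat.le_ceil |t|]
  have h := hα N t (by
    rw [mem_Ioo, ← abs_lt, hNdef, Nat.cast_add, Nat.cast_one]
    linarith [Nat.le_ceil |t|])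
  rw [← hev.self_of_nhds] at h
  exact h.congr_of_eventuallyEq hev

/-- Integration from the left endpoint, as a continuous linear operator on `C([0,1], E)`. -/
noncomputable def primitive (E : Type u) [NormedAddCommGroup E] [NormedSpace ℝ E] :
    C(unitInterval, E) →L[ℝ] C(unitInterval, E) :=
  LinearMap.mkContinuous
    { toFun := fun β =>
        ⟨fun t => ∫ r in (0 : ℝ)..t, β (projIcc 0 1 zero_le_one r),
          (intervalIntegral.continuous_primitive
            (fun _ _ => (by fun_prop : Continuous fun r : ℝ =>
              β (projIcc 0 1 zero_le_one r)).intervalIntegrable _ _) 0).comp continuous_subtype_val⟩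
      map_add' := fun β β' => by
        ext t
        exact intervalIntegral.integral_add
          ((by fun_prop : Continuous fun r : ℝ =>
              β (projIcc 0 1 zero_le_one r)).intervalIntegrable _ _)
          ((by fun_prop : Continuous fun r : ℝ =>
              β' (projIcc 0 1 zero_le_one r)).intervalIntegrable _ _)
      map_smul' := fun c β => by
        ext t
        exact intervalIntegral.integral_smul c _ } 1
    (fun β => by
      rw [ContinuousMap.norm_le _ (by positivity)]
      intro t
      refine (intervalIntegral.norm_integral_le_of_norm_le_const
        (fun r _ => β.norm_coe_le_norm _)).trans ?_
      rw [sub_zero, one_mul]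
      exact mul_le_of_le_one_right (norm_nonneg _) (abs_le.2 ⟨by linarith [t.2.1], t.2.2⟩))

theorem primitive_apply (β : C(unitInterval, E)) (t : unitInterval) :
    primitive E β t = ∫ r in (0 : ℝ)..t, β (projIcc 0 1 zero_le_one r) := rfl

theorem norm_primitive_le : ‖primitive E‖ ≤ 1 :=
  LinearMap.mkContinuous_norm_le _ zero_le_one _

/-- `Φ` is the flow of the vector field `T`. -/
structure IsFlow (T : E → E) (Φ : ℝ → E → E) : Prop where
  zero : ∀ x, Φ 0 x = x
  hasDerivAt : ∀ t x, HasDerivAt (fun t => Φ t x) (T (Φ t x)) t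

theorem exists_isFlow [CompleteSpace E] {T : E → E} {L M : ℝ≥0} (hL : LipschitzWith L T)
    (hM : ∀ x, ‖T x‖ ≤ M) : ∃ Φ : ℝ → E → E, IsFlow T Φ := by
  choose γ h0 hγ using exists_integralCurve hL hM
  exact ⟨fun t x => γ x t, h0, fun t x => hγ x t⟩

theorem IsFlow.add {T : E → E} {Φ : ℝ → E → E} (hΦ : IsFlow T Φ) {L : ℝ≥0}
    (hL : LipschitzWith L T) (s t : ℝ) (x : E) : Φ (s + t) x = Φ s (Φ t x) := by
  have := integralCurve_unique hL (γ₁ := fun s => Φ (s + t) x) (γ₂ := fun s => Φ s (Φ t x))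
    (fun r => HasDerivAt.comp_add_const r t (hΦ.hasDerivAt (r + t) x))
    (fun r => hΦ.hasDerivAt r _) (by simp [hΦ.zero])
  exact congrFun this s

theorem IsFlow.eq_self {T : E → E} {Φ : ℝ → E → E} (hΦ : IsFlow T Φ) {L : ℝ≥0}
    (hL : LipschitzWith L T) {x : E} (hx : T x = 0) (t : ℝ) : Φ t x = x := by
  have := integralCurve_unique hL (γ₁ := fun s => Φ s x) (γ₂ := fun _ => x)
    (fun r => hΦ.hasDerivAt r x) (fun r => by rw [hx]; exact hasDerivAt_const r x)
    (hΦ.zero x)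
  exact congrFun this t

theorem IsFlow.neg_apply {T : E → E} {Φ : ℝ → E → E} (hΦ : IsFlow T Φ) {L : ℝ≥0}
    (hL : LipschitzWith L T) (t : ℝ) (x : E) : Φ (-t) (Φ t x) = x := by
  rw [← hΦ.add hL, neg_add_cancel, hΦ.zero]

theorem IsFlow.apply_neg {T : E → E} {Φ : ℝ → E → E} (hΦ : IsFlow T Φ) {L : ℝ≥0}
    (hL : LipschitzWith L T) (t : ℝ) (x : E) : Φ t (Φ (-t) x) = x := by
  rw [← hΦ.add hL, add_neg_cancel, hΦ.zero]

theorem isInvertible_one_sub {X : Type*} [NormedAddCommGroup X] [NormedSpace ℝ X] [CompleteSpace X]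
    {A : X →L[ℝ] X} (hA : ‖A‖ < 1) : (1 - A).IsInvertible :=
  ⟨ContinuousLinearEquiv.ofUnit (Units.oneSub A hA), rfl⟩

/-- After rescaling time to `[0,1]`, the orbit of `x` up to time `τ` is the zero of `G (τ, x, γ) = γ
- x - τ ∫ T(γ)` in the Banach space `C([0,1], E)`. This `G` is smooth, and when `|τ| * L < 1` its
partial differential in `γ` is invertible by a Neumann series. The implicit function theorem gives a
smooth solution, and evaluation at time 1 gives the flow. -/
theorem IsFlow.contDiffAt [CompleteSpace E] {T : E → E} {Φ : ℝ → E → E} (hΦ : IsFlow T Φ) {L : ℝ≥0}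
    (hL : LipschitzWith L T) (hT : ContDiff ℝ ∞ T) (hc : HasCompactSupport T) {t₀ : ℝ}
    (ht₀ : |t₀| * L < 1) (x₀ : E) :
    ContDiffAt ℝ ∞ (fun p : ℝ × E => Φ p.1 p.2) (t₀, x₀) := by
  let N : C(unitInterval, E) → C(unitInterval, E) := fun γ => ⟨fun t => T (γ t), hT.continuous.comp γ.continuous⟩
  have hN : ContDiff ℝ ∞ N := contDiff_nemytskii hT hc
  let cst : E →L[ℝ] C(unitInterval, E) := ContinuousLinearMap.const ℝ unitInterval
  let G : (ℝ × E) × C(unitInterval, E) → C(unitInterval, E) := fun q => q.2 - cst q.1.2 - q.1.1 • primitive E (N q.2)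
  have hG : ContDiff ℝ ∞ G := by
    have h1 : ContDiff ℝ ∞ fun q : (ℝ × E) × C(unitInterval, E) => primitive E (N q.2) :=
      (primitive E).contDiff.comp (hN.comp contDiff_snd)
    have h2 : ContDiff ℝ ∞ fun q : (ℝ × E) × C(unitInterval, E) => cst q.1.2 :=
      cst.contDiff.comp (contDiff_snd.comp contDiff_fst)
    exact (contDiff_snd.sub h2).sub ((contDiff_fst.comp contDiff_fst).smul h1)
  have hΦc : ∀ x, Continuous fun t => Φ t x := fun x =>
    continuous_iff_continuousAt.2 fun t => (hΦ.hasDerivAt t x).continuousAt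
  let c : ℝ × E → C(unitInterval, E) := fun p => ⟨fun t => Φ (p.1 * t) p.2, (hΦc p.2).comp (by fun_prop)⟩
  have hsol : ∀ p, G (p, c p) = 0 := by
    rintro ⟨τ, x⟩
    ext t
    have hFTC : ∫ r in (0 : ℝ)..t, τ • T (Φ (τ * r) x) = Φ (τ * t) x - Φ (τ * 0) x := by
      refine intervalIntegral.integral_eq_sub_of_hasDerivAt
        (f := fun r : ℝ => Φ (τ * r) x) (fun r _ => ?_) ?_
      · have h := (hasDerivAt_id r).const_mul τ
        rw [mul_one] at h
        exact HasDerivAt.scomp (g₁ := fun t => Φ t x) r (hΦ.hasDerivAt (τ * r) x) h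
      · exact (((hT.continuous.comp (hΦc x)).comp
          (continuous_const.mul continuous_id)).const_smul τ).intervalIntegrable _ _
    rw [intervalIntegral.integral_smul, mul_zero, hΦ.zero] at hFTC
    have h1 : primitive E (N (c (τ, x))) t = ∫ r in (0 : ℝ)..t, T (Φ (τ * r) x) := by
      rw [primitive_apply]
      refine intervalIntegral.integral_congr fun r hr => ?_
      rw [uIcc_of_le t.2.1] at hr
      rw [projIcc_of_mem zero_le_one (⟨hr.1, hr.2.trans t.2.2⟩ : r ∈ Icc (0 : ℝ) 1)]
      rfl
    change Φ (τ * t) x - x - τ • primitive E (N (c (τ, x))) t = 0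
    rw [h1, hFTC, sub_self]
  -- The contraction estimate makes the zero unique in the whole space, so the implicit function is
  -- identified with the orbit without knowing beforehand that `c` is continuous.
  have huniq : ∀ p : ℝ × E, |p.1| * L < 1 → ∀ γ γ' : C(unitInterval, E), G (p, γ) = 0 → G (p, γ') = 0 → γ = γ' := by
    intro p hp γ γ' h h'
    have e : γ - γ' = p.1 • primitive E (N γ - N γ') := by
      have : γ - γ' - p.1 • primitive E (N γ - N γ') = G (p, γ) - G (p, γ') := by
        simp only [G, map_sub, smul_sub]; abel
      rw [h, h', sub_self] at this
      exact sub_eq_zero.1 this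
    have hNL : ‖N γ - N γ'‖ ≤ L * ‖γ - γ'‖ := by
      rw [ContinuousMap.norm_le _ (by positivity)]
      intro t
      refine (hL.norm_sub_le (γ t) (γ' t)).trans ?_
      exact mul_le_mul_of_nonneg_left ((γ - γ').norm_coe_le_norm t) L.2
    have hb : ‖γ - γ'‖ ≤ |p.1| * L * ‖γ - γ'‖ := by
      calc ‖γ - γ'‖ = ‖p.1 • primitive E (N γ - N γ')‖ := by rw [← e]
        _ ≤ |p.1| * (1 * (L * ‖γ - γ'‖)) := by
          rw [norm_smul, Real.norm_eq_abs]
          gcongr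
          exact ((primitive E).le_of_opNorm_le norm_primitive_le _).trans (by gcongr)
        _ = _ := by ring
    have : ‖γ - γ'‖ = 0 := by nlinarith [norm_nonneg (γ - γ')]
    exact sub_eq_zero.1 (norm_eq_zero.1 this)
  set u : (ℝ × E) × C(unitInterval, E) := ((t₀, x₀), c (t₀, x₀)) with hu
  have hGu : ContDiffAt ℝ ∞ G u := hG.contDiffAt
  have hinv : (fderiv ℝ G u ∘L .inr ℝ (ℝ × E) C(unitInterval, E)).IsInvertible := by
    have hd : HasFDerivAt (fun γ : C(unitInterval, E) => G ((t₀, x₀), γ))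
        (1 - t₀ • (primitive E ∘L fderiv ℝ N (c (t₀, x₀)))) (c (t₀, x₀)) := by
      have := (hN.differentiable (by simp) (c (t₀, x₀))).hasFDerivAt
      exact ((hasFDerivAt_id (c (t₀, x₀))).sub_const (cst x₀)).sub
        (((primitive E).hasFDerivAt.comp (c (t₀, x₀)) this).const_smul t₀)
    have hd' : HasFDerivAt (fun γ : C(unitInterval, E) => G ((t₀, x₀), γ))
        (fderiv ℝ G u ∘L .inr ℝ (ℝ × E) C(unitInterval, E)) (c (t₀, x₀)) :=
      HasFDerivAt.comp (c (t₀, x₀)) (g := G) (f := fun γ : C(unitInterval, E) => ((t₀, x₀), γ))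
        (hG.differentiable (by simp) u).hasFDerivAt
        (hasFDerivAt_prodMk_right (t₀, x₀) (c (t₀, x₀)))
    rw [hd'.unique hd]
    have hDN : ‖fderiv ℝ N (c (t₀, x₀))‖ ≤ L := by
      rw [(hasFDerivAt_nemytskii (hT.of_le (by simp)) hc (c (t₀, x₀))).fderiv]
      exact norm_pointwiseApply_le L.2 fun t => norm_fderiv_le_of_lipschitz ℝ hL
    have hlt : ‖t₀ • (primitive E ∘L fderiv ℝ N (c (t₀, x₀)))‖ < 1 := by
      refine (ContinuousLinearMap.opNorm_smul_le t₀ _).trans_lt ?_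
      rw [Real.norm_eq_abs]
      refine lt_of_le_of_lt ?_ ht₀
      gcongr
      refine (ContinuousLinearMap.opNorm_comp_le _ _).trans ?_
      calc _ ≤ 1 * (L : ℝ) := mul_le_mul norm_primitive_le hDN (by positivity) zero_le_one
        _ = L := one_mul _
    exact isInvertible_one_sub hlt
  let ψ := hGu.implicitFunction (by simp) hinv
  have hψ : ContDiffAt ℝ ∞ ψ (t₀, x₀) := hGu.contDiffAt_implicitFunction (by simp) hinv
  have hψeq : ∀ᶠ p in 𝓝 (t₀, x₀), G (p, ψ p) = G u :=
    hGu.eventually_apply_implicitFunction (by simp) hinv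
  have hsmall : ∀ᶠ p : ℝ × E in 𝓝 (t₀, x₀), |p.1| * L < 1 :=
    (by fun_prop : Continuous fun p : ℝ × E => |p.1| * (L : ℝ)).continuousAt.eventually_lt_const ht₀
  have hev : (fun p : ℝ × E => Φ p.1 p.2) =ᶠ[𝓝 (t₀, x₀)]
      fun p => ContinuousMap.evalCLM ℝ (1 : unitInterval) (ψ p) := by
    filter_upwards [hψeq, hsmall] with p hp hps
    have : ψ p = c p := huniq p hps _ _ (hp.trans (hsol _)) (hsol p)
    rw [this]
    simp [c]
  exact ContDiffAt.congr_of_eventuallyEq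
    ((ContinuousMap.evalCLM (M := E) ℝ (1 : unitInterval)).contDiff.contDiffAt.comp (t₀, x₀) hψ) hev

end Flow

end NonlocalCapillarity

namespace NonlocalCapillarity

/-! ### Invariance of the domain under tangential flows. -/

section Nagumo

variable {n : ℕ}

theorem IsTangentToBoundary.fderiv_apply_eq_zero {Ω : Set (Space n)} {T : Space n → Space n}
    (hT : IsTangentToBoundary Ω T) {x : Space n} (hx : x ∈ frontier Ω) {φ : Space n → ℝ}
    (hφ : IsC1DefiningFunctionAt Ω x φ) : fderiv ℝ φ x (T x) = 0 := by
  have hg : gradient φ x ≠ 0 := fun h => hφ.fderiv_ne_zero (by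
    rw [gradient] at h
    simpa using h)
  have hpos : 0 < ‖gradient φ x‖ := norm_pos_iff.2 hg
  have h := hT x hx (‖gradient φ x‖⁻¹ • gradient φ x)
    ⟨by rw [norm_smul, norm_inv, norm_norm, inv_mul_cancel₀ hpos.ne'],
      φ, hφ, ‖gradient φ x‖, hpos, by rw [smul_smul, mul_inv_cancel₀ hpos.ne', one_smul]⟩
  rw [inner_smul_right, mul_eq_zero, or_iff_right (inv_ne_zero hpos.ne'), real_inner_comm] at h
  rwa [gradient, InnerProductSpace.toDual_symm_apply] at h

/-- The subtangentiality condition of Nagumo. At a boundary point, tilt `T z` by a vector `w` of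
length `ε` with `dφ(w) > 0`: since `dφ(T z) = 0`, `φ` increases to first order along `T z + w`, so
`z + h (T z + w)` lies off `Ω`, at distance `ε h` from `z + h T z`. -/
theorem IsTangentToBoundary.eventually_infDist_le {Ω : Set (Space n)} {T : Space n → Space n}
    (hT : IsTangentToBoundary Ω T) (hΩo : IsOpen Ω) (hΩ : HasC1Boundary Ω)
    {z : Space n} (hz : z ∈ Ωᶜ) {ε : ℝ} (hε : 0 < ε) :
    ∀ᶠ h : ℝ in 𝓝[>] 0, Metric.infDist (z + h • T z) Ωᶜ ≤ ε * h := by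
  by_cases hzc : z ∈ closure Ω
  · have hzf : z ∈ frontier Ω := ⟨hzc, by rwa [hΩo.interior_eq]⟩
    obtain ⟨φ, hφ⟩ := hΩ z hzf
    obtain ⟨u, hu⟩ : ∃ u, 0 < fderiv ℝ φ z u := by
      by_contra! hcon
      refine hφ.fderiv_ne_zero (ContinuousLinearMap.ext fun u => le_antisymm (hcon u) ?_)
      have := hcon (-u)
      rw [map_neg] at this
      simpa using this
    have hu0 : u ≠ 0 := fun h => by simp [h] at hu
    have hupos : 0 < ‖u‖ := norm_pos_iff.2 hu0
    set w := (ε / ‖u‖) • u with hw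
    have hline : HasDerivAt (fun h : ℝ => z + h • (T z + w)) (T z + w) 0 := by
      simpa using ((hasDerivAt_id (0 : ℝ)).smul_const (T z + w)).const_add z
    have hd : HasDerivAt (fun h : ℝ => φ (z + h • (T z + w))) (fderiv ℝ φ z (T z + w)) 0 := by
      have h1 : HasFDerivAt φ (fderiv ℝ φ z) (z + (0 : ℝ) • (T z + w)) := by
        simpa using (hφ.contDiffAt.differentiableAt one_ne_zero).hasFDerivAt
      exact h1.comp_hasDerivAt (0 : ℝ) hline
    have hpos : 0 < fderiv ℝ φ z (T z + w) := by
      rw [map_add, hT.fderiv_apply_eq_zero hzf hφ, zero_add, hw, map_smul]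
      exact mul_pos (by positivity) hu
    have hslope := (hasDerivAt_iff_tendsto_slope.1 hd).mono_left
      (nhdsWithin_mono (0 : ℝ) (fun h (hh : h ∈ Ioi (0 : ℝ)) => ne_of_gt hh))
    have hmem : ∀ᶠ h : ℝ in 𝓝[>] 0, (z + h • (T z + w) ∈ Ω ↔ φ (z + h • (T z + w)) < 0) := by
      have : Tendsto (fun h : ℝ => z + h • (T z + w)) (𝓝[>] 0) (𝓝 z) := by
        have := hline.continuousAt.tendsto
        simp only [zero_smul, add_zero] at this
        exact this.mono_left nhdsWithin_le_nhds
      exact this.eventually hφ.mem_iff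
    filter_upwards [hslope.eventually_const_lt hpos, hmem, self_mem_nhdsWithin] with h h1 h2 h3
    have h3' : (0 : ℝ) < h := h3
    have hout : z + h • (T z + w) ∈ Ωᶜ := by
      rw [mem_compl_iff, h2, not_lt]
      rw [slope_def_field, sub_zero, zero_smul, add_zero, hφ.apply_eq_zero, sub_zero] at h1
      exact ((div_pos_iff_of_pos_right h3').1 h1).le
    refine (Metric.infDist_le_dist_of_mem hout).trans ?_
    rw [dist_eq_norm, show z + h • T z - (z + h • (T z + w)) = -(h • w) by module, norm_neg,
      norm_smul, hw, norm_smul, Real.norm_of_nonneg h3'.le, Real.norm_of_nonneg (by positivity),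
      div_mul_cancel₀ _ hupos.ne', mul_comm]
  · have : Tendsto (fun h : ℝ => z + h • T z) (𝓝[>] 0) (𝓝 z) := by
      have hc : Continuous fun h : ℝ => z + h • T z := by fun_prop
      have := hc.tendsto 0
      simp only [zero_smul, add_zero] at this
      exact this.mono_left nhdsWithin_le_nhds
    filter_upwards [this.eventually (isClosed_closure.isOpen_compl.mem_nhds hzc),
      self_mem_nhdsWithin] with h h1 h2
    rw [Metric.infDist_zero_of_mem (show z + h • T z ∈ Ωᶜ from fun hh => h1 (subset_closure hh))]
    exact mul_nonneg hε.le (le_of_lt h2)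

/-- Nagumo's invariance theorem for the complement of a `C¹` domain. -/
theorem IsFlow.mem_compl_of_nonneg {Ω : Set (Space n)} {T : Space n → Space n}
    (hT : IsTangentToBoundary Ω T) (hΩo : IsOpen Ω) (hΩ : HasC1Boundary Ω)
    {L : ℝ≥0} (hL : LipschitzWith L T) {Φ : ℝ → Space n → Space n} (hΦ : IsFlow T Φ)
    {x : Space n} (hx : x ∈ Ωᶜ) {t : ℝ} (ht : 0 ≤ t) : Φ t x ∈ Ωᶜ := by
  have hcl : IsClosed Ωᶜ := hΩo.isClosed_compl
  have hne : (Ωᶜ).Nonempty := ⟨x, hx⟩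
  set d : ℝ → ℝ := fun t => Metric.infDist (Φ t x) Ωᶜ with hd
  have hc : Continuous fun t => Φ t x :=
    continuous_iff_continuousAt.2 fun t => (hΦ.hasDerivAt t x).continuousAt
  have hdc : Continuous d := (Metric.continuous_infDist_pt _).comp hc
  -- Gronwall for the distance `d` to `Ωᶜ`: it starts at 0 and its lower right derivative is at most
  -- `L * d`.
  have key := le_gronwallBound_of_liminf_deriv_right_le (f := d) (f' := fun t => L * d t)
    (δ := 0) (K := L) (ε := 0) (a := 0) (b := t) hdc.continuousOn ?_ ?_ ?_ t ⟨ht, le_rfl⟩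
  · rw [gronwallBound_ε0_δ0] at key
    have h0 : Metric.infDist (Φ t x) Ωᶜ = 0 := le_antisymm key Metric.infDist_nonneg
    exact (hcl.mem_iff_infDist_zero hne).2 h0
  · intro s _ r hr
    refine Eventually.frequently ?_
    -- The orbit is compared with the ray from a nearest point `z` in the direction `T z`, which
    -- stays close to `Ωᶜ`; `T (Φ s x)` and `T z` differ by at most `L * d s`.
    obtain ⟨z, hz, hzd⟩ := hcl.exists_infDist_eq_dist hne (Φ s x)
    -- Two errors are spent, the remainder of the orbit and the distance of the ray to `Ωᶜ`; a third
    -- of the gap for each leaves a strict inequality.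
    set ε := (r - L * d s) / 3 with hε
    have hε0 : 0 < ε := by rw [hε]; linarith
    have h1 := hT.eventually_infDist_le hΩo hΩ hz hε0
    have hshift : Tendsto (fun y : ℝ => y - s) (𝓝[>] s) (𝓝[>] 0) := by
      refine tendsto_nhdsWithin_iff.2 ⟨?_, ?_⟩
      · have : Tendsto (fun y : ℝ => y - s) (𝓝 s) (𝓝 (s - s)) := tendsto_id.sub_const s
        rw [sub_self] at this
        exact this.mono_left nhdsWithin_le_nhds
      · filter_upwards [self_mem_nhdsWithin] with y hy
        exact sub_pos.2 (mem_Ioi.1 hy)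
    have h2 := hshift.eventually h1
    have h3 := ((hasDerivAt_iff_isLittleO.1 (hΦ.hasDerivAt s x)).def hε0).filter_mono
      (nhdsWithin_le_nhds (s := Ioi s))
    filter_upwards [h2, h3, self_mem_nhdsWithin] with y hy2 hy3 hy
    have hpos : 0 < y - s := sub_pos.2 hy
    rw [Real.norm_of_nonneg hpos.le] at hy3
    have hTz : ‖T (Φ s x) - T z‖ ≤ L * d s := by
      rw [hd]
      simp only
      rw [hzd, dist_eq_norm]
      exact hL.norm_sub_le _ _
    have hdy : d y ≤ d s + (y - s) * (L * d s) + ε * (y - s) + ε * (y - s) := by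
      calc d y ≤ dist (Φ y x) (z + (y - s) • T z) + Metric.infDist (z + (y - s) • T z) Ωᶜ := by
            rw [add_comm]; exact Metric.infDist_le_infDist_add_dist
        _ ≤ (d s + (y - s) * (L * d s) + ε * (y - s)) + ε * (y - s) := by
            gcongr
            have e : Φ y x - (z + (y - s) • T z) = (Φ s x - z) + (y - s) • (T (Φ s x) - T z)
              + (Φ y x - Φ s x - (y - s) • T (Φ s x)) := by module
            rw [dist_eq_norm, e]
            refine (norm_add_le _ _).trans (add_le_add ((norm_add_le _ _).trans
              (add_le_add ?_ ?_)) hy3)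
            · rw [hd]
              simp only
              rw [hzd, dist_eq_norm]
            · rw [norm_smul, Real.norm_of_nonneg hpos.le]
              gcongr
    have : (y - s)⁻¹ * (d y - d s) ≤ L * d s + 2 * ε := by
      rw [inv_mul_le_iff₀ hpos]
      linarith
    linarith
  · simp [hd, hΦ.zero, Metric.infDist_zero_of_mem hx]
  · intro s _
    simp

theorem IsFlow.neg {E : Type*} [NormedAddCommGroup E] [NormedSpace ℝ E] {T : E → E}
    {Φ : ℝ → E → E} (hΦ : IsFlow T Φ) : IsFlow (fun x => -T x) (fun t => Φ (-t)) where
  zero x := by simpa using hΦ.zero x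
  hasDerivAt t x := by
    have := HasDerivAt.scomp (g₁ := fun t => Φ t x) t (hΦ.hasDerivAt (-t) x) (hasDerivAt_neg t)
    rw [neg_one_smul] at this
    exact this

/-- The reversed flow is the flow of `-T`, also tangential, so `Ωᶜ` is invariant in both time
directions; as `Φ (-t)` inverts `Φ t`, so is `Ω`. -/
theorem IsFlow.image_eq {Ω : Set (Space n)} {T : Space n → Space n}
    (hT : IsTangentToBoundary Ω T) (hΩo : IsOpen Ω) (hΩ : HasC1Boundary Ω)
    {L : ℝ≥0} (hL : LipschitzWith L T) {Φ : ℝ → Space n → Space n} (hΦ : IsFlow T Φ)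
    (t : ℝ) : Φ t '' Ω = Ω := by
  have hT' : IsTangentToBoundary Ω fun x => -T x := fun x hx ν hν => by
    rw [inner_neg_left, hT x hx ν hν, neg_zero]
  have hL' : LipschitzWith L fun x => -T x := hL.neg
  have inv : ∀ t x, x ∈ Ωᶜ → Φ t x ∈ Ωᶜ := by
    intro t x hx
    rcases le_total 0 t with ht | ht
    · exact hΦ.mem_compl_of_nonneg hT hΩo hΩ hL hx ht
    · have := hΦ.neg.mem_compl_of_nonneg hT' hΩo hΩ hL' hx (neg_nonneg.2 ht)
      simpa using this
  ext y
  constructor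
  · rintro ⟨x, hx, rfl⟩
    by_contra hcon
    have := inv (-t) _ hcon
    rw [hΦ.neg_apply hL] at this
    exact this hx
  · intro hy
    refine ⟨Φ (-t) y, ?_, hΦ.apply_neg hL t y⟩
    by_contra hcon
    have := inv t _ hcon
    rw [hΦ.apply_neg hL] at this
    exact this hy

end Nagumo

end NonlocalCapillarity

namespace NonlocalCapillarity

/-! ### The differential of the determinant. -/

section Determinant

variable {W : Type*} [NormedAddCommGroup W] [NormedSpace ℝ W] [FiniteDimensional ℝ W]

theorem contDiff_det {k : WithTop ℕ∞} : ContDiff ℝ k fun A : W →L[ℝ] W => A.det := by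
  let b := Module.finBasis ℝ W
  have h : (fun A : W →L[ℝ] W => A.det) = fun A : W →L[ℝ] W =>
      ∑ τ : Equiv.Perm (Fin (Module.finrank ℝ W)), (Equiv.Perm.sign τ : ℝ) *
        ∏ i, (b.equivFunL.toContinuousLinearMap (A (b i))) (τ i) := by
    funext A
    rw [ContinuousLinearMap.det, ← LinearMap.det_toMatrix b, Matrix.det_apply']
    refine Finset.sum_congr rfl fun τ _ => ?_
    congr 1
    refine Finset.prod_congr rfl fun i _ => ?_
    rw [LinearMap.toMatrix_apply]
    rfl
  rw [h]
  refine ContDiff.sum fun τ _ => contDiff_const.mul (contDiff_prod fun i _ => ?_)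
  have h1 : ContDiff ℝ k fun A : W →L[ℝ] W => b.equivFunL.toContinuousLinearMap (A (b i)) :=
    b.equivFunL.toContinuousLinearMap.contDiff.comp
      (contDiff_id.clm_apply contDiff_const)
  exact (contDiff_pi.1 h1) (τ i)

/-- Along the line `1 + t • B` the determinant is `1 + t * trace + t ^ 2 * q t` with `q` a
polynomial, and the linear coefficient is the derivative. -/
theorem fderiv_det_one (B : W →L[ℝ] W) :
    fderiv ℝ (fun A : W →L[ℝ] W => A.det) 1 B = LinearMap.trace ℝ W B := by
  have hd : HasFDerivAt (fun A : W →L[ℝ] W => A.det)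
      (fderiv ℝ (fun A : W →L[ℝ] W => A.det) 1) ((1 : W →L[ℝ] W) + (0 : ℝ) • B) := by
    rw [zero_smul, add_zero]
    exact ((contDiff_det (k := 1)).differentiable one_ne_zero 1).hasFDerivAt
  have hl : HasDerivAt (fun t : ℝ => (1 : W →L[ℝ] W) + t • B) B 0 := by
    simpa using ((hasDerivAt_id (0 : ℝ)).smul_const B).const_add (1 : W →L[ℝ] W)
  have h1 := hd.comp_hasDerivAt (0 : ℝ) hl
  let b := Module.finBasis ℝ W
  set M := LinearMap.toMatrix b b (B : W →ₗ[ℝ] W) with hM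
  set q := ((1 + (Polynomial.X : Polynomial ℝ) • M.map Polynomial.C).det.divX.divX).eval with hq
  have h2 : (fun t : ℝ => ((1 : W →L[ℝ] W) + t • B).det) = fun t =>
      1 + M.trace * t + q t * t ^ 2 := by
    funext t
    rw [ContinuousLinearMap.det, ← LinearMap.det_toMatrix b]
    have : LinearMap.toMatrix b b (((1 : W →L[ℝ] W) + t • B : W →L[ℝ] W) : W →ₗ[ℝ] W)
        = 1 + t • M := by
      rw [hM, ContinuousLinearMap.toLinearMap_add, map_add, ContinuousLinearMap.toLinearMap_smul,
        map_smul]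
      congr 1
      exact LinearMap.toMatrix_one b
    rw [this, Matrix.det_one_add_smul]
  have h3 : HasDerivAt (fun t : ℝ => 1 + M.trace * t + q t * t ^ 2) M.trace 0 := by
    have e1 : HasDerivAt (fun t : ℝ => 1 + M.trace * t) M.trace 0 := by
      simpa using ((hasDerivAt_id (0 : ℝ)).const_mul M.trace).const_add 1
    have e2 : HasDerivAt (fun t : ℝ => q t * t ^ 2) 0 0 := by
      have := (Polynomial.hasDerivAt
        ((1 + (Polynomial.X : Polynomial ℝ) • M.map Polynomial.C).det.divX.divX) (0 : ℝ)).fun_mul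
        (hasDerivAt_pow 2 (0 : ℝ))
      simpa using this
    simpa using e1.fun_add e2
  have h4 : ((fun A : W →L[ℝ] W => A.det) ∘ fun t : ℝ => (1 : W →L[ℝ] W) + t • B) =
    fun t => 1 + M.trace * t + q t * t ^ 2 := h2
  rw [h4] at h1
  rw [h1.unique h3, hM, ← LinearMap.trace_eq_matrix_trace]

theorem hasDerivAt_det {A : ℝ → W →L[ℝ] W} {A' : W →L[ℝ] W} {t : ℝ} (h1 : A t = 1)
    (hA : HasDerivAt A A' t) : HasDerivAt (fun t => (A t).det) (LinearMap.trace ℝ W A') t := by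
  have hd : HasFDerivAt (fun A : W →L[ℝ] W => A.det)
      (fderiv ℝ (fun A : W →L[ℝ] W => A.det) 1) (A t) := by
    rw [h1]
    exact ((contDiff_det (k := 1)).differentiable one_ne_zero 1).hasFDerivAt
  have := hd.comp_hasDerivAt t hA
  rwa [fderiv_det_one] at this

theorem trace_smulRight (ℓ : W →L[ℝ] ℝ) (w : W) :
    LinearMap.trace ℝ W (ℓ.smulRight w : W →L[ℝ] W) = ℓ w := by
  have h : ((ℓ.smulRight w : W →L[ℝ] W) : W →ₗ[ℝ] W) =
      (LinearMap.toSpanSingleton ℝ W w) ∘ₗ (ℓ : W →ₗ[ℝ] ℝ) := by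
    ext; simp
  rw [h, LinearMap.trace_comp_comm']
  have : (ℓ : W →ₗ[ℝ] ℝ) ∘ₗ LinearMap.toSpanSingleton ℝ W w = ℓ w • LinearMap.id := by
    ext; simp
  rw [this, map_smul, LinearMap.trace_id]
  simp

end Determinant

/-! ### Divergence of products and of kernel fields. -/

section Divergence

variable {W : Type*} [NormedAddCommGroup W] [NormedSpace ℝ W]

theorem divergence_smul [FiniteDimensional ℝ W] {u : W → ℝ} {X : W → W} {z : W} (hu : DifferentiableAt ℝ u z)
    (hX : DifferentiableAt ℝ X z) :
    divergence (fun z => u z • X z) z = u z * divergence X z + fderiv ℝ u z (X z) := by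
  have := fderiv_fun_smul hu hX
  rw [divergence, this, ContinuousLinearMap.toLinearMap_add, map_add, trace_smulRight,
    ContinuousLinearMap.toLinearMap_smul, map_smul, smul_eq_mul, divergence]

theorem divergence_add {X Y : W → W} {z : W} (hX : DifferentiableAt ℝ X z)
    (hY : DifferentiableAt ℝ Y z) :
    divergence (fun z => X z + Y z) z = divergence X z + divergence Y z := by
  rw [divergence, fderiv_fun_add hX hY, ContinuousLinearMap.toLinearMap_add, map_add, divergence,
    divergence]

theorem divergence_const_smul (c : ℝ) {X : W → W} {z : W} (hX : DifferentiableAt ℝ X z) :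
    divergence (fun z => c • X z) z = c * divergence X z := by
  rw [divergence, fderiv_fun_const_smul hX, ContinuousLinearMap.toLinearMap_smul, map_smul,
    smul_eq_mul, divergence]

theorem continuous_divergence [FiniteDimensional ℝ W] {X : W → W} (hX : ContDiff ℝ 1 X) : Continuous (divergence X) := by
  have h : Continuous (LinearMap.toContinuousLinearMap
      ((LinearMap.trace ℝ W) ∘ₗ (ContinuousLinearMap.coeLM ℝ : (W →L[ℝ] W) →ₗ[ℝ] (W →ₗ[ℝ] W)))) :=
    ContinuousLinearMap.continuous _
  exact h.comp (hX.continuous_fderiv one_ne_zero)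

theorem divergence_eq_zero_of_notMem_tsupport {X : W → W} {z : W} (hz : z ∉ tsupport X) :
    divergence X z = 0 := by
  have : fderiv ℝ X z = 0 := by
    by_contra h
    exact hz (support_fderiv_subset ℝ h)
  rw [divergence, this]
  simp

theorem hasCompactSupport_divergence {X : W → W} (hX : HasCompactSupport X) :
    HasCompactSupport (divergence X) :=
  HasCompactSupport.intro hX fun _ hz => divergence_eq_zero_of_notMem_tsupport hz

variable {n : ℕ}

/-- The differential of `K` meets the field only through `T p.1 - T p.2`, which for Lipschitz `T`
cancels one power of its singularity. -/
theorem divergence_kernelField {K : Space n → ℝ} {T : Space n → Space n}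
    {p : Space n × Space n} (hK : DifferentiableAt ℝ K (p.1 - p.2)) (hT : Differentiable ℝ T) :
    divergence (kernelField K T) p = fderiv ℝ K (p.1 - p.2) (T p.1 - T p.2)
      + K (p.1 - p.2) * (divergence T p.1 + divergence T p.2) := by
  have h1 : HasFDerivAt (fun p : Space n × Space n => K (p.1 - p.2))
      (fderiv ℝ K (p.1 - p.2) ∘L (.fst ℝ (Space n) (Space n) - .snd ℝ (Space n) (Space n))) p :=
    hK.hasFDerivAt.comp p (hasFDerivAt_fst.sub hasFDerivAt_snd)
  have h2 : HasFDerivAt (fun p : Space n × Space n => (T p.1, T p.2))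
      ((fderiv ℝ T p.1).prodMap (fderiv ℝ T p.2)) p :=
    ((hT p.1).hasFDerivAt.prodMap p (hT p.2).hasFDerivAt)
  have e := divergence_smul h1.differentiableAt h2.differentiableAt
  have e2 : divergence (fun p : Space n × Space n => (T p.1, T p.2)) p
      = divergence T p.1 + divergence T p.2 := by
    rw [divergence, h2.fderiv]
    exact LinearMap.trace_prodMap' _ _
  rw [e2, h1.fderiv] at e
  change divergence (fun p : Space n × Space n => K (p.1 - p.2) • (T p.1, T p.2)) p = _
  rw [e]
  simp [add_comm]

end Divergence

end NonlocalCapillarity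

namespace NonlocalCapillarity

/-! ### Smooth families of maps: velocity, Jacobian and uniform bounds. -/

section Family

variable {n : ℕ}

/-- A smooth family of maps of `ℝⁿ` that is the identity at time `0` and off the compact `C`. -/
structure IsSmoothFamily (δ : ℝ) (C : Set (Space n)) (f : ℝ → Space n → Space n) : Prop where
  pos : 0 < δ
  isCompact : IsCompact C
  smooth : ContDiffOn ℝ ∞ (fun p : ℝ × Space n => f p.1 p.2) (Ioo (-δ) δ ×ˢ univ)
  zero : ∀ x, f 0 x = x
  eq_self : ∀ t ∈ Ioo (-δ) δ, ∀ x ∉ C, f t x = x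

/-- The velocity of a family of maps. -/
noncomputable def velocity (f : ℝ → Space n → Space n) (t : ℝ) (x : Space n) : Space n :=
  fderiv ℝ (fun p : ℝ × Space n => f p.1 p.2) (t, x) (1, 0)

/-- The spatial differential of a family of maps. -/
noncomputable def spatialDeriv (f : ℝ → Space n → Space n) (t : ℝ) (x : Space n) :
    Space n →L[ℝ] Space n :=
  fderiv ℝ (fun p : ℝ × Space n => f p.1 p.2) (t, x) ∘L .inr ℝ ℝ (Space n)

/-- The Jacobian determinant of a family of maps. -/
noncomputable def jacobian (f : ℝ → Space n → Space n) (t : ℝ) (x : Space n) : ℝ :=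
  (spatialDeriv f t x).det

/-- The time derivative of the Jacobian determinant. -/
noncomputable def jacobianVelocity (f : ℝ → Space n → Space n) (t : ℝ) (x : Space n) : ℝ :=
  fderiv ℝ (fun p : ℝ × Space n => jacobian f p.1 p.2) (t, x) (1, 0)

theorem hasDerivAt_slice {F : Type*} [NormedAddCommGroup F] [NormedSpace ℝ F]
    {u : ℝ × Space n → F} {u' : ℝ × Space n →L[ℝ] F} {t : ℝ} {x : Space n}
    (h : HasFDerivAt u u' (t, x)) : HasDerivAt (fun t => u (t, x)) (u' (1, 0)) t :=
  h.comp_hasDerivAt (f := fun t => (t, x)) t ((hasDerivAt_id t).prodMk (hasDerivAt_const t x))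

theorem hasFDerivAt_slice {F : Type*} [NormedAddCommGroup F] [NormedSpace ℝ F]
    {u : ℝ × Space n → F} {u' : ℝ × Space n →L[ℝ] F} {t : ℝ} {x : Space n}
    (h : HasFDerivAt u u' (t, x)) :
    HasFDerivAt (fun x => u (t, x)) (u' ∘L .inr ℝ ℝ (Space n)) x :=
  h.comp (f := fun x => (t, x)) x (hasFDerivAt_prodMk_right t x)

theorem isOpen_slab (δ : ℝ) : IsOpen (Ioo (-δ) δ ×ˢ (univ : Set (Space n))) :=
  isOpen_Ioo.prod isOpen_univ

namespace IsSmoothFamily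

variable {δ : ℝ} {C : Set (Space n)} {f : ℝ → Space n → Space n}

theorem zero_mem (h : IsSmoothFamily δ C f) : (0 : ℝ) ∈ Ioo (-δ) δ := ⟨by linarith [h.pos], h.pos⟩

theorem contDiffAt (h : IsSmoothFamily δ C f) {t : ℝ} (ht : t ∈ Ioo (-δ) δ) (x : Space n) :
    ContDiffAt ℝ ∞ (fun p : ℝ × Space n => f p.1 p.2) (t, x) :=
  h.smooth.contDiffAt ((isOpen_slab δ).mem_nhds ⟨ht, trivial⟩)

theorem hasFDerivAt (h : IsSmoothFamily δ C f) {t : ℝ} (ht : t ∈ Ioo (-δ) δ) (x : Space n) :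
    HasFDerivAt (fun p : ℝ × Space n => f p.1 p.2)
      (fderiv ℝ (fun p : ℝ × Space n => f p.1 p.2) (t, x)) (t, x) :=
  ((h.contDiffAt ht x).differentiableAt (by simp)).hasFDerivAt

theorem hasDerivAt_time (h : IsSmoothFamily δ C f) {t : ℝ} (ht : t ∈ Ioo (-δ) δ) (x : Space n) :
    HasDerivAt (fun t => f t x) (velocity f t x) t :=
  hasDerivAt_slice (h.hasFDerivAt ht x)

theorem hasFDerivAt_space (h : IsSmoothFamily δ C f) {t : ℝ} (ht : t ∈ Ioo (-δ) δ) (x : Space n) :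
    HasFDerivAt (f t) (spatialDeriv f t x) x :=
  hasFDerivAt_slice (h.hasFDerivAt ht x)

theorem contDiffOn_fderiv (h : IsSmoothFamily δ C f) :
    ContDiffOn ℝ ∞ (fderiv ℝ (fun p : ℝ × Space n => f p.1 p.2)) (Ioo (-δ) δ ×ˢ univ) :=
  h.smooth.fderiv_of_isOpen (isOpen_slab δ) (by simp)

theorem contDiffOn_velocity (h : IsSmoothFamily δ C f) :
    ContDiffOn ℝ ∞ (fun p : ℝ × Space n => velocity f p.1 p.2) (Ioo (-δ) δ ×ˢ univ) :=
  h.contDiffOn_fderiv.clm_apply contDiffOn_const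

theorem contDiffOn_spatialDeriv (h : IsSmoothFamily δ C f) :
    ContDiffOn ℝ ∞ (fun p : ℝ × Space n => spatialDeriv f p.1 p.2) (Ioo (-δ) δ ×ˢ univ) :=
  h.contDiffOn_fderiv.clm_comp contDiffOn_const

theorem contDiffOn_jacobian (h : IsSmoothFamily δ C f) :
    ContDiffOn ℝ ∞ (fun p : ℝ × Space n => jacobian f p.1 p.2) (Ioo (-δ) δ ×ˢ univ) :=
  contDiff_det.comp_contDiffOn h.contDiffOn_spatialDeriv

theorem contDiffOn_jacobianVelocity (h : IsSmoothFamily δ C f) :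
    ContDiffOn ℝ ∞ (fun p : ℝ × Space n => jacobianVelocity f p.1 p.2) (Ioo (-δ) δ ×ˢ univ) :=
  (h.contDiffOn_jacobian.fderiv_of_isOpen (isOpen_slab δ) (by simp)).clm_apply contDiffOn_const

theorem hasDerivAt_jacobian (h : IsSmoothFamily δ C f) {t : ℝ} (ht : t ∈ Ioo (-δ) δ)
    (x : Space n) : HasDerivAt (fun t => jacobian f t x) (jacobianVelocity f t x) t :=
  hasDerivAt_slice (u := fun p : ℝ × Space n => jacobian f p.1 p.2)
    ((h.contDiffOn_jacobian.contDiffAt ((isOpen_slab δ).mem_nhds ⟨ht, trivial⟩)).differentiableAt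
      (by simp)).hasFDerivAt

theorem spatialDeriv_zero (h : IsSmoothFamily δ C f) (x : Space n) : spatialDeriv f 0 x = 1 := by
  have h1 := h.hasFDerivAt_space h.zero_mem x
  have h2 : f 0 = id := funext h.zero
  rw [h2] at h1
  exact h1.unique (hasFDerivAt_id x)

theorem jacobian_zero (h : IsSmoothFamily δ C f) (x : Space n) : jacobian f 0 x = 1 := by
  rw [jacobian, h.spatialDeriv_zero]
  exact LinearMap.det_id

/-- At time 0 the spatial differential is the identity, so the determinant varies by the trace of
its time derivative; symmetry of the second differential turns this into the spatial differential of
the velocity. -/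
theorem jacobianVelocity_zero (h : IsSmoothFamily δ C f) (x : Space n) :
    jacobianVelocity f 0 x = divergence (velocity f 0) x := by
  set F := fun p : ℝ × Space n => f p.1 p.2 with hF
  have hd : HasFDerivAt (fderiv ℝ F) (fderiv ℝ (fderiv ℝ F) (0, x)) (0, x) :=
    ((h.contDiffOn_fderiv.contDiffAt ((isOpen_slab δ).mem_nhds ⟨h.zero_mem, trivial⟩)).differentiableAt
      (by simp)).hasFDerivAt
  have h1 : HasDerivAt (fun t => spatialDeriv f t x)
      ((fderiv ℝ (fderiv ℝ F) (0, x) (1, 0)) ∘L .inr ℝ ℝ (Space n)) 0 :=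
    (((ContinuousLinearMap.compL ℝ (Space n) (ℝ × Space n) (Space n)).flip
      (.inr ℝ ℝ (Space n))).hasFDerivAt.comp_hasDerivAt (0 : ℝ) (hasDerivAt_slice hd))
  have h2 : HasFDerivAt (velocity f 0)
      (((ContinuousLinearMap.apply ℝ (Space n) ((1, 0) : ℝ × Space n)) ∘L
        fderiv ℝ (fderiv ℝ F) (0, x)) ∘L .inr ℝ ℝ (Space n)) x :=
    hasFDerivAt_slice (u := fun p : ℝ × Space n => velocity f p.1 p.2)
      ((ContinuousLinearMap.apply ℝ (Space n) ((1, 0) : ℝ × Space n)).hasFDerivAt.comp (0, x) hd)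
  have hsymm : IsSymmSndFDerivAt ℝ F (0, x) :=
    (h.contDiffAt h.zero_mem x).isSymmSndFDerivAt (by
      rw [minSmoothness_of_isRCLikeNormedField]
      exact WithTop.coe_le_coe.2 (le_top : (2 : ℕ∞) ≤ ⊤))
  rw [divergence, h2.fderiv,
    (h.hasDerivAt_jacobian h.zero_mem x).unique (hasDerivAt_det (h.spatialDeriv_zero x) h1)]
  congr 2
  ext v : 1
  exact hsymm.eq (1, 0) (0, v)

theorem velocity_eq_zero (h : IsSmoothFamily δ C f) {t : ℝ} (ht : t ∈ Ioo (-δ) δ) {x : Space n}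
    (hx : x ∉ C) : velocity f t x = 0 := by
  refine (h.hasDerivAt_time ht x).unique
    ((hasDerivAt_const t x).congr_of_eventuallyEq ?_)
  filter_upwards [isOpen_Ioo.mem_nhds ht] with s hs
  exact h.eq_self s hs x hx

theorem spatialDeriv_eq_one (h : IsSmoothFamily δ C f) {t : ℝ} (ht : t ∈ Ioo (-δ) δ)
    {x : Space n} (hx : x ∉ C) : spatialDeriv f t x = 1 := by
  refine (h.hasFDerivAt_space ht x).unique ((hasFDerivAt_id x).congr_of_eventuallyEq ?_)
  filter_upwards [h.isCompact.isClosed.isOpen_compl.mem_nhds hx] with y hy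
  exact h.eq_self t ht y hy

theorem jacobian_eq_one (h : IsSmoothFamily δ C f) {t : ℝ} (ht : t ∈ Ioo (-δ) δ)
    {x : Space n} (hx : x ∉ C) : jacobian f t x = 1 := by
  rw [jacobian, h.spatialDeriv_eq_one ht hx]
  exact LinearMap.det_id

theorem jacobianVelocity_eq_zero (h : IsSmoothFamily δ C f) {t : ℝ} (ht : t ∈ Ioo (-δ) δ)
    {x : Space n} (hx : x ∉ C) : jacobianVelocity f t x = 0 := by
  refine (h.hasDerivAt_jacobian ht x).unique
    ((hasDerivAt_const t 1).congr_of_eventuallyEq ?_)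
  filter_upwards [isOpen_Ioo.mem_nhds ht] with s hs
  exact h.jacobian_eq_one hs hx

theorem exists_bound (h : IsSmoothFamily δ C f) {F : Type*} [NormedAddCommGroup F]
    {u : ℝ → Space n → F}
    (hu : ContinuousOn (fun p : ℝ × Space n => u p.1 p.2) (Ioo (-δ) δ ×ˢ univ))
    (h0 : ∀ t ∈ Ioo (-δ) δ, ∀ x ∉ C, u t x = 0) :
    ∃ M > 0, ∀ t ∈ Icc (-(δ / 2)) (δ / 2), ∀ x, ‖u t x‖ ≤ M := by
  have hsub : Icc (-(δ / 2)) (δ / 2) ⊆ Ioo (-δ) δ := fun t ht =>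
    ⟨by linarith [ht.1, h.pos], by linarith [ht.2, h.pos]⟩
  obtain ⟨M, hM⟩ := ((isCompact_Icc (a := -(δ / 2)) (b := δ / 2)).prod
    h.isCompact).exists_bound_of_continuousOn (hu.mono (prod_mono hsub (subset_univ C)))
  refine ⟨max M 1, by positivity, fun t ht x => ?_⟩
  by_cases hx : x ∈ C
  · exact (hM (t, x) ⟨ht, hx⟩).trans (le_max_left _ _)
  · rw [h0 t (hsub ht) x hx, norm_zero]
    positivity

/-- Uniform estimates for a smooth family at small times. -/
theorem exists_uniform_bounds (h : IsSmoothFamily δ C f) : ∃ a M : ℝ, 0 < a ∧ a < δ ∧ 1 ≤ M ∧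
    ∀ t ∈ Icc (-a) a, (∀ x y, ‖velocity f t x - velocity f t y‖ ≤ M * ‖x - y‖) ∧
      (∀ x y, ‖x - y‖ / 2 ≤ ‖f t x - f t y‖) ∧
      (∀ x, 0 < jacobian f t x) ∧ (∀ x, |jacobian f t x| ≤ M) ∧
      (∀ x, |jacobianVelocity f t x| ≤ M) := by
  have hsub : Icc (-(δ / 2)) (δ / 2) ⊆ Ioo (-δ) δ := fun t ht =>
    ⟨by linarith [ht.1, h.pos], by linarith [ht.2, h.pos]⟩
  have hDV := h.contDiffOn_velocity.fderiv_of_isOpen (isOpen_slab δ) (m := ∞) (by simp)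
  obtain ⟨M₁, hM₁, B₁⟩ := h.exists_bound
    (u := fun t x => (fderiv ℝ (fun p : ℝ × Space n => velocity f p.1 p.2) (t, x)) ∘L
      .inr ℝ ℝ (Space n))
    (hDV.clm_comp contDiffOn_const).continuousOn (fun t ht x hx => by
      have h1 := hasFDerivAt_slice (u := fun p : ℝ × Space n => velocity f p.1 p.2) (t := t) (x := x)
        ((h.contDiffOn_velocity.contDiffAt ((isOpen_slab δ).mem_nhds ⟨ht, mem_univ x⟩)).differentiableAt
          (by simp)).hasFDerivAt
      refine h1.unique ((hasFDerivAt_const (0 : Space n) x).congr_of_eventuallyEq ?_)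
      filter_upwards [h.isCompact.isClosed.isOpen_compl.mem_nhds hx] with y hy
      exact h.velocity_eq_zero ht hy)
  obtain ⟨M₂, hM₂, B₂⟩ := h.exists_bound (u := fun t x => jacobianVelocity f t x)
    h.contDiffOn_jacobianVelocity.continuousOn (fun t ht x hx => h.jacobianVelocity_eq_zero ht hx)
  have lipV : ∀ t ∈ Icc (-(δ / 2)) (δ / 2), ∀ x y,
      ‖velocity f t x - velocity f t y‖ ≤ M₁ * ‖x - y‖ := fun t ht x y =>
    convex_univ.norm_image_sub_le_of_norm_hasFDerivWithin_le
      (fun z _ => (hasFDerivAt_slice (u := fun p : ℝ × Space n => velocity f p.1 p.2)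
        ((h.contDiffOn_velocity.contDiffAt ((isOpen_slab δ).mem_nhds
          ⟨hsub ht, mem_univ z⟩)).differentiableAt (by simp)).hasFDerivAt).hasFDerivWithinAt)
      (fun z _ => B₁ t ht z) (mem_univ y) (mem_univ x)
  -- `M₁ * a ≤ 1 / 2` keeps `f t x - f t y` within `‖x - y‖ / 2` of `x - y`, and `M₂ * a ≤ 1 / 2`
  -- keeps the Jacobian within `1 / 2` of 1, hence positive and below 2.
  set a := min (δ / 2) (min (1 / (2 * M₁)) (1 / (2 * M₂))) with ha
  have ha0 : 0 < a := by
    have := h.pos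
    rw [ha]
    positivity
  have hIcc : Icc (-a) a ⊆ Icc (-(δ / 2)) (δ / 2) :=
    Icc_subset_Icc (neg_le_neg (min_le_left _ _)) (min_le_left _ _)
  have ha1 : M₁ * a ≤ 1 / 2 := by
    have : a ≤ 1 / (2 * M₁) := (min_le_right _ _).trans (min_le_left _ _)
    calc M₁ * a ≤ M₁ * (1 / (2 * M₁)) := by gcongr
      _ = 1 / 2 := by field_simp
  have ha2 : M₂ * a ≤ 1 / 2 := by
    have : a ≤ 1 / (2 * M₂) := (min_le_right _ _).trans (min_le_right _ _)
    calc M₂ * a ≤ M₂ * (1 / (2 * M₂)) := by gcongr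
      _ = 1 / 2 := by field_simp
  have h0a : (0 : ℝ) ∈ Icc (-a) a := ⟨by linarith, ha0.le⟩
  have habs : ∀ t ∈ Icc (-a) a, |t| ≤ a := fun t ht => abs_le.2 ht
  have hjac : ∀ t ∈ Icc (-a) a, ∀ x, |jacobian f t x - 1| ≤ 1 / 2 := by
    intro t ht x
    have := (convex_Icc (-a) a).norm_image_sub_le_of_norm_hasDerivWithin_le
      (f := fun t => jacobian f t x) (C := M₂)
      (fun s hs => (h.hasDerivAt_jacobian (hsub (hIcc hs)) x).hasDerivWithinAt)
      (fun s hs => B₂ s (hIcc hs) x) h0a ht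
    simp only [h.jacobian_zero, sub_zero, Real.norm_eq_abs] at this
    refine this.trans (le_trans ?_ ha2)
    gcongr
    exact habs t ht
  refine ⟨a, max (max M₁ M₂) 2, ha0, ?_, (by norm_num : (1 : ℝ) ≤ 2).trans (le_max_right _ _),
    fun t ht => ⟨fun x y => ?_, fun x y => ?_, fun x => ?_, fun x => ?_, fun x => ?_⟩⟩
  · exact (min_le_left _ _).trans_lt (by linarith [h.pos])
  · refine (lipV t (hIcc ht) x y).trans ?_
    gcongr
    exact (le_max_left _ _).trans (le_max_left _ _)
  · have := (convex_Icc (-a) a).norm_image_sub_le_of_norm_hasDerivWithin_le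
      (f := fun t => f t x - f t y) (C := M₁ * ‖x - y‖)
      (fun s hs => ((h.hasDerivAt_time (hsub (hIcc hs)) x).fun_sub
        (h.hasDerivAt_time (hsub (hIcc hs)) y)).hasDerivWithinAt)
      (fun s hs => lipV s (hIcc hs) x y) h0a ht
    simp only [h.zero, sub_zero, Real.norm_eq_abs] at this
    have h2 : ‖f t x - f t y - (x - y)‖ ≤ ‖x - y‖ / 2 := by
      refine this.trans ?_
      calc M₁ * ‖x - y‖ * |t| ≤ M₁ * ‖x - y‖ * a := by gcongr; exact habs t ht
        _ = (M₁ * a) * ‖x - y‖ := by ring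
        _ ≤ 1 / 2 * ‖x - y‖ := by gcongr
        _ = _ := by ring
    have h3 := norm_sub_norm_le (x - y) (f t x - f t y)
    rw [norm_sub_rev (x - y) (f t x - f t y)] at h3
    linarith
  · have := (abs_le.1 (hjac t ht x)).1
    linarith
  · have := abs_le.1 (hjac t ht x)
    refine (abs_le.2 ⟨?_, ?_⟩ : |jacobian f t x| ≤ 2).trans (le_max_right _ _) <;> linarith
  · exact (B₂ t (hIcc ht) x).trans ((le_max_right _ _).trans (le_max_left _ _))

end IsSmoothFamily

end Family

end NonlocalCapillarity

namespace NonlocalCapillarity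

/-! ### Differentiation of interactions under the integral sign. -/

section Energy

variable {n : ℕ}

/-- A `C¹` kernel off the origin with the growth of `‖z‖ ^ (-β)`. -/
structure IsSingularKernel (K : Space n → ℝ) (Λ β : ℝ) : Prop where
  nonneg : 0 ≤ Λ
  contDiffOn : ContDiffOn ℝ 1 K {0}ᶜ
  bound : ∀ z, z ≠ 0 → |K z| ≤ Λ * ‖z‖ ^ (-β)
  fderiv_bound : ∀ z, z ≠ 0 → ‖fderiv ℝ K z‖ ≤ Λ * ‖z‖ ^ (-β - 1)

theorem IsSingularKernel.differentiableAt {K : Space n → ℝ} {Λ β : ℝ}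
    (hK : IsSingularKernel K Λ β) {z : Space n} (hz : z ≠ 0) : DifferentiableAt ℝ K z :=
  (hK.contDiffOn.contDiffAt (isOpen_compl_singleton.mem_nhds hz)).differentiableAt one_ne_zero

theorem IsSingularKernel.measurable {K : Space n → ℝ} {Λ β : ℝ}
    (hK : IsSingularKernel K Λ β) : Measurable K :=
  measurable_of_continuousOn_compl_singleton 0 hK.contDiffOn.continuousOn

theorem measurable_divergence_kernelField_formula {K : Space n → ℝ} (hK : Measurable K)
    {T : Space n → Space n} (hT : ContDiff ℝ 1 T) :
    Measurable fun p : Space n × Space n => fderiv ℝ K (p.1 - p.2) (T p.1 - T p.2)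
      + K (p.1 - p.2) * (divergence T p.1 + divergence T p.2) := by
  have hTm : Measurable T := hT.continuous.measurable
  have hdT : Measurable (divergence T) := (continuous_divergence hT).measurable
  have h1 : Measurable fun p : Space n × Space n => fderiv ℝ K (p.1 - p.2) (T p.1 - T p.2) := by
    have hc : Continuous fun q : (Space n →L[ℝ] ℝ) × Space n => q.1 q.2 := by fun_prop
    exact hc.measurable.comp (((measurable_fderiv ℝ K).comp (by fun_prop)).prodMk (by fun_prop))
  fun_prop

namespace IsSmoothFamily

variable {δ : ℝ} {C : Set (Space n)} {f : ℝ → Space n → Space n}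

theorem contDiff_slice {F : Type*} [NormedAddCommGroup F]
    [NormedSpace ℝ F] {u : ℝ → Space n → F}
    (hu : ContDiffOn ℝ ∞ (fun p : ℝ × Space n => u p.1 p.2) (Ioo (-δ) δ ×ˢ univ))
    {t : ℝ} (ht : t ∈ Ioo (-δ) δ) : ContDiff ℝ ∞ (u t) := by
  have : ContDiff ℝ ∞ fun x : Space n => (t, x) := contDiff_const.prodMk contDiff_id
  exact contDiffOn_univ.1 (hu.comp this.contDiffOn fun x _ => ⟨ht, trivial⟩)

/-- Dominated differentiation. The majorant is a multiple of `‖x - y‖ ^ (-β)`: the differential of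
`K` costs the power `-β - 1`, the velocity difference returns one power, and `‖f t x - f t y‖ ≥ ‖x -
y‖ / 2` brings everything back to `x - y`. Disjointness of `A` and `B` keeps the kernel away from
its singular point. -/
theorem hasDerivAt_integral_kernel (h : IsSmoothFamily δ C f) {K : Space n → ℝ} {Λ β : ℝ}
    (hβ : 0 ≤ β) (hK : IsSingularKernel K Λ β) {A B : Set (Space n)} (hA : MeasurableSet A)
    (hB : MeasurableSet B) (hAB : Disjoint A B)
    (hint : IntegrableOn (fun p : Space n × Space n => ‖p.1 - p.2‖ ^ (-β)) (A ×ˢ B)) :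
    IntegrableOn (divergence (kernelField K (velocity f 0))) (A ×ˢ B) ∧
      HasDerivAt (fun t => ∫ p in A ×ˢ B,
          K (f t p.1 - f t p.2) * (jacobian f t p.1 * jacobian f t p.2))
        (∫ p in A ×ˢ B, divergence (kernelField K (velocity f 0)) p) 0 := by
  obtain ⟨a, M, ha, haδ, hM, hb⟩ := h.exists_uniform_bounds
  have hsub : Icc (-a) a ⊆ Ioo (-δ) δ := fun t ht => ⟨by linarith [ht.1], by linarith [ht.2]⟩
  have hM0 : 0 ≤ M := zero_le_one.trans hM
  have hT : ContDiff ℝ ∞ (velocity f 0) := contDiff_slice h.contDiffOn_velocity h.zero_mem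
  have hAB' : MeasurableSet (A ×ˢ B) := hA.prod hB
  have hne : ∀ p ∈ A ×ˢ B, p.1 ≠ p.2 := fun p hp heq =>
    Set.disjoint_left.1 hAB hp.1 (heq ▸ hp.2)
  have hneae : ∀ᵐ p ∂(volume.restrict (A ×ˢ B)), p.1 ≠ p.2 :=
    (ae_restrict_iff' hAB').2 (Eventually.of_forall hne)
  let F : ℝ → Space n × Space n → ℝ := fun t p =>
    K (f t p.1 - f t p.2) * (jacobian f t p.1 * jacobian f t p.2)
  let F' : ℝ → Space n × Space n → ℝ := fun t p =>
    fderiv ℝ K (f t p.1 - f t p.2) (velocity f t p.1 - velocity f t p.2) *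
        (jacobian f t p.1 * jacobian f t p.2) +
      K (f t p.1 - f t p.2) * (jacobianVelocity f t p.1 * jacobian f t p.2 +
        jacobian f t p.1 * jacobianVelocity f t p.2)
  have hF0 : F' 0 = fun p => fderiv ℝ K (p.1 - p.2) (velocity f 0 p.1 - velocity f 0 p.2)
      + K (p.1 - p.2) * (divergence (velocity f 0) p.1 + divergence (velocity f 0) p.2) := by
    funext p
    simp only [F', h.zero, h.jacobian_zero, h.jacobianVelocity_zero, mul_one, one_mul]
  have hFm : ∀ t ∈ Ioo (-δ) δ, Measurable (F t) := fun t ht => by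
    have h1 : Measurable (f t) := (contDiff_slice h.smooth ht).continuous.measurable
    have h2 : Measurable (jacobian f t) :=
      (contDiff_slice h.contDiffOn_jacobian ht).continuous.measurable
    have h3 := hK.measurable
    fun_prop
  have hlow : ∀ t ∈ Icc (-a) a, ∀ p : Space n × Space n, p.1 ≠ p.2 →
      f t p.1 - f t p.2 ≠ 0 ∧ ∀ γ : ℝ, γ ≤ 0 →
        ‖f t p.1 - f t p.2‖ ^ γ ≤ 2 ^ (-γ) * ‖p.1 - p.2‖ ^ γ := by
    intro t ht p hp
    have hd : 0 < ‖p.1 - p.2‖ := norm_pos_iff.2 (sub_ne_zero.2 hp)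
    have hw := (hb t ht).2.1 p.1 p.2
    refine ⟨norm_pos_iff.1 (by linarith), fun γ hγ => ?_⟩
    refine (Real.rpow_le_rpow_of_nonpos (by positivity) hw hγ).trans (le_of_eq ?_)
    rw [Real.div_rpow hd.le zero_le_two, Real.rpow_neg zero_le_two]
    field_simp
  have key := hasDerivAt_integral_of_dominated_loc_of_deriv_le (𝕜 := ℝ)
    (μ := volume.restrict (A ×ˢ B)) (F := F) (F' := F') (x₀ := (0 : ℝ)) (s := Icc (-a) a)
    (bound := fun p => (Λ * 2 ^ (β + 1) * M * (M * M) + Λ * 2 ^ β * (M * M + M * M)) *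
      ‖p.1 - p.2‖ ^ (-β))
    (Icc_mem_nhds (by linarith) ha) ?_ ?_ ?_ ?_ ?_ ?_
  · have hcongr : F' 0 =ᵐ[volume.restrict (A ×ˢ B)]
        divergence (kernelField K (velocity f 0)) := by
      filter_upwards [hneae] with p hp
      rw [hF0, divergence_kernelField (hK.differentiableAt (sub_ne_zero.2 hp))
        (hT.differentiable (by simp))]
    refine ⟨key.1.congr hcongr, ?_⟩
    rw [← integral_congr_ae hcongr]
    exact key.2
  · filter_upwards [Ioo_mem_nhds h.zero_mem.1 h.zero_mem.2] with t ht
    exact (hFm t ht).aestronglyMeasurable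
  · refine Integrable.mono' (hint.const_mul Λ) (hFm 0 h.zero_mem).aestronglyMeasurable ?_
    filter_upwards [hneae] with p hp
    simp only [F, h.zero, h.jacobian_zero, mul_one]
    exact hK.bound _ (sub_ne_zero.2 hp)
  · rw [hF0]
    exact (measurable_divergence_kernelField_formula hK.measurable
      (hT.of_le (by simp))).aestronglyMeasurable
  · filter_upwards [hneae] with p hp t ht
    obtain ⟨hw0, hw⟩ := hlow t ht p hp
    obtain ⟨b1, -, -, b4, b5⟩ := hb t ht
    have hd : 0 < ‖p.1 - p.2‖ := norm_pos_iff.2 (sub_ne_zero.2 hp)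
    have hΛ := hK.nonneg
    have e1 : ‖fderiv ℝ K (f t p.1 - f t p.2) (velocity f t p.1 - velocity f t p.2)‖ ≤
        Λ * 2 ^ (β + 1) * M * ‖p.1 - p.2‖ ^ (-β) := by
      refine (ContinuousLinearMap.le_opNorm _ _).trans ?_
      calc _ ≤ (Λ * (2 ^ (-(-β - 1)) * ‖p.1 - p.2‖ ^ (-β - 1))) * (M * ‖p.1 - p.2‖) := by
            gcongr
            · exact (hK.fderiv_bound _ hw0).trans (by gcongr; exact hw _ (by linarith))
            · exact b1 _ _
        _ = Λ * 2 ^ (β + 1) * M * (‖p.1 - p.2‖ ^ (-β - 1) * ‖p.1 - p.2‖) := by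
            rw [show -(-β - 1) = β + 1 by ring]; ring
        _ = _ := by
            rw [← Real.rpow_add_one hd.ne', sub_add_cancel]
    have e2 : |K (f t p.1 - f t p.2)| ≤ Λ * 2 ^ β * ‖p.1 - p.2‖ ^ (-β) := by
      refine (hK.bound _ hw0).trans ?_
      have := hw (-β) (by linarith)
      rw [neg_neg] at this
      calc _ ≤ Λ * (2 ^ β * ‖p.1 - p.2‖ ^ (-β)) := by gcongr
        _ = _ := by ring
    have e3 : ∀ x y, |jacobian f t x * jacobian f t y| ≤ M * M := fun x y => by
      rw [abs_mul]; exact mul_le_mul (b4 x) (b4 y) (abs_nonneg _) hM0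
    have e4 : ∀ x y, |jacobianVelocity f t x * jacobian f t y| ≤ M * M := fun x y => by
      rw [abs_mul]; exact mul_le_mul (b5 x) (b4 y) (abs_nonneg _) hM0
    have e5 : |jacobianVelocity f t p.1 * jacobian f t p.2 +
        jacobian f t p.1 * jacobianVelocity f t p.2| ≤ M * M + M * M :=
      (abs_add_le _ _).trans (add_le_add (e4 _ _) (by rw [mul_comm]; exact e4 _ _))
    simp only [F', Real.norm_eq_abs] at e1 ⊢
    refine (abs_add_le _ _).trans ?_
    rw [abs_mul (fderiv ℝ K _ _), abs_mul (K _)]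
    calc _ ≤ Λ * 2 ^ (β + 1) * M * ‖p.1 - p.2‖ ^ (-β) * (M * M) +
          Λ * 2 ^ β * ‖p.1 - p.2‖ ^ (-β) * (M * M + M * M) :=
          add_le_add (mul_le_mul e1 (e3 _ _) (abs_nonneg _) (by positivity))
            (mul_le_mul e2 e5 (abs_nonneg _) (by positivity))
      _ = _ := by ring
  · exact hint.const_mul _
  · filter_upwards [hneae] with p hp t ht
    have ht' := hsub ht
    have d1 := (h.hasDerivAt_time ht' p.1).fun_sub (h.hasDerivAt_time ht' p.2)
    have d2 := (hK.differentiableAt (hlow t ht p hp).1).hasFDerivAt.comp_hasDerivAt t d1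
    exact HasDerivAt.mul (c := fun t => K (f t p.1 - f t p.2)) d2
      ((h.hasDerivAt_jacobian ht' p.1).fun_mul (h.hasDerivAt_jacobian ht' p.2))

end IsSmoothFamily

theorem interaction_image {K : Space n → ℝ} (hK : Measurable K) {φ : Space n → Space n}
    {φ' : Space n → Space n →L[ℝ] Space n} (hφ : ∀ x, HasFDerivAt φ (φ' x) x)
    (hinj : Function.Injective φ) (hdet : ∀ x, 0 < (φ' x).det) {A B : Set (Space n)}
    (hA : MeasurableSet A) (hB : MeasurableSet B) :
    interaction K (φ '' A) (φ '' B) = ∫⁻ p in A ×ˢ B,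
      ENNReal.ofReal (K (φ p.1 - φ p.2) * ((φ' p.1).det * (φ' p.2).det)) := by
  have hφm : Measurable φ :=
    (continuous_iff_continuousAt.2 fun x => (hφ x).continuousAt).measurable
  have hdm : Measurable fun x => (φ' x).det := by
    have : φ' = fderiv ℝ φ := funext fun x => (hφ x).fderiv.symm
    rw [this]
    exact ContinuousLinearMap.continuous_det.measurable.comp (measurable_fderiv ℝ φ)
  have hcv : ∀ S, MeasurableSet S → ∀ g : Space n → ℝ≥0∞,
      ∫⁻ x in φ '' S, g x = ∫⁻ x in S, ENNReal.ofReal (φ' x).det * g (φ x) := by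
    intro S hS g
    rw [lintegral_image_eq_lintegral_abs_det_fderiv_mul volume hS
      (fun x _ => (hφ x).hasFDerivWithinAt) hinj.injOn]
    simp_rw [abs_of_pos (hdet _)]
  have hm : Measurable fun p : Space n × Space n =>
      ENNReal.ofReal (K (φ p.1 - φ p.2) * ((φ' p.1).det * (φ' p.2).det)) :=
    ((hK.comp ((hφm.comp measurable_fst).sub (hφm.comp measurable_snd))).mul
      ((hdm.comp measurable_fst).mul (hdm.comp measurable_snd))).ennreal_ofReal
  rw [interaction, hcv A hA, Measure.volume_eq_prod, ← Measure.prod_restrict,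
    lintegral_prod _ hm.aemeasurable]
  refine lintegral_congr fun x => ?_
  rw [hcv B hB, ← lintegral_const_mul']
  · refine lintegral_congr fun y => ?_
    rw [← ENNReal.ofReal_mul (hdet y).le, ← ENNReal.ofReal_mul (hdet x).le]
    congr 1
    ring
  · exact ENNReal.ofReal_ne_top

/-- Disjointness and injectivity keep `φ p.1 - φ p.2` nonzero, which is where the sign of `K` is
known; nonnegativity then identifies the lower integral with the Bochner integral. -/
theorem toReal_interaction_image {K : Space n → ℝ} (hK : Measurable K)
    (hK0 : ∀ z, z ≠ 0 → 0 ≤ K z) {φ : Space n → Space n}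
    {φ' : Space n → Space n →L[ℝ] Space n} (hφ : ∀ x, HasFDerivAt φ (φ' x) x)
    (hinj : Function.Injective φ) (hdet : ∀ x, 0 < (φ' x).det) {A B : Set (Space n)}
    (hA : MeasurableSet A) (hB : MeasurableSet B) (hAB : Disjoint A B) :
    (interaction K (φ '' A) (φ '' B)).toReal = ∫ p in A ×ˢ B,
      K (φ p.1 - φ p.2) * ((φ' p.1).det * (φ' p.2).det) := by
  have hφm : Measurable φ :=
    (continuous_iff_continuousAt.2 fun x => (hφ x).continuousAt).measurable
  have hdm : Measurable fun x => (φ' x).det := by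
    have : φ' = fderiv ℝ φ := funext fun x => (hφ x).fderiv.symm
    rw [this]
    exact ContinuousLinearMap.continuous_det.measurable.comp (measurable_fderiv ℝ φ)
  have hm : Measurable fun p : Space n × Space n =>
      K (φ p.1 - φ p.2) * ((φ' p.1).det * (φ' p.2).det) :=
    (hK.comp ((hφm.comp measurable_fst).sub (hφm.comp measurable_snd))).mul
      ((hdm.comp measurable_fst).mul (hdm.comp measurable_snd))
  rw [interaction_image hK hφ hinj hdet hA hB,
    integral_eq_lintegral_of_nonneg_ae _ hm.aestronglyMeasurable]
  refine (ae_restrict_iff' (hA.prod hB)).2 (Eventually.of_forall fun p hp => ?_)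
  refine mul_nonneg (hK0 _ (sub_ne_zero.2 fun heq => ?_)) (mul_pos (hdet _) (hdet _)).le
  exact Set.disjoint_left.1 hAB hp.1 (hinj heq ▸ hp.2)

end Energy

end NonlocalCapillarity

namespace NonlocalCapillarity

/-! ### Volumes of thin sets and of the layer crossed by a translation. -/

section Thin

variable {n : ℕ}

/-- A set of which every translate by `t • v` with `t ≥ τ` is disjoint from itself is thin. -/
theorem volume_le_of_thin {S : Set (Space n)} (hS : MeasurableSet S) {x₀ v : Space n} {ρ τ : ℝ}
    (hρ : 0 < ρ) (hτ : 0 < τ) (hv : ‖v‖ ≤ 1) (hsub : S ⊆ Metric.ball x₀ ρ)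
    (hthin : ∀ x ∈ S, ∀ t, τ ≤ t → x + t • v ∉ S) :
    volume S ≤ ENNReal.ofReal (τ / ρ) * volume (Metric.ball x₀ (2 * ρ)) := by
  set N := ⌈ρ / τ⌉₊ with hN
  have hN0 : ρ / τ ≤ N := Nat.le_ceil _
  have hpos : 0 < ρ / τ := by positivity
  have hlt : (N : ℝ) < ρ / τ + 1 := Nat.ceil_lt_add_one hpos.le
  -- The translates of `S` by `j * τ` along `v`, for `j < N`, are disjoint. Since `j ≤ N - 1 < ρ /
  -- τ` they stay in the ball of radius `2 * ρ`, so `N` copies of `volume S` fit there, with `N ≥ ρ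
  -- / τ`.
  let A : ℕ → Set (Space n) := fun j => (fun x => x + (-((j : ℝ) * τ)) • v) ⁻¹' S
  have hA : ∀ j, volume (A j) = volume S := fun j => measure_preimage_add_right _ _ _
  have hAm : ∀ j, MeasurableSet (A j) := fun j =>
    (by fun_prop : Measurable fun x : Space n => x + (-((j : ℝ) * τ)) • v) hS
  have hlt_disj : ∀ i j : ℕ, i < j → Disjoint (A i) (A j) := by
    intro i j hij
    rw [Set.disjoint_left]
    intro x hi hj
    have hij' : (1 : ℝ) ≤ (j : ℝ) - i := by
      have : (i : ℝ) + 1 ≤ j := by exact_mod_cast hij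
      linarith
    refine hthin _ hj (((j : ℝ) - i) * τ) (by nlinarith) ?_
    have : x + (-((j : ℝ) * τ)) • v + (((j : ℝ) - i) * τ) • v = x + (-((i : ℝ) * τ)) • v := by
      module
    rw [this]
    exact hi
  have hdisj : (↑(Finset.range N) : Set ℕ).PairwiseDisjoint A := by
    intro i _ j _ hij
    rcases lt_or_gt_of_ne hij with h | h
    · exact hlt_disj i j h
    · exact (hlt_disj j i h).symm
  have hUsub : (⋃ j ∈ Finset.range N, A j) ⊆ Metric.ball x₀ (2 * ρ) := by
    intro x hx
    simp only [mem_iUnion, Finset.mem_range] at hx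
    obtain ⟨j, hj, hx⟩ := hx
    have h1 : ‖x + (-((j : ℝ) * τ)) • v - x₀‖ < ρ := mem_ball_iff_norm.1 (hsub hx)
    have hj' : (j : ℝ) + 1 ≤ N := by exact_mod_cast hj
    have h2 : (j : ℝ) * τ < ρ := by
      have : (j : ℝ) < ρ / τ := by linarith
      rwa [lt_div_iff₀ hτ] at this
    rw [mem_ball_iff_norm]
    have e : x - x₀ = (x + (-((j : ℝ) * τ)) • v - x₀) + ((j : ℝ) * τ) • v := by module
    rw [e]
    refine (norm_add_le _ _).trans_lt ?_
    have h3 : ‖((j : ℝ) * τ) • v‖ ≤ (j : ℝ) * τ := by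
      rw [norm_smul, Real.norm_of_nonneg (by positivity)]
      exact mul_le_of_le_one_right (by positivity) hv
    linarith
  have hsum : (N : ℝ≥0∞) * volume S ≤ volume (Metric.ball x₀ (2 * ρ)) := by
    refine le_trans (le_of_eq ?_) (measure_mono hUsub)
    rw [measure_biUnion_finset hdisj fun j _ => hAm j]
    simp [hA]
  calc volume S = ENNReal.ofReal (τ / ρ) * (ENNReal.ofReal (ρ / τ) * volume S) := by
        rw [← mul_assoc, ← ENNReal.ofReal_mul (by positivity), div_mul_div_cancel₀ hρ.ne',
          div_self hτ.ne', ENNReal.ofReal_one, one_mul]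
    _ ≤ ENNReal.ofReal (τ / ρ) * (N * volume S) := by
        gcongr
        rw [← ENNReal.ofReal_natCast]
        exact ENNReal.ofReal_le_ofReal hN0
    _ ≤ _ := by gcongr

theorem exists_mem_frontier_of_segment {Ω : Set (Space n)} (hΩ : IsOpen Ω) {x y : Space n}
    (hx : x ∈ Ω) (hy : y ∉ Ω) : ∃ q ∈ frontier Ω, q ∈ segment ℝ x y := by
  by_contra! hcon
  have hpre : IsPreconnected (segment ℝ x y) := (convex_segment x y).isPreconnected
  have := hpre.subset_left_of_subset_union hΩ isClosed_closure.isOpen_compl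
    (disjoint_compl_right.mono_left subset_closure) (fun z hz => by
      by_cases hzc : z ∈ closure Ω
      · left
        by_contra hzΩ
        exact hcon z ⟨hzc, by rwa [hΩ.interior_eq]⟩ hz
      · exact Or.inr hzc) ⟨x, left_mem_segment ℝ x y, hx⟩
  exact hy (this (right_mem_segment ℝ x y))

/-- Uniform bounds for a `C¹` function with nonvanishing differential near a point. -/
theorem exists_ball_fderiv_bounds {φ : Space n → ℝ} {x : Space n} (hφ : ContDiffAt ℝ 1 φ x)
    (hx : fderiv ℝ φ x ≠ 0) : ∃ v : Space n, ‖v‖ ≤ 1 ∧ ∃ c > 0, ∃ L > 0, ∀ᶠ y in 𝓝 x,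
      DifferentiableAt ℝ φ y ∧ c ≤ fderiv ℝ φ y v ∧ ‖fderiv ℝ φ y‖ ≤ L := by
  obtain ⟨u, hu⟩ : ∃ u, 0 < fderiv ℝ φ x u := by
    by_contra! hcon
    refine hx (ContinuousLinearMap.ext fun u => le_antisymm (hcon u) ?_)
    have := hcon (-u)
    rw [map_neg] at this
    simpa using this
  have hu0 : u ≠ 0 := fun h => by simp [h] at hu
  have hupos : 0 < ‖u‖ := norm_pos_iff.2 hu0
  set v := ‖u‖⁻¹ • u with hv
  have hfv : 0 < fderiv ℝ φ x v := by
    rw [hv, map_smul]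
    exact mul_pos (by positivity) hu
  have hcont : ContinuousAt (fderiv ℝ φ) x :=
    (hφ.fderiv_right (m := 0) (by simp)).continuousAt
  refine ⟨v, ?_, fderiv ℝ φ x v / 2, by positivity, ‖fderiv ℝ φ x‖ + 1, by positivity, ?_⟩
  · rw [hv, norm_smul, norm_inv, norm_norm, inv_mul_cancel₀ hupos.ne']
  · have h1 : ∀ᶠ y in 𝓝 x, fderiv ℝ φ x v / 2 < fderiv ℝ φ y v :=
      (hcont.clm_apply continuousAt_const).eventually_const_lt (by linarith)
    have h2 : ∀ᶠ y in 𝓝 x, ‖fderiv ℝ φ y‖ < ‖fderiv ℝ φ x‖ + 1 :=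
      hcont.norm.eventually_lt_const (by linarith)
    filter_upwards [hφ.eventually (by simp), h1, h2] with y hy1 hy2 hy3
    exact ⟨hy1.differentiableAt one_ne_zero, hy2.le, hy3.le⟩

/-- If `y ∈ Ω` and `y + h ∉ Ω`, then `-(L * ‖h‖) ≤ φ y < 0`. As `φ` grows at rate at least `c` along
`v`, a line in that direction meets this layer in length at most `L * ‖h‖ / c`, so the layer is
thin. -/
theorem exists_volume_shift_le_local {Ω : Set (Space n)} (hΩo : IsOpen Ω) {x : Space n}
    {φ : Space n → ℝ} (hφ : IsC1DefiningFunctionAt Ω x φ) :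
    ∃ C r : ℝ, 0 ≤ C ∧ 0 < r ∧ ∀ h : Space n, ‖h‖ ≤ r →
      volume {y | y ∈ Ω ∧ y + h ∉ Ω ∧ ∃ q ∈ Metric.ball x r, dist y q ≤ ‖h‖} ≤
        ENNReal.ofReal (C * ‖h‖) := by
  obtain ⟨v, hv, c, hc, L, hL, hev⟩ := exists_ball_fderiv_bounds hφ.contDiffAt hφ.fderiv_ne_zero
  obtain ⟨R, hR, hball⟩ := Metric.eventually_nhds_iff_ball.1 (hev.and hφ.mem_iff)
  -- With `q` within `r` of `x` and `‖h‖ ≤ r`, the point `y` stays within `2 * r` and `y + h` within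
  -- `3 * r = R`.
  set r := R / 3 with hr
  have hr0 : 0 < r := by positivity
  set V := volume (Metric.ball x (2 * (2 * r))) with hV
  have hVtop : V ≠ ⊤ := measure_ball_lt_top.ne
  refine ⟨L / c / (2 * r) * V.toReal, r, by positivity, hr0, fun h hh => ?_⟩
  rcases eq_or_ne h 0 with rfl | hh0
  · have : {y | y ∈ Ω ∧ y + 0 ∉ Ω ∧ ∃ q ∈ Metric.ball x r, dist y q ≤ ‖(0 : Space n)‖} = ∅ := by
      ext y
      simp only [add_zero, mem_ofPred_eq, mem_empty_iff_false, iff_false]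
      exact fun hy => hy.2.1 hy.1
    rw [this, measure_empty]
    exact zero_le
  have hpos : 0 < ‖h‖ := norm_pos_iff.2 hh0
  set S := {y | y ∈ Ω ∧ y + h ∉ Ω} ∩ Metric.ball x (2 * r) with hS
  have hSm : MeasurableSet S :=
    (hΩo.measurableSet.inter ((hΩo.preimage (continuous_add_const h)).measurableSet.compl)).inter
      measurableSet_ball
  have hsub : {y | y ∈ Ω ∧ y + h ∉ Ω ∧ ∃ q ∈ Metric.ball x r, dist y q ≤ ‖h‖} ⊆ S := by
    rintro y ⟨hy1, hy2, q, hq, hyq⟩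
    refine ⟨⟨hy1, hy2⟩, ?_⟩
    rw [Metric.mem_ball] at hq ⊢
    linarith [dist_triangle y q x]
  have hlow : ∀ y ∈ S, -(L * ‖h‖) ≤ φ y ∧ φ y < 0 := by
    rintro y ⟨⟨hy1, hy2⟩, hy3⟩
    have hyR : y ∈ Metric.ball x R := Metric.ball_subset_ball (by linarith) hy3
    have hyhR : y + h ∈ Metric.ball x R := by
      rw [Metric.mem_ball] at hy3 ⊢
      have : dist (y + h) y = ‖h‖ := by rw [dist_eq_norm, add_sub_cancel_left]
      linarith [dist_triangle (y + h) y x]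
    have h1 : φ y < 0 := (hball y hyR).2.1 hy1
    have h2 : 0 ≤ φ (y + h) := not_lt.1 fun hcon => hy2 ((hball _ hyhR).2.2 hcon)
    have h3 := (convex_ball x R).norm_image_sub_le_of_norm_hasFDerivWithin_le
      (f := φ) (f' := fderiv ℝ φ) (C := L)
      (fun z hz => ((hball z hz).1.1.hasFDerivAt).hasFDerivWithinAt)
      (fun z hz => (hball z hz).1.2.2) hyR hyhR
    rw [add_sub_cancel_left, Real.norm_eq_abs] at h3
    exact ⟨by linarith [le_abs_self (φ (y + h) - φ y)], h1⟩
  have hthin : ∀ y ∈ S, ∀ t, L * ‖h‖ / c ≤ t → y + t • v ∉ S := by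
    intro y hy t ht hyt
    have ht0 : 0 < t := lt_of_lt_of_le (by positivity) ht
    have hyR : y ∈ Metric.ball x R := Metric.ball_subset_ball (by linarith) hy.2
    have hytR : y + t • v ∈ Metric.ball x R := Metric.ball_subset_ball (by linarith) hyt.2
    have hseg : ∀ s ∈ Icc 0 t, y + s • v ∈ Metric.ball x R := by
      intro s hs
      have : y + s • v = (1 - s / t) • y + (s / t) • (y + t • v) := by
        rw [smul_add, smul_smul, div_mul_cancel₀ _ ht0.ne']; module
      rw [this]
      exact (convex_ball x R) hyR hytR (sub_nonneg.2 ((div_le_one ht0).2 hs.2))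
        (div_nonneg hs.1 ht0.le) (by ring)
    have hder : ∀ s ∈ Icc 0 t, HasDerivAt (fun s : ℝ => φ (y + s • v))
        (fderiv ℝ φ (y + s • v) v) s := fun s hs => by
      have h1 : HasDerivAt (fun s : ℝ => y + s • v) v s := by
        simpa using ((hasDerivAt_id s).smul_const v).const_add y
      exact (hball _ (hseg s hs)).1.1.hasFDerivAt.comp_hasDerivAt s h1
    have hmv := (convex_Icc 0 t).mul_sub_le_image_sub_of_le_deriv
      (f := fun s : ℝ => φ (y + s • v)) (C := c)
      (fun s hs => (hder s hs).continuousAt.continuousWithinAt)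
      (fun s hs => (hder s (interior_subset hs)).differentiableAt.differentiableWithinAt)
      (fun s hs => by
        rw [(hder s (interior_subset hs)).deriv]
        exact (hball _ (hseg s (interior_subset hs))).1.2.1)
      0 ⟨le_rfl, ht0.le⟩ t ⟨ht0.le, le_rfl⟩ ht0.le
    simp only [sub_zero, zero_smul, add_zero] at hmv
    have h1 := (hlow y hy).1
    have h2 := (hlow _ hyt).2
    rw [div_le_iff₀ hc] at ht
    linarith
  have := volume_le_of_thin hSm (x₀ := x) (ρ := 2 * r) (τ := L * ‖h‖ / c) (by positivity)
    (by positivity) hv inter_subset_right hthin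
  refine (measure_mono hsub).trans (this.trans (le_of_eq ?_))
  rw [← hV, ← ENNReal.ofReal_toReal hVtop, ← ENNReal.ofReal_mul (by positivity),
    ENNReal.toReal_ofReal ENNReal.toReal_nonneg]
  congr 1
  ring

/-- The measure of the part of a bounded `C¹` domain that a translation moves out of it. -/
theorem exists_volume_shift_le {Ω : Set (Space n)} (hΩo : IsOpen Ω)
    (hΩb : Bornology.IsBounded Ω) (hΩ : HasC1Boundary Ω) :
    ∃ C : ℝ, 0 ≤ C ∧ ∀ h : Space n,
      volume {y | y ∈ Ω ∧ y + h ∉ Ω} ≤ ENNReal.ofReal (C * ‖h‖) := by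
  have hcomp : IsCompact (frontier Ω) :=
    Metric.isCompact_of_isClosed_isBounded isClosed_frontier
      (hΩb.closure.subset frontier_subset_closure)
  have key : ∃ C r : ℝ, 0 ≤ C ∧ 0 < r ∧ ∀ h : Space n, ‖h‖ ≤ r →
      volume {y | y ∈ Ω ∧ y + h ∉ Ω ∧ ∃ q ∈ frontier Ω, dist y q ≤ ‖h‖} ≤
        ENNReal.ofReal (C * ‖h‖) := by
    -- The clause on `q ∈ S` attaches each point to a piece of the boundary, which makes the
    -- estimate subadditive in `S`, as the compactness induction requires.
    refine hcomp.induction_on (p := fun S => ∃ C r : ℝ, 0 ≤ C ∧ 0 < r ∧ ∀ h : Space n, ‖h‖ ≤ r →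
      volume {y | y ∈ Ω ∧ y + h ∉ Ω ∧ ∃ q ∈ S, dist y q ≤ ‖h‖} ≤ ENNReal.ofReal (C * ‖h‖)) ?_ ?_ ?_ ?_
    · exact ⟨0, 1, le_rfl, one_pos, fun h _ => by simp⟩
    · rintro S S' hSS ⟨C, r, hC, hr, H⟩
      refine ⟨C, r, hC, hr, fun h hh => (measure_mono ?_).trans (H h hh)⟩
      rintro y ⟨h1, h2, q, hq, h3⟩
      exact ⟨h1, h2, q, hSS hq, h3⟩
    · rintro S S' ⟨C, r, hC, hr, H⟩ ⟨C', r', hC', hr', H'⟩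
      refine ⟨C + C', min r r', by positivity, by positivity, fun h hh => ?_⟩
      have hsub : {y | y ∈ Ω ∧ y + h ∉ Ω ∧ ∃ q ∈ S ∪ S', dist y q ≤ ‖h‖} ⊆
          {y | y ∈ Ω ∧ y + h ∉ Ω ∧ ∃ q ∈ S, dist y q ≤ ‖h‖} ∪
          {y | y ∈ Ω ∧ y + h ∉ Ω ∧ ∃ q ∈ S', dist y q ≤ ‖h‖} := by
        rintro y ⟨h1, h2, q, hq | hq, h3⟩
        · exact Or.inl ⟨h1, h2, q, hq, h3⟩
        · exact Or.inr ⟨h1, h2, q, hq, h3⟩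
      refine (measure_mono hsub).trans ((measure_union_le _ _).trans ?_)
      rw [add_mul, ENNReal.ofReal_add (by positivity) (by positivity)]
      exact add_le_add (H h (hh.trans (min_le_left _ _))) (H' h (hh.trans (min_le_right _ _)))
    · intro x hx
      obtain ⟨φ, hφ⟩ := hΩ x hx
      obtain ⟨C, r, hC, hr, H⟩ := exists_volume_shift_le_local hΩo hφ
      exact ⟨Metric.ball x r, mem_nhdsWithin_of_mem_nhds (Metric.ball_mem_nhds x hr), C, r, hC, hr, H⟩
  obtain ⟨C, r, hC, hr, H⟩ := key
  have hΩfin : volume Ω ≠ ⊤ := hΩb.measure_lt_top.ne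
  -- For `‖h‖ ≤ r` the segment from `y` to `y + h` crosses the boundary and the local estimate
  -- applies; for larger `h` the trivial bound `volume Ω` is at most `volume Ω / r * ‖h‖`.
  refine ⟨C + (volume Ω).toReal / r, by positivity, fun h => ?_⟩
  rw [add_mul, ENNReal.ofReal_add (by positivity) (by positivity)]
  rcases le_total ‖h‖ r with hh | hh
  · refine le_trans ((measure_mono ?_).trans (H h hh)) le_self_add
    rintro y ⟨h1, h2⟩
    obtain ⟨q, hq, hqs⟩ := exists_mem_frontier_of_segment hΩo h1 h2
    refine ⟨h1, h2, q, hq, ?_⟩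
    obtain ⟨θ, hθ, rfl⟩ := (segment_eq_image' ℝ y (y + h)) ▸ hqs
    rw [dist_eq_norm]
    simp only [add_sub_cancel_left]
    rw [sub_add_cancel_left, norm_neg, norm_smul, Real.norm_of_nonneg hθ.1]
    exact mul_le_of_le_one_left (norm_nonneg _) hθ.2
  · refine le_trans ((measure_mono (fun y hy => hy.1)).trans ?_) le_add_self
    rw [← ENNReal.ofReal_toReal hΩfin, ENNReal.toReal_ofReal ENNReal.toReal_nonneg]
    refine ENNReal.ofReal_le_ofReal ?_
    rw [div_mul_eq_mul_div, le_div_iff₀ hr]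
    gcongr

end Thin

end NonlocalCapillarity

namespace NonlocalCapillarity

/-! ### Integrability of the singular weight. -/

section Integrability

variable {n : ℕ}

theorem integrableOn_rpow_ball (hn : 1 ≤ n) {β : ℝ} (hβ : β < n) (r : ℝ) :
    IntegrableOn (fun x : Space n => ‖x‖ ^ (-β)) (Metric.ball 0 r) := by
  refine integrableOn_ball_of_norm_le_rpow (by simpa using hn) (C := 1) (α := β) (by simpa using hβ)
    (Eventually.of_forall fun x => ?_) (by fun_prop : Measurable _).aestronglyMeasurable
  rw [one_mul, Real.norm_of_nonneg (by positivity)]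

theorem integrableOn_rpow_compl_ball {β : ℝ} (hβ : n < β) {r : ℝ} (hr : 0 < r) :
    IntegrableOn (fun x : Space n => ‖x‖ ^ (-β)) (Metric.ball 0 r)ᶜ := by
  have hβ0 : 0 < β := lt_of_le_of_lt (by positivity) hβ
  have h1 : Integrable (fun x : Space n => (1 + ‖x‖) ^ (-β)) :=
    integrable_one_add_norm (by simpa using hβ)
  refine Integrable.mono' (h1.integrableOn.const_mul ((r / (1 + r)) ^ (-β)))
    (by fun_prop : Measurable _).aestronglyMeasurable ?_
  refine (ae_restrict_iff' measurableSet_ball.compl).2 (Eventually.of_forall fun x hx => ?_)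
  have hx' : r ≤ ‖x‖ := by simpa using hx
  rw [Real.norm_of_nonneg (by positivity), ← Real.mul_rpow (by positivity) (by positivity)]
  refine Real.rpow_le_rpow_of_nonpos (by positivity) ?_ (by linarith)
  rw [div_mul_eq_mul_div, div_le_iff₀ (by positivity)]
  nlinarith

theorem integrableOn_rpow_compl_ball_center {β : ℝ} (hβ : n < β) {r : ℝ} (hr : 0 < r)
    (x : Space n) : IntegrableOn (fun y : Space n => ‖x - y‖ ^ (-β)) (Metric.ball x r)ᶜ := by
  have h := (integrableOn_rpow_compl_ball hβ hr)
  rw [← integrable_indicator_iff measurableSet_ball.compl] at h ⊢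
  have := h.comp_sub_left x
  refine this.congr (Eventually.of_forall fun y => ?_)
  simp only [indicator, mem_compl_iff, Metric.mem_ball, dist_eq_norm, sub_zero, norm_sub_rev y x]

theorem integrableOn_rpow_of_lintegral_lt_top {A B : Set (Space n)} {β : ℝ}
    (h : ∫⁻ x in A, ∫⁻ y in B, ENNReal.ofReal (‖x - y‖ ^ (-β)) < ⊤) :
    IntegrableOn (fun p : Space n × Space n => ‖p.1 - p.2‖ ^ (-β)) (A ×ˢ B) := by
  have hm : Measurable fun p : Space n × Space n => ‖p.1 - p.2‖ ^ (-β) := by fun_prop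
  refine ⟨hm.aestronglyMeasurable, ?_⟩
  rw [hasFiniteIntegral_iff_ofReal (Eventually.of_forall fun p => by positivity),
    Measure.volume_eq_prod, ← Measure.prod_restrict,
    lintegral_prod _ hm.ennreal_ofReal.aemeasurable]
  exact h

/-- With `h = y - x` the double integral becomes the integral of `‖h‖ ^ (-(n + s))` times the volume
that translation by `h` moves out of `Ω`. That volume is `O(‖h‖)`, which suffices near 0 as `s < 1`;
it is at most the volume of `Ω`, which suffices at infinity as `s > 0`. -/
theorem integrableOn_rpow_domain (hn : 1 ≤ n) {Ω : Set (Space n)} (hΩo : IsOpen Ω)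
    (hΩb : Bornology.IsBounded Ω) (hΩ : HasC1Boundary Ω) {s : ℝ} (hs : s ∈ Ioo (0 : ℝ) 1) :
    IntegrableOn (fun p : Space n × Space n => ‖p.1 - p.2‖ ^ (-((n : ℝ) + s))) (Ω ×ˢ Ωᶜ) := by
  refine integrableOn_rpow_of_lintegral_lt_top ?_
  set β := (n : ℝ) + s with hβ
  obtain ⟨C, hC, H⟩ := exists_volume_shift_le hΩo hΩb hΩ
  have hΩfin : volume Ω ≠ ⊤ := hΩb.measure_lt_top.ne
  let w : Space n → ℝ≥0∞ := fun h => ENNReal.ofReal (‖h‖ ^ (-β))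
  have hw : Measurable w := by fun_prop
  have e1 : ∀ x, ∫⁻ y in Ωᶜ, ENNReal.ofReal (‖x - y‖ ^ (-β)) =
      ∫⁻ h, Ωᶜ.indicator (fun _ => w h) (x + h) := by
    intro x
    rw [← lintegral_indicator hΩo.measurableSet.compl,
      ← lintegral_add_left_eq_self _ x]
    refine lintegral_congr fun h => ?_
    simp only [indicator, w, sub_add_cancel_left, norm_neg]
  have hm2 : MeasurableSet {p : Space n × Space n | p.1 + p.2 ∉ Ω} :=
    (hΩo.preimage (by fun_prop : Continuous fun p : Space n × Space n => p.1 + p.2)).measurableSet.compl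
  have e2 : ∫⁻ x in Ω, ∫⁻ y in Ωᶜ, ENNReal.ofReal (‖x - y‖ ^ (-β)) =
      ∫⁻ h, w h * volume {y | y ∈ Ω ∧ y + h ∉ Ω} := by
    simp_rw [e1]
    rw [lintegral_lintegral_swap]
    · refine lintegral_congr fun h => ?_
      have hmS : MeasurableSet {y : Space n | y + h ∉ Ω} :=
        (hΩo.preimage (continuous_add_const h)).measurableSet.compl
      have : ∀ x : Space n, Ωᶜ.indicator (fun _ => w h) (x + h) =
          {y : Space n | y + h ∉ Ω}.indicator (fun _ => w h) x := fun x => rfl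
      simp_rw [this]
      rw [lintegral_indicator hmS, lintegral_const, Measure.restrict_restrict hmS,
        Measure.restrict_apply_univ]
      congr 2
      ext y
      exact and_comm
    · have : Function.uncurry (fun x h : Space n => Ωᶜ.indicator (fun _ => w h) (x + h)) =
          {p : Space n × Space n | p.1 + p.2 ∉ Ω}.indicator (fun p => w p.2) := by
        funext p; rfl
      rw [this]
      exact ((hw.comp measurable_snd).indicator hm2).aemeasurable
  rw [e2, ← lintegral_add_compl _ (measurableSet_ball (x := (0 : Space n)) (ε := 1))]
  refine ENNReal.add_lt_top.2 ⟨?_, ?_⟩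
  · have hint := (integrableOn_rpow_ball hn (β := β - 1) (by rw [hβ]; linarith [hs.2]) 1).const_mul C
    refine lt_of_le_of_lt (lintegral_mono_ae ?_)
      ((hasFiniteIntegral_iff_ofReal (Eventually.of_forall fun x => by positivity)).1 hint.2)
    have hne : ∀ᵐ h : Space n ∂(volume.restrict (Metric.ball 0 1)), h ≠ 0 := by
      have : Nonempty (Fin n) := ⟨⟨0, hn⟩⟩
      exact ae_restrict_of_ae (Measure.ae_ne volume 0)
    filter_upwards [hne] with h hh
    have hpos : 0 < ‖h‖ := norm_pos_iff.2 hh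
    refine (mul_le_mul_right (H h) _).trans (le_of_eq ?_)
    rw [← ENNReal.ofReal_mul (by positivity)]
    congr 1
    rw [neg_sub, sub_eq_add_neg, add_comm (1 : ℝ), Real.rpow_add_one hpos.ne']
    ring
  · have hint := integrableOn_rpow_compl_ball (n := n) (β := β) (by rw [hβ]; linarith [hs.1]) one_pos
    refine lt_of_le_of_lt (lintegral_mono fun h => mul_le_mul_right
      (measure_mono (fun y hy => hy.1) : _ ≤ volume Ω) _) ?_
    rw [lintegral_mul_const _ hw]
    exact ENNReal.mul_lt_top
      ((hasFiniteIntegral_iff_ofReal (Eventually.of_forall fun x => by positivity)).1 hint.2)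
      hΩfin.lt_top

/-- Pairs closer than a real radius `r ≤ ϱ` are controlled by the lower bound on `K` and the finite
interaction; for the others the weight is at most `r ^ (-β)` on a set of finite measure. -/
theorem IsKernel.integrableOn_rpow {s lam : ℝ} {ϱ : ℝ≥0∞} {K : Space n → ℝ}
    (hK : IsKernel n s lam ϱ K) (hs : 0 < s) (hlam : 1 ≤ lam) (hϱ : 0 < ϱ) {A B : Set (Space n)}
    (hA : MeasurableSet A) (hB : MeasurableSet B) (hAB : Disjoint A B) (hAfin : volume A ≠ ⊤)
    (hBfin : volume B ≠ ⊤) (hfin : interaction K A B ≠ ⊤) :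
    IntegrableOn (fun p : Space n × Space n => ‖p.1 - p.2‖ ^ (-((n : ℝ) + s))) (A ×ˢ B) := by
  refine integrableOn_rpow_of_lintegral_lt_top ?_
  set β := (n : ℝ) + s with hβ
  have hβ0 : 0 < β := by positivity
  obtain ⟨r, hr, hrϱ⟩ : ∃ r : ℝ, 0 < r ∧ ENNReal.ofReal r ≤ ϱ := by
    rcases eq_or_ne ϱ ⊤ with h | h
    · exact ⟨1, one_pos, h ▸ le_top⟩
    · exact ⟨ϱ.toReal, ENNReal.toReal_pos hϱ.ne' h, ENNReal.ofReal_toReal_le⟩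
  have hlam0 : 0 < lam := by linarith
  have hpt : ∀ x ∈ A, ∀ y ∈ B, ENNReal.ofReal (‖x - y‖ ^ (-β)) ≤
      ENNReal.ofReal lam * ENNReal.ofReal (K (x - y)) + ENNReal.ofReal (r ^ (-β)) := by
    intro x hx y hy
    have hne : x - y ≠ 0 := sub_ne_zero.2 fun h => Set.disjoint_left.1 hAB hx (h ▸ hy)
    have hd : 0 < ‖x - y‖ := norm_pos_iff.2 hne
    rcases lt_or_ge ‖x - y‖ r with h | h
    · refine le_trans ?_ le_self_add
      rw [← ENNReal.ofReal_mul hlam0.le]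
      refine ENNReal.ofReal_le_ofReal ?_
      have hmem : x - y ∈ Metric.eball (0 : Space n) ϱ := by
        rw [Metric.mem_eball, edist_dist, dist_zero_right]
        exact (ENNReal.ofReal_lt_ofReal_iff hr |>.2 h).trans_le hrϱ
      have h1 := hK.lower _ hne
      rw [indicator_of_mem hmem, Pi.one_apply, div_le_iff₀ (by positivity)] at h1
      rw [Real.rpow_neg hd.le, inv_le_iff_one_le_mul₀ (by positivity)]
      linarith
    · refine le_trans ?_ le_add_self
      exact ENNReal.ofReal_le_ofReal (Real.rpow_le_rpow_of_nonpos hr h (by linarith))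
  calc ∫⁻ x in A, ∫⁻ y in B, ENNReal.ofReal (‖x - y‖ ^ (-β))
      ≤ ∫⁻ x in A, (ENNReal.ofReal lam * (∫⁻ y in B, ENNReal.ofReal (K (x - y))) +
          ENNReal.ofReal (r ^ (-β)) * volume B) := by
        refine setLIntegral_mono' hA fun x hx => ?_
        refine (setLIntegral_mono' hB fun y hy => hpt x hx y hy).trans ?_
        rw [lintegral_add_right _ measurable_const, lintegral_const_mul' _ _ ENNReal.ofReal_ne_top,
          lintegral_const, Measure.restrict_apply_univ]
    _ = ENNReal.ofReal lam * interaction K A B +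
          ENNReal.ofReal (r ^ (-β)) * volume B * volume A := by
        rw [lintegral_add_right _ measurable_const, lintegral_const_mul' _ _ ENNReal.ofReal_ne_top,
          lintegral_const, Measure.restrict_apply_univ, interaction]
    _ < ⊤ := by
        refine ENNReal.add_lt_top.2 ⟨ENNReal.mul_lt_top ENNReal.ofReal_lt_top hfin.lt_top,
          ENNReal.mul_lt_top (ENNReal.mul_lt_top ENNReal.ofReal_lt_top hBfin.lt_top) hAfin.lt_top⟩

theorem IsKernelOfClass.isSingularKernel {s lam : ℝ} {ϱ : ℝ≥0∞} {K : Space n → ℝ}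
    (hK : IsKernelOfClass 1 n s lam ϱ K) (hlam : 1 ≤ lam) :
    IsSingularKernel K lam ((n : ℝ) + s) where
  nonneg := by linarith
  contDiffOn := by exact_mod_cast hK.contDiffOn
  bound z hz := by
    rw [abs_of_nonneg (hK.nonneg z hz), Real.rpow_neg (norm_nonneg z), ← div_eq_mul_inv]
    exact hK.upper z hz
  fderiv_bound z hz := by
    have := hK.deriv_bound 1 le_rfl le_rfl z hz
    rw [norm_iteratedFDeriv_one, Nat.cast_one] at this
    rwa [show -((n : ℝ) + s) - 1 = -((n : ℝ) + s + 1) by ring, Real.rpow_neg (norm_nonneg z),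
      ← div_eq_mul_inv]

end Integrability

end NonlocalCapillarity

namespace NonlocalCapillarity

/-! ### The implicit function that restores the volume. -/

section Implicit

theorem isInvertible_of_apply_one_ne_zero {A : ℝ →L[ℝ] ℝ} (h : A 1 ≠ 0) : A.IsInvertible := by
  refine ⟨ContinuousLinearEquiv.unitsEquivAut ℝ (Units.mk0 (A 1) h), ?_⟩
  ext
  simp

/-- A smooth scalar implicit function at a point where the first partial derivative vanishes. -/
theorem exists_contDiffOn_implicit {V : ℝ × ℝ → ℝ} {U : Set (ℝ × ℝ)} (hU : IsOpen U)
    (h0 : (0, 0) ∈ U) (hV : ContDiffOn ℝ ∞ V U) (h₁ : fderiv ℝ V (0, 0) (1, 0) = 0)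
    (h₂ : fderiv ℝ V (0, 0) (0, 1) ≠ 0) :
    ∃ δ > 0, ∃ s : ℝ → ℝ, ContDiffOn ℝ ∞ s (Ioo (-δ) δ) ∧ s 0 = 0 ∧ HasDerivAt s 0 0 ∧
      ∀ t ∈ Ioo (-δ) δ, (t, s t) ∈ U ∧ V (t, s t) = V (0, 0) := by
  have hVat : ∀ p ∈ U, ContDiffAt ℝ ∞ V p := fun p hp => hV.contDiffAt (hU.mem_nhds hp)
  have hinv : ∀ p, fderiv ℝ V p (0, 1) ≠ 0 → (fderiv ℝ V p ∘L .inr ℝ ℝ ℝ).IsInvertible :=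
    fun p hp => isInvertible_of_apply_one_ne_zero (by simpa using hp)
  have c0 := hVat _ h0
  set ψ := c0.implicitFunction (by simp) (hinv _ h₂) with hψ
  have hψ0 : ψ 0 = 0 := c0.implicitFunction_apply_self (by simp) (hinv _ h₂)
  have hψc : ContDiffAt ℝ ∞ ψ 0 := c0.contDiffAt_implicitFunction (by simp) (hinv _ h₂)
  have hψd : HasDerivAt ψ 0 0 := by
    have h := (c0.hasStrictFDerivAt_implicitFunction (by simp) (hinv _ h₂)).hasFDerivAt.hasDerivAt
    have e : (-(fderiv ℝ V (0, 0) ∘L .inr ℝ ℝ ℝ).inverse ∘L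
        (fderiv ℝ V (0, 0) ∘L .inl ℝ ℝ ℝ)) 1 = 0 := by
      simp [h₁]
    rwa [e] at h
  have hψe : ∀ᶠ t in 𝓝 (0 : ℝ), V (t, ψ t) = V (0, 0) :=
    c0.eventually_apply_implicitFunction (by simp) (hinv _ h₂)
  have hiff : ∀ᶠ v in 𝓝 ((0 : ℝ), (0 : ℝ)), V v = V (0, 0) ↔ ψ v.1 = v.2 :=
    c0.eventually_apply_eq_iff_implicitFunction (by simp) (hinv _ h₂)
  have hgc : ∀ᶠ v in 𝓝 ((0 : ℝ), (0 : ℝ)), fderiv ℝ V v (0, 1) ≠ 0 :=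
    (((c0.fderiv_right (m := 0) (by simp)).continuousAt).clm_apply continuousAt_const).eventually_ne h₂
  have hgraph : Tendsto (fun t => (t, ψ t)) (𝓝 0) (𝓝 ((0 : ℝ), (0 : ℝ))) := by
    have : ContinuousAt (fun t => (t, ψ t)) 0 := continuousAt_id.prodMk hψc.continuousAt
    simpa [ContinuousAt, hψ0] using this
  have hall := hgraph.eventually
    ((hiff.eventually_nhds).and (hgc.and (hU.mem_nhds h0 : ∀ᶠ v in 𝓝 ((0 : ℝ), (0 : ℝ)), v ∈ U)))
  obtain ⟨δ, hδ, hball⟩ := Metric.eventually_nhds_iff_ball.1 (hall.and hψe)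
  rw [Real.ball_eq_Ioo, zero_sub, zero_add] at hball
  refine ⟨δ, hδ, ψ, fun t ht => ?_, hψ0, hψd, fun t ht => ⟨(hball t ht).1.2.2, (hball t ht).2⟩⟩
  obtain ⟨⟨hb1, hb2, hb3⟩, hb4⟩ := hball t ht
  -- Smoothness of `ψ` at 0 to every finite order gives no common interval. At each `t` the theorem
  -- is therefore applied anew at `(t, ψ t)`; the local uniqueness around the origin identifies the
  -- new solution `χ` with `ψ` near `t`.
  have ct := hVat _ hb3
  have hχ0 := ct.implicitFunction_apply_self (by simp) (hinv _ hb2)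
  have hχc := ct.contDiffAt_implicitFunction (by simp) (hinv _ hb2)
  have hχe := ct.eventually_apply_implicitFunction (by simp) (hinv _ hb2)
  set χ := ct.implicitFunction (by simp) (hinv _ hb2) with hχ
  refine (hχc.congr_of_eventuallyEq ?_).contDiffWithinAt
  have htend : Tendsto (fun r => (r, χ r)) (𝓝 t) (𝓝 (t, ψ t)) := by
    have : ContinuousAt (fun r => (r, χ r)) t := continuousAt_id.prodMk hχc.continuousAt
    rw [ContinuousAt, hχ0] at this
    exact this
  filter_upwards [htend.eventually hb1, hχe] with r hr1 hr2
  exact hr1.1 (hr2.trans hb4)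

end Implicit

/-! ### Integrals over a fixed set depending on parameters. -/

section ParametricIntegral

variable {n : ℕ}

/-- The integral is the value at 0 of the convolution of the indicator of `E` with the reflection of
`u p`, so smoothness of convolutions with a parameter applies. -/
theorem contDiffOn_setIntegral {P : Type*} [NormedAddCommGroup P] [NormedSpace ℝ P]
    {U : Set P} (hU : IsOpen U) {k : Set (Space n)} (hk : IsCompact k) {u : P → Space n → ℝ}
    (h0 : ∀ p ∈ U, ∀ x ∉ k, u p x = 0)
    (hu : ContDiffOn ℝ ∞ (fun q : P × Space n => u q.1 q.2) (U ×ˢ univ)) {E : Set (Space n)}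
    (hE : MeasurableSet E) : ContDiffOn ℝ ∞ (fun p => ∫ x in E, u p x) U := by
  have hloc : LocallyIntegrable (E.indicator fun _ => (1 : ℝ)) (volume : Measure (Space n)) :=
    (locallyIntegrable_const 1).indicator hE
  have key := contDiffOn_convolution_right_with_param (𝕜 := ℝ) (n := ⊤) (μ := volume)
    (ContinuousLinearMap.lsmul ℝ ℝ) (g := fun p x => u p (-x)) (s := U) (k := -k) hU hk.neg
    (fun p x hp hx => h0 p hp (-x) (by simpa using hx)) hloc
    (by
      have : ContDiff ℝ ∞ fun q : P × Space n => (q.1, -q.2) := by fun_prop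
      exact hu.comp this.contDiffOn fun q hq => ⟨hq.1, trivial⟩)
  have h1 : ContDiff ℝ ∞ fun p : P => (p, (0 : Space n)) := by fun_prop
  refine (key.comp h1.contDiffOn fun p hp => ⟨hp, trivial⟩).congr fun p hp => ?_
  simp only [Function.comp, convolution, ContinuousLinearMap.lsmul_apply, zero_sub, neg_neg]
  rw [← integral_indicator hE]
  congr 1
  funext x
  by_cases hx : x ∈ E <;> simp [hx]

/-- The time derivative vanishes off `C`, so a constant dominates it on the bounded set `E`. The
case `g = 1` is the variation of volume; the case where `g` is a Jacobian yields that variation at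
later times along a flow. -/
theorem IsSmoothFamily.hasDerivAt_integral_pullback {δ : ℝ} {C : Set (Space n)}
    {f : ℝ → Space n → Space n} (h : IsSmoothFamily δ C f) {g : Space n → ℝ}
    (hg : ContDiff ℝ 1 g) {E : Set (Space n)}
    (hEb : Bornology.IsBounded E) :
    IntegrableOn (divergence fun x => g x • velocity f 0 x) E ∧
      HasDerivAt (fun t => ∫ x in E, g (f t x) * jacobian f t x)
        (∫ x in E, divergence (fun x => g x • velocity f 0 x) x) 0 := by
  have hEfin : volume E ≠ ⊤ := hEb.measure_lt_top.ne
  have hT : ContDiff ℝ ∞ (velocity f 0) := contDiff_slice h.contDiffOn_velocity h.zero_mem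
  have hfc := h.smooth.continuousOn
  have hjc := h.contDiffOn_jacobian.continuousOn
  let u' : ℝ → Space n → ℝ := fun t x => fderiv ℝ g (f t x) (velocity f t x) * jacobian f t x +
    g (f t x) * jacobianVelocity f t x
  have hu'c : ContinuousOn (fun p : ℝ × Space n => u' p.1 p.2) (Ioo (-δ) δ ×ˢ univ) := by
    refine ContinuousOn.add (ContinuousOn.mul (ContinuousOn.clm_apply ?_
      h.contDiffOn_velocity.continuousOn) hjc) (ContinuousOn.mul ?_
        h.contDiffOn_jacobianVelocity.continuousOn)
    · exact (hg.continuous_fderiv one_ne_zero).comp_continuousOn hfc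
    · exact hg.continuous.comp_continuousOn hfc
  obtain ⟨M, hM, hb⟩ := h.exists_bound hu'c (fun t ht x hx => by
    simp only [u', h.velocity_eq_zero ht hx, h.jacobianVelocity_eq_zero ht hx, map_zero, zero_mul,
      mul_zero, add_zero])
  have hsub : Icc (-(δ / 2)) (δ / 2) ⊆ Ioo (-δ) δ := fun t ht =>
    ⟨by linarith [ht.1, h.pos], by linarith [ht.2, h.pos]⟩
  have hslice : ∀ {w : ℝ → Space n → ℝ},
      ContinuousOn (fun p : ℝ × Space n => w p.1 p.2) (Ioo (-δ) δ ×ˢ univ) →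
      ∀ t ∈ Ioo (-δ) δ, Continuous (w t) := fun hw t ht =>
    continuousOn_univ.1 (hw.comp (f := fun x : Space n => (t, x))
      (by fun_prop) fun x _ => ⟨ht, trivial⟩)
  have hu0 : u' 0 = divergence fun x => g x • velocity f 0 x := by
    funext x
    rw [divergence_smul (hg.differentiable one_ne_zero x) (hT.differentiable (by simp) x)]
    simp only [u', h.zero, h.jacobian_zero, h.jacobianVelocity_zero, mul_one]
    ring
  have huc : ContinuousOn (fun p : ℝ × Space n => g (f p.1 p.2) * jacobian f p.1 p.2)
      (Ioo (-δ) δ ×ˢ univ) := (hg.continuous.comp_continuousOn hfc).mul hjc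
  have key := hasDerivAt_integral_of_dominated_loc_of_deriv_le (𝕜 := ℝ)
    (μ := volume.restrict E) (F := fun t x => g (f t x) * jacobian f t x) (F' := u')
    (x₀ := (0 : ℝ)) (s := Icc (-(δ / 2)) (δ / 2)) (bound := fun _ => M)
    (Icc_mem_nhds (by linarith [h.pos]) (by linarith [h.pos])) ?_ ?_ ?_ ?_ ?_ ?_
  · rw [hu0] at key
    exact key
  · filter_upwards [Ioo_mem_nhds h.zero_mem.1 h.zero_mem.2] with t ht
    exact (hslice (w := fun t x => g (f t x) * jacobian f t x) huc t ht).aestronglyMeasurable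
  · exact ((hslice (w := fun t x => g (f t x) * jacobian f t x) huc 0
      h.zero_mem).continuousOn.integrableOn_compact
        (hEb.isCompact_closure)).mono_set subset_closure
  · exact (hslice hu'c 0 h.zero_mem).aestronglyMeasurable
  · exact Eventually.of_forall fun x t ht => hb t ht x
  · exact integrableOn_const hEfin
  · refine Eventually.of_forall fun x t ht => ?_
    have d1 := ((hg.differentiable one_ne_zero (f t x)).hasFDerivAt).comp_hasDerivAt t
      (h.hasDerivAt_time (hsub ht) x)
    exact HasDerivAt.mul (c := fun t => g (f t x)) d1 (h.hasDerivAt_jacobian (hsub ht) x)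

end ParametricIntegral

end NonlocalCapillarity

namespace NonlocalCapillarity

/-! ### Volume preserving variations built from two flows. -/

section Variations

variable {n : ℕ}

theorem det_clm_comp {W : Type*} [NormedAddCommGroup W] [NormedSpace ℝ W] (A B : W →L[ℝ] W) :
    (A ∘L B).det = A.det * B.det := LinearMap.det_comp _ _

/-- A smooth compactly supported vector field. -/
structure IsTestField (T : Space n → Space n) : Prop where
  contDiff : ContDiff ℝ ∞ T
  hasCompactSupport : HasCompactSupport T

theorem IsTestField.exists_lipschitzWith {T : Space n → Space n} (hT : IsTestField T) :
    ∃ L : ℝ≥0, LipschitzWith L T :=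
  hT.contDiff.lipschitzWith_of_hasCompactSupport hT.hasCompactSupport (by simp)

theorem IsTestField.exists_flow {T : Space n → Space n} (hT : IsTestField T) :
    ∃ Φ : ℝ → Space n → Space n, IsFlow T Φ := by
  obtain ⟨L, hL⟩ := hT.exists_lipschitzWith
  obtain ⟨M, hM⟩ := hT.hasCompactSupport.exists_bound_of_continuous hT.contDiff.continuous
  exact exists_isFlow hL (M := M.toNNReal) fun x => (hM x).trans (Real.le_coe_toNNReal M)

theorem IsTestField.smul {T : Space n → Space n} (hT : IsTestField T) {u : Space n → ℝ}
    (hu : ContDiff ℝ ∞ u) : IsTestField fun x => u x • T x :=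
  ⟨ContDiff.smul hu hT.contDiff, HasCompactSupport.smul_left (f := u) hT.hasCompactSupport⟩

theorem IsTestField.add {S T : Space n → Space n} (hS : IsTestField S) (hT : IsTestField T) :
    IsTestField fun x => S x + T x :=
  ⟨hS.contDiff.add hT.contDiff, hS.hasCompactSupport.add hT.hasCompactSupport⟩

theorem IsTangentToBoundary.smul {Ω : Set (Space n)} {T : Space n → Space n}
    (hT : IsTangentToBoundary Ω T) (u : Space n → ℝ) : IsTangentToBoundary Ω fun x => u x • T x :=
  fun x hx ν hν => by rw [inner_smul_left, hT x hx ν hν, mul_zero]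

theorem IsTangentToBoundary.add {Ω : Set (Space n)} {S T : Space n → Space n}
    (hS : IsTangentToBoundary Ω S) (hT : IsTangentToBoundary Ω T) :
    IsTangentToBoundary Ω fun x => S x + T x :=
  fun x hx ν hν => by rw [inner_add_left, hS x hx ν hν, hT x hx ν hν, add_zero]

theorem IsFlow.isSmoothFamily {T : Space n → Space n} {Φ : ℝ → Space n → Space n}
    (hΦ : IsFlow T Φ) (hT : IsTestField T) : ∃ δ, IsSmoothFamily δ (tsupport T) Φ := by
  obtain ⟨L, hL⟩ := hT.exists_lipschitzWith
  have hL1 : (0 : ℝ) < L + 1 := by positivity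
  -- Within this time span `|t| * L < 1`, the range where smoothness of the flow is known; the 1
  -- covers `L = 0`.
  refine ⟨1 / (L + 1), by positivity, hT.hasCompactSupport, ?_, hΦ.zero, ?_⟩
  · rintro ⟨t, x⟩ ⟨ht, -⟩
    refine (hΦ.contDiffAt hL hT.contDiff hT.hasCompactSupport ?_ x).contDiffWithinAt
    have h1 : |t| < 1 / (L + 1) := abs_lt.2 ht
    rw [lt_div_iff₀ hL1] at h1
    nlinarith [abs_nonneg t]
  · intro t _ x hx
    exact hΦ.eq_self hL (image_eq_zero_of_notMem_tsupport hx) t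

theorem IsFlow.velocity_zero {T : Space n → Space n} {Φ : ℝ → Space n → Space n}
    (hΦ : IsFlow T Φ) {δ : ℝ} {C : Set (Space n)} (h : IsSmoothFamily δ C Φ) :
    velocity Φ 0 = T := by
  funext x
  rw [(h.hasDerivAt_time h.zero_mem x).unique (hΦ.hasDerivAt 0 x), hΦ.zero]

theorem IsFlow.injective {T : Space n → Space n} {Φ : ℝ → Space n → Space n}
    (hΦ : IsFlow T Φ) (hT : IsTestField T) (t : ℝ) : Function.Injective (Φ t) := by
  obtain ⟨L, hL⟩ := hT.exists_lipschitzWith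
  exact Function.LeftInverse.injective (hΦ.neg_apply hL t)

/-- The composition of two families, the second one reparametrized in time. -/
def compFamily (f g : ℝ → Space n → Space n) (s : ℝ → ℝ) (t : ℝ) (x : Space n) : Space n :=
  f t (g (s t) x)

theorem IsSmoothFamily.comp {δ₁ δ₂ δ : ℝ} {C₁ C₂ : Set (Space n)}
    {f g : ℝ → Space n → Space n} (hf : IsSmoothFamily δ₁ C₁ f) (hg : IsSmoothFamily δ₂ C₂ g)
    (hδ : 0 < δ) (hδ₁ : δ ≤ δ₁) {s : ℝ → ℝ} (hs : ContDiffOn ℝ ∞ s (Ioo (-δ) δ)) (hs0 : s 0 = 0)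
    (hsm : ∀ t ∈ Ioo (-δ) δ, s t ∈ Ioo (-δ₂) δ₂) :
    IsSmoothFamily δ (C₁ ∪ C₂) (compFamily f g s) where
  pos := hδ
  isCompact := hf.isCompact.union hg.isCompact
  smooth := by
    have h1 : ContDiffOn ℝ ∞ (fun p : ℝ × Space n => (s p.1, p.2)) (Ioo (-δ) δ ×ˢ univ) :=
      (hs.comp contDiffOn_fst fun p hp => hp.1).prodMk contDiffOn_snd
    have h2 : ContDiffOn ℝ ∞ (fun p : ℝ × Space n => g (s p.1) p.2) (Ioo (-δ) δ ×ˢ univ) :=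
      hg.smooth.comp h1 fun p hp => ⟨hsm _ hp.1, trivial⟩
    exact hf.smooth.comp (contDiffOn_fst.prodMk h2) fun p hp =>
      ⟨Ioo_subset_Ioo (neg_le_neg hδ₁) hδ₁ hp.1, trivial⟩
  zero x := by rw [compFamily, hs0, hg.zero, hf.zero]
  eq_self t ht x hx := by
    rw [compFamily, hg.eq_self _ (hsm t ht) x fun h => hx (Or.inr h),
      hf.eq_self t (Ioo_subset_Ioo (neg_le_neg hδ₁) hδ₁ ht) x fun h => hx (Or.inl h)]

/-- Since `s` has zero derivative at 0, the correcting family is invisible to first order. -/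
theorem IsSmoothFamily.velocity_comp {δ₁ δ₂ δ : ℝ} {C₁ C₂ C : Set (Space n)}
    {f g : ℝ → Space n → Space n} (hf : IsSmoothFamily δ₁ C₁ f) (hg : IsSmoothFamily δ₂ C₂ g)
    {s : ℝ → ℝ} (h : IsSmoothFamily δ C (compFamily f g s)) (hs0 : s 0 = 0)
    (hs : HasDerivAt s 0 0) : velocity (compFamily f g s) 0 = velocity f 0 := by
  funext x
  have h1 : HasDerivAt (fun t => g (s t) x) 0 0 := by
    have e : HasDerivAt (fun r => g r x) (velocity g 0 x) (s 0) := by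
      rw [hs0]
      exact hg.hasDerivAt_time hg.zero_mem x
    have e' := HasDerivAt.scomp (g₁ := fun r => g r x) (0 : ℝ) e hs
    rw [zero_smul] at e'
    exact e'
  have h2 := h.hasDerivAt_time h.zero_mem x
  have h3 : HasFDerivAt (fun p : ℝ × Space n => f p.1 p.2)
      (fderiv ℝ (fun p : ℝ × Space n => f p.1 p.2) (0, x)) (0, g (s 0) x) := by
    rw [hs0, hg.zero]
    exact hf.hasFDerivAt hf.zero_mem x
  have h4 : HasDerivAt (fun t : ℝ => (t, g (s t) x)) ((1 : ℝ), (0 : Space n)) 0 :=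
    (hasDerivAt_id' (0 : ℝ)).prodMk h1
  have h5 := HasFDerivAt.comp_hasDerivAt (f := fun t : ℝ => (t, g (s t) x)) (0 : ℝ) h3 h4
  have h6 : velocity f 0 x = fderiv ℝ (fun p : ℝ × Space n => f p.1 p.2) (0, x) (1, 0) := rfl
  rw [h6]
  exact h2.unique h5

/-- The composite is a separate family `h`, so that the rule serves both for `compFamily` and for
the group law of a flow. -/
theorem IsSmoothFamily.jacobian_comp {δ₁ δ₂ : ℝ} {C₁ C₂ : Set (Space n)}
    {f g h : ℝ → Space n → Space n} (hf : IsSmoothFamily δ₁ C₁ f) (hg : IsSmoothFamily δ₂ C₂ g)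
    {δ : ℝ} {C : Set (Space n)} (hh : IsSmoothFamily δ C h) {t r u : ℝ}
    (ht : t ∈ Ioo (-δ₁) δ₁) (hr : r ∈ Ioo (-δ₂) δ₂) (hu : u ∈ Ioo (-δ) δ)
    (heq : ∀ x, h u x = f t (g r x)) (x : Space n) :
    jacobian h u x = jacobian f t (g r x) * jacobian g r x := by
  have h1 := hh.hasFDerivAt_space hu x
  have h2 := (hf.hasFDerivAt_space ht (g r x)).comp x (hg.hasFDerivAt_space hr x)
  have h3 : h u = f t ∘ g r := funext heq
  rw [h3] at h1
  rw [jacobian, h1.unique h2, det_clm_comp, jacobian, jacobian]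

theorem IsSmoothFamily.volume_image {δ : ℝ} {C : Set (Space n)} {f : ℝ → Space n → Space n}
    (h : IsSmoothFamily δ C f) {t : ℝ} (ht : t ∈ Ioo (-δ) δ) (hinj : Function.Injective (f t))
    (hpos : ∀ x, 0 < jacobian f t x) {E : Set (Space n)} (hE : MeasurableSet E)
    (hEb : Bornology.IsBounded E) :
    volume (f t '' E) = ENNReal.ofReal (∫ x in E, jacobian f t x) := by
  rw [← lintegral_abs_det_fderiv_eq_addHaar_image volume hE
    (fun x _ => (h.hasFDerivAt_space ht x).hasFDerivWithinAt) hinj.injOn,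
    ofReal_integral_eq_lintegral_ofReal]
  · refine lintegral_congr fun x => ?_
    rw [← jacobian, abs_of_pos (hpos x)]
  · exact ((contDiff_slice h.contDiffOn_jacobian ht).continuous.continuousOn.integrableOn_compact
      hEb.isCompact_closure).mono_set subset_closure
  · exact Eventually.of_forall fun x => (hpos x).le

/-- The composite of the two flows has the inverse `Ψ (-s t) ∘ Φ (-t)`, and each factor preserves
`Ω` by tangency. -/
theorem exists_variation {Ω E : Set (Space n)} (hΩo : IsOpen Ω) (hΩ : HasC1Boundary Ω)
    {S T : Space n → Space n} (hS : IsTestField S) (hT : IsTestField T)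
    (hSt : IsTangentToBoundary Ω S) (hTt : IsTangentToBoundary Ω T)
    {Φ Ψ : ℝ → Space n → Space n} (hΦ : IsFlow S Φ) (hΨ : IsFlow T Ψ)
    {δ₁ δ₂ δ : ℝ} {C₁ C₂ : Set (Space n)} (hΦf : IsSmoothFamily δ₁ C₁ Φ)
    (hΨf : IsSmoothFamily δ₂ C₂ Ψ) (hδ : 0 < δ) (hδ₁ : δ ≤ δ₁) {s : ℝ → ℝ}
    (hs : ContDiffOn ℝ ∞ s (Ioo (-δ) δ)) (hs0 : s 0 = 0) (hsd : HasDerivAt s 0 0)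
    (hsm : ∀ t ∈ Ioo (-δ) δ, s t ∈ Ioo (-δ₂) δ₂)
    (hvol : ∀ t ∈ Ioo (-δ) δ, volume (compFamily Φ Ψ s t '' E) = volume E) :
    ∃ f : ℝ → (Space n ≃ₘ[ℝ] Space n), ∃ C, IsSmoothFamily δ C (fun t x => f t x) ∧
      IsVolumePreservingVariation Ω E δ f ∧ velocity (fun t x => f t x) 0 = S := by
  obtain ⟨LS, hLS⟩ := hS.exists_lipschitzWith
  obtain ⟨LT, hLT⟩ := hT.exists_lipschitzWith
  have hfam := hΦf.comp hΨf hδ hδ₁ hs hs0 hsm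
  have hneg : ∀ {t a : ℝ}, t ∈ Ioo (-a) a → -t ∈ Ioo (-a) a := fun ht =>
    ⟨by linarith [ht.2], by linarith [ht.1]⟩
  have hsub : Ioo (-δ) δ ⊆ Ioo (-δ₁) δ₁ := Ioo_subset_Ioo (neg_le_neg hδ₁) hδ₁
  let F : ∀ t, t ∈ Ioo (-δ) δ → (Space n ≃ₘ[ℝ] Space n) := fun t ht =>
    { toFun := compFamily Φ Ψ s t
      invFun := fun x => Ψ (-s t) (Φ (-t) x)
      left_inv := fun x => by
        change Ψ (-s t) (Φ (-t) (Φ t (Ψ (s t) x))) = x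
        rw [hΦ.neg_apply hLS, hΨ.neg_apply hLT]
      right_inv := fun x => by
        change Φ t (Ψ (s t) (Ψ (-s t) (Φ (-t) x))) = x
        rw [hΨ.apply_neg hLT, hΦ.apply_neg hLS]
      contMDiff_toFun := (IsSmoothFamily.contDiff_slice hfam.smooth ht).contMDiff
      contMDiff_invFun := ((IsSmoothFamily.contDiff_slice hΨf.smooth (hneg (hsm t ht))).comp
        (IsSmoothFamily.contDiff_slice hΦf.smooth (hneg (hsub ht)))).contMDiff }
  classical
  -- A variation assigns a diffeomorphism to every real time; outside the interval the identity is a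
  -- filler.
  let f : ℝ → (Space n ≃ₘ[ℝ] Space n) := fun t =>
    if ht : t ∈ Ioo (-δ) δ then F t ht else Diffeomorph.refl _ _ _
  have hf : ∀ t ∈ Ioo (-δ) δ, ∀ x, f t x = compFamily Φ Ψ s t x := by
    intro t ht x
    simp only [f, dif_pos ht]
    rfl
  have hf' : ∀ t ∈ Ioo (-δ) δ, (f t : Space n → Space n) = compFamily Φ Ψ s t :=
    fun t ht => funext (hf t ht)
  have hsmooth : ContDiffOn ℝ ∞ (fun p : ℝ × Space n => f p.1 p.2) (Ioo (-δ) δ ×ˢ univ) :=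
    hfam.smooth.congr fun p hp => hf p.1 hp.1 p.2
  have h0 : (0 : ℝ) ∈ Ioo (-δ) δ := ⟨by linarith, hδ⟩
  have hff : IsSmoothFamily δ (C₁ ∪ C₂) (fun t x => f t x) :=
    ⟨hδ, hfam.isCompact, hsmooth, fun x => by rw [hf 0 h0, hfam.zero],
      fun t ht x hx => by rw [hf t ht, hfam.eq_self t ht x hx]⟩
  refine ⟨f, C₁ ∪ C₂, hff, ⟨hsmooth, hff.zero, fun t ht => ?_, fun t ht => ?_, fun t ht => ?_⟩, ?_⟩
  · refine HasCompactSupport.intro hfam.isCompact fun x hx => ?_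
    rw [hf t ht, hfam.eq_self t ht x hx, sub_self]
  · rw [hf' t ht]
    have : compFamily Φ Ψ s t '' Ω = Φ t '' (Ψ (s t) '' Ω) := by
      rw [image_image]; rfl
    rw [this, hΨ.image_eq hTt hΩo hΩ hLT, hΦ.image_eq hSt hΩo hΩ hLS]
  · rw [hf' t ht, hvol t ht]
  · have hv : velocity (fun t x => f t x) 0 = velocity (compFamily Φ Ψ s) 0 := by
      funext x
      refine (hff.hasDerivAt_time h0 x).unique ((hfam.hasDerivAt_time h0 x).congr_of_eventuallyEq ?_)
      filter_upwards [Ioo_mem_nhds h0.1 h0.2] with t ht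
      exact hf t ht x
    rw [hv, hΦf.velocity_comp hΨf hfam hs0 hsd, hΦ.velocity_zero hΦf]

end Variations

end NonlocalCapillarity

namespace NonlocalCapillarity

/-! ### First variation of the energy and the Lagrange multiplier. -/

section WeakEquation

variable {n : ℕ}

/-- The data of the capillarity problem, with the integrability that makes the first variation
meaningful. -/
structure IsAdmissible (K₁ K₂ : Space n → ℝ) (Λ β₁ β₂ : ℝ) (g : Space n → ℝ)
    (Ω E : Set (Space n)) : Prop where
  β₁_nonneg : 0 ≤ β₁
  β₂_nonneg : 0 ≤ β₂
  singular₁ : IsSingularKernel K₁ Λ β₁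
  singular₂ : IsSingularKernel K₂ Λ β₂
  nonneg₁ : ∀ z, z ≠ 0 → 0 ≤ K₁ z
  nonneg₂ : ∀ z, z ≠ 0 → 0 ≤ K₂ z
  contDiff : ContDiff ℝ 1 g
  isOpen : IsOpen Ω
  isBounded : Bornology.IsBounded Ω
  hasC1Boundary : HasC1Boundary Ω
  measurableSet : MeasurableSet E
  subset : E ⊆ Ω
  integrableOn₁ : IntegrableOn (fun p : Space n × Space n => ‖p.1 - p.2‖ ^ (-β₁)) (E ×ˢ (Eᶜ ∩ Ω))
  integrableOn₂ : IntegrableOn (fun p : Space n × Space n => ‖p.1 - p.2‖ ^ (-β₂)) (E ×ˢ Ωᶜ)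

/-- The first variation of the capillarity energy along a vector field. -/
noncomputable def firstVariation (K₁ K₂ : Space n → ℝ) (σ : ℝ) (g : Space n → ℝ)
    (Ω E : Set (Space n)) (T : Space n → Space n) : ℝ :=
  (∫ p in E ×ˢ (Eᶜ ∩ Ω), divergence (kernelField K₁ T) p)
    + σ * (∫ p in E ×ˢ Ωᶜ, divergence (kernelField K₂ T) p)
    + ∫ x in E, divergence (fun x => g x • T x) x

theorem divergence_kernelField_add_smul {K : Space n → ℝ} {Λ β : ℝ}
    (hK : IsSingularKernel K Λ β) {S T : Space n → Space n} (hS : IsTestField S)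
    (hT : IsTestField T) (a : ℝ) {p : Space n × Space n} (hp : p.1 ≠ p.2) :
    divergence (kernelField K fun x => S x + a • T x) p =
      divergence (kernelField K S) p + a * divergence (kernelField K T) p := by
  have hKd := hK.differentiableAt (sub_ne_zero.2 hp)
  have dS : Differentiable ℝ S := hS.contDiff.differentiable (by simp)
  have dT : Differentiable ℝ T := hT.contDiff.differentiable (by simp)
  have hdiv : ∀ x, divergence (fun x => S x + a • T x) x = divergence S x + a * divergence T x := by
    intro x
    rw [divergence_add (dS x) ((dT x).fun_const_smul a), divergence_const_smul a (dT x)]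
  rw [divergence_kernelField hKd (dS.fun_add (dT.fun_const_smul a)), divergence_kernelField hKd dS,
    divergence_kernelField hKd dT, hdiv, hdiv,
    show S p.1 + a • T p.1 - (S p.2 + a • T p.2) = (S p.1 - S p.2) + a • (T p.1 - T p.2) by
      rw [smul_sub]; abel, map_add, map_smul, smul_eq_mul]
  ring

namespace IsAdmissible

variable {K₁ K₂ : Space n → ℝ} {Λ β₁ β₂ σ : ℝ} {g : Space n → ℝ} {Ω E : Set (Space n)}

theorem disjoint₁ : Disjoint E (Eᶜ ∩ Ω) :=
  disjoint_compl_right.mono_right inter_subset_left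

theorem disjoint₂ (h : IsAdmissible K₁ K₂ Λ β₁ β₂ g Ω E) : Disjoint E Ωᶜ :=
  disjoint_compl_right.mono_left h.subset

theorem measurableSet₁ (h : IsAdmissible K₁ K₂ Λ β₁ β₂ g Ω E) : MeasurableSet (Eᶜ ∩ Ω) :=
  h.measurableSet.compl.inter h.isOpen.measurableSet

theorem measurableSet₂ (h : IsAdmissible K₁ K₂ Λ β₁ β₂ g Ω E) : MeasurableSet Ωᶜ :=
  h.isOpen.measurableSet.compl

theorem isBounded_set (h : IsAdmissible K₁ K₂ Λ β₁ β₂ g Ω E) : Bornology.IsBounded E :=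
  h.isBounded.subset h.subset

theorem integrableOn_of_continuous (h : IsAdmissible K₁ K₂ Λ β₁ β₂ g Ω E) {u : Space n → ℝ}
    (hu : Continuous u) : IntegrableOn u E :=
  (hu.continuousOn.integrableOn_compact h.isBounded_set.isCompact_closure).mono_set subset_closure

/-- Every test field is the initial velocity of its own flow, so integrability is part of the
differentiation under the integral. -/
theorem integrableOn_divergence (h : IsAdmissible K₁ K₂ Λ β₁ β₂ g Ω E) {T : Space n → Space n}
    (hT : IsTestField T) :
    IntegrableOn (divergence (kernelField K₁ T)) (E ×ˢ (Eᶜ ∩ Ω)) ∧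
      IntegrableOn (divergence (kernelField K₂ T)) (E ×ˢ Ωᶜ) ∧
      IntegrableOn (divergence fun x => g x • T x) E := by
  obtain ⟨Φ, hΦ⟩ := hT.exists_flow
  obtain ⟨δ, hfam⟩ := hΦ.isSmoothFamily hT
  rw [← hΦ.velocity_zero hfam]
  exact ⟨(hfam.hasDerivAt_integral_kernel h.β₁_nonneg h.singular₁ h.measurableSet
      h.measurableSet₁ disjoint₁ h.integrableOn₁).1,
    (hfam.hasDerivAt_integral_kernel h.β₂_nonneg h.singular₂ h.measurableSet
      h.measurableSet₂ h.disjoint₂ h.integrableOn₂).1,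
    (hfam.hasDerivAt_integral_pullback h.contDiff h.isBounded_set).1⟩

theorem firstVariation_add_smul (h : IsAdmissible K₁ K₂ Λ β₁ β₂ g Ω E) {S T : Space n → Space n}
    (hS : IsTestField S) (hT : IsTestField T) (a : ℝ) :
    firstVariation K₁ K₂ σ g Ω E (fun x => S x + a • T x) =
      firstVariation K₁ K₂ σ g Ω E S + a * firstVariation K₁ K₂ σ g Ω E T := by
  obtain ⟨iS₁, iS₂, iS₃⟩ := h.integrableOn_divergence hS
  obtain ⟨iT₁, iT₂, iT₃⟩ := h.integrableOn_divergence hT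
  have key : ∀ {K : Space n → ℝ} {Λ β : ℝ} (_ : IsSingularKernel K Λ β) {B : Set (Space n)}
      (_ : MeasurableSet B) (_ : Disjoint E B)
      (_ : IntegrableOn (divergence (kernelField K S)) (E ×ˢ B))
      (_ : IntegrableOn (divergence (kernelField K T)) (E ×ˢ B)),
      ∫ p in E ×ˢ B, divergence (kernelField K fun x => S x + a • T x) p =
        (∫ p in E ×ˢ B, divergence (kernelField K S) p) +
          a * ∫ p in E ×ˢ B, divergence (kernelField K T) p := by
    intro K Λ β hK B hB hEB i₁ i₂
    rw [← integral_const_mul, ← integral_add i₁ (i₂.const_mul a)]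
    refine setIntegral_congr_fun (h.measurableSet.prod hB) fun p hp => ?_
    exact divergence_kernelField_add_smul hK hS hT a fun heq =>
      Set.disjoint_left.1 hEB hp.1 (heq ▸ hp.2)
  have key3 : ∫ x in E, divergence (fun x => g x • (S x + a • T x)) x =
      (∫ x in E, divergence (fun x => g x • S x) x) +
        a * ∫ x in E, divergence (fun x => g x • T x) x := by
    rw [← integral_const_mul, ← integral_add iS₃ (iT₃.const_mul a)]
    refine setIntegral_congr_fun h.measurableSet fun x _ => ?_
    have dg : Differentiable ℝ g := h.contDiff.differentiable one_ne_zero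
    have dS := (dg.fun_smul (hS.contDiff.differentiable (by simp))) x
    have dT := (dg.fun_smul (hT.contDiff.differentiable (by simp))) x
    have e : (fun x => g x • (S x + a • T x)) = fun x => g x • S x + a • (g x • T x) := by
      funext x
      rw [smul_add, smul_comm]
    rw [e, divergence_add dS (dT.fun_const_smul a), divergence_const_smul a dT]
  rw [firstVariation, firstVariation, firstVariation,
    key h.singular₁ h.measurableSet₁ disjoint₁ iS₁ iT₁,
    key h.singular₂ h.measurableSet₂ h.disjoint₂ iS₂ iT₂, key3]
  ring

/-- As `f t` is a bijection that preserves `Ω`, the sets `(f t '' E)ᶜ ∩ Ω` and `Ωᶜ` are the images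
of `Eᶜ ∩ Ω` and `Ωᶜ`; a change of variables then moves all dependence on `t` into the integrands. -/
theorem hasDerivAt_energy (h : IsAdmissible K₁ K₂ Λ β₁ β₂ g Ω E) {δ : ℝ} {C : Set (Space n)}
    {f : ℝ → (Space n ≃ₘ[ℝ] Space n)} (hf : IsSmoothFamily δ C fun t x => f t x)
    (hΩ : ∀ t ∈ Ioo (-δ) δ, f t '' Ω = Ω) :
    HasDerivAt (fun t => capillarityEnergy K₁ K₂ σ g Ω (f t '' E))
      (firstVariation K₁ K₂ σ g Ω E (velocity (fun t x => f t x) 0)) 0 := by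
  obtain ⟨a, M, ha, haδ, -, hb⟩ := hf.exists_uniform_bounds
  have d₁ := (hf.hasDerivAt_integral_kernel h.β₁_nonneg h.singular₁ h.measurableSet
      h.measurableSet₁ disjoint₁ h.integrableOn₁).2
  have d₂ := (hf.hasDerivAt_integral_kernel h.β₂_nonneg h.singular₂ h.measurableSet
      h.measurableSet₂ h.disjoint₂ h.integrableOn₂).2
  have d₃ := (hf.hasDerivAt_integral_pullback h.contDiff h.isBounded_set).2
  refine ((d₁.fun_add (d₂.const_mul σ)).fun_add d₃).congr_of_eventuallyEq ?_
  filter_upwards [Ioo_mem_nhds (neg_lt_zero.2 ha) ha] with t ht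
  have htδ : t ∈ Ioo (-δ) δ := Ioo_subset_Ioo (neg_le_neg haδ.le) haδ.le ht
  have hpos := (hb t (Ioo_subset_Icc_self ht)).2.2.1
  have hbij : Function.Bijective (f t) := (f t).bijective
  have hc : ∀ A : Set (Space n), (f t '' A)ᶜ = f t '' Aᶜ := fun A => (image_compl_eq hbij).symm
  have e₁ : (f t '' E)ᶜ ∩ Ω = f t '' (Eᶜ ∩ Ω) := by
    rw [image_inter hbij.1, ← hc, hΩ t htδ]
  have e₂ : Ωᶜ = f t '' Ωᶜ := by rw [← hc, hΩ t htδ]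
  have hd := fun x => hf.hasFDerivAt_space htδ x
  have e₃ : ∫ x in f t '' E, g x = ∫ x in E, g (f t x) * jacobian (fun t x => f t x) t x := by
    rw [integral_image_eq_integral_abs_det_fderiv_smul volume h.measurableSet
      (fun x _ => (hd x).hasFDerivWithinAt) hbij.1.injOn]
    refine setIntegral_congr_fun h.measurableSet fun x _ => ?_
    simp only [smul_eq_mul]
    rw [← jacobian, abs_of_pos (hpos x), mul_comm]
  rw [capillarityEnergy, e₃, e₁]
  have e₄ : interaction K₂ (f t '' E) Ωᶜ = interaction K₂ (f t '' E) (f t '' Ωᶜ) := by rw [← e₂]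
  rw [e₄, toReal_interaction_image h.singular₁.measurable h.nonneg₁ hd hbij.1 hpos h.measurableSet
    h.measurableSet₁ disjoint₁, toReal_interaction_image h.singular₂.measurable h.nonneg₂ hd hbij.1
    hpos h.measurableSet h.measurableSet₂ h.disjoint₂]
  rfl

theorem hasDerivAt_integral_jacobian (h : IsAdmissible K₁ K₂ Λ β₁ β₂ g Ω E) {δ : ℝ}
    {C : Set (Space n)} {f : ℝ → Space n → Space n} (hf : IsSmoothFamily δ C f) :
    HasDerivAt (fun t => ∫ x in E, jacobian f t x) (∫ x in E, divergence (velocity f 0) x) 0 := by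
  have := (hf.hasDerivAt_integral_pullback (g := fun _ => 1) contDiff_const h.isBounded_set).2
  simpa only [one_mul, one_smul] using this

/-- The hypothesis `hvol` says through Jacobians that the corrected flow preserves the volume of
`E`. The energy along it is then differentiated twice over: by `hasDerivAt_energy`, and as zero by
criticality. -/
theorem firstVariation_eq_zero {m : ℝ} (h : IsAdmissible K₁ K₂ Λ β₁ β₂ g Ω E)
    (hcrit : IsVolumeConstrainedCritical K₁ K₂ σ g Ω m E) {S T : Space n → Space n}
    (hS : IsTestField S) (hT : IsTestField T)
    (hSt : IsTangentToBoundary Ω S) (hTt : IsTangentToBoundary Ω T)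
    {Φ Ψ : ℝ → Space n → Space n} (hΦ : IsFlow S Φ) (hΨ : IsFlow T Ψ)
    {δ₁ δ₂ δ : ℝ} {C₁ C₂ : Set (Space n)} (hΦf : IsSmoothFamily δ₁ C₁ Φ)
    (hΨf : IsSmoothFamily δ₂ C₂ Ψ) (hδ : 0 < δ) (hδ₁ : δ ≤ δ₁) {s : ℝ → ℝ}
    (hs : ContDiffOn ℝ ∞ s (Ioo (-δ) δ)) (hs0 : s 0 = 0) (hsd : HasDerivAt s 0 0)
    (hsm : ∀ t ∈ Ioo (-δ) δ, s t ∈ Ioo (-δ₂) δ₂)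
    (hvol : ∀ t ∈ Ioo (-δ) δ,
      ∫ x in E, jacobian Φ t (Ψ (s t) x) * jacobian Ψ (s t) x = ∫ _ in E, (1 : ℝ)) :
    firstVariation K₁ K₂ σ g Ω E S = 0 := by
  have hfam := hΦf.comp hΨf hδ hδ₁ hs hs0 hsm
  obtain ⟨a, M, ha, haδ, -, hb⟩ := hfam.exists_uniform_bounds
  have hsub : Ioo (-a) a ⊆ Ioo (-δ) δ := Ioo_subset_Ioo (neg_le_neg haδ.le) haδ.le
  have hv : ∀ t ∈ Ioo (-a) a, volume (compFamily Φ Ψ s t '' E) = volume E := by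
    intro t ht
    rw [hfam.volume_image (hsub ht) ((hΦ.injective hS t).comp (hΨ.injective hT (s t)))
      (hb t (Ioo_subset_Icc_self ht)).2.2.1 h.measurableSet h.isBounded_set]
    have : ∫ x in E, jacobian (compFamily Φ Ψ s) t x = ∫ _ in E, (1 : ℝ) := by
      rw [← hvol t (hsub ht)]
      refine setIntegral_congr_fun h.measurableSet fun x _ => ?_
      exact hΦf.jacobian_comp hΨf hfam (Ioo_subset_Ioo (neg_le_neg hδ₁) hδ₁ (hsub ht))
        (hsm t (hsub ht)) (hsub ht) (fun _ => rfl) x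
    rw [this, setIntegral_const, smul_eq_mul, mul_one, Measure.real,
      ENNReal.ofReal_toReal h.isBounded_set.measure_lt_top.ne]
  obtain ⟨f, C, hf, hvar, hvel⟩ := exists_variation h.isOpen h.hasC1Boundary hS hT hSt hTt hΦ hΨ
    hΦf hΨf ha (haδ.le.trans hδ₁) (hs.mono hsub) hs0 hsd (fun t ht => hsm t (hsub ht)) hv
  rw [← hvel]
  exact (h.hasDerivAt_energy hf hvar.image_domain).unique (hcrit.hasDerivAt a ha f hvar)

/-- The degenerate case, where no tangential field changes the volume to first order. By the group
law the derivative of the volume at time `t` is `∫_E div (J_t T)` with `J_t` the Jacobian, and `J_t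
T` is again a tangential test field; so the flow of `T` preserves the volume without correction. -/
theorem firstVariation_eq_zero_of_forall {m : ℝ} (h : IsAdmissible K₁ K₂ Λ β₁ β₂ g Ω E)
    (hcrit : IsVolumeConstrainedCritical K₁ K₂ σ g Ω m E)
    (hdiv : ∀ T : Space n → Space n, IsTestField T → IsTangentToBoundary Ω T →
      ∫ x in E, divergence T x = 0) {T : Space n → Space n} (hT : IsTestField T)
    (hTt : IsTangentToBoundary Ω T) : firstVariation K₁ K₂ σ g Ω E T = 0 := by
  obtain ⟨Φ, hΦ⟩ := hT.exists_flow
  obtain ⟨L, hL⟩ := hT.exists_lipschitzWith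
  obtain ⟨δ, hfam⟩ := hΦ.isSmoothFamily hT
  have hderiv : ∀ t ∈ Ioo (-δ) δ, HasDerivAt (fun t => ∫ x in E, jacobian Φ t x) 0 t := by
    intro t ht
    have hj : ContDiff ℝ ∞ (jacobian Φ t) := IsSmoothFamily.contDiff_slice hfam.contDiffOn_jacobian ht
    have h1 := (hfam.hasDerivAt_integral_pullback (hj.of_le (by exact_mod_cast le_top))
      h.isBounded_set).2
    rw [hΦ.velocity_zero hfam, hdiv _ (hT.smul hj) (hTt.smul _)] at h1
    have h2 : HasDerivAt (fun r => ∫ x in E, jacobian Φ (t + r) x) 0 0 := by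
      refine h1.congr_of_eventuallyEq ?_
      have hc : Tendsto (fun r : ℝ => t + r) (𝓝 0) (𝓝 t) := by
        simpa using (continuous_const_add t).tendsto (0 : ℝ)
      filter_upwards [hc.eventually (Ioo_mem_nhds ht.1 ht.2),
        Ioo_mem_nhds hfam.zero_mem.1 hfam.zero_mem.2] with r hr hr'
      exact setIntegral_congr_fun h.measurableSet fun x _ =>
        hfam.jacobian_comp hfam hfam ht hr' hr (fun x => hΦ.add hL t r x) x
    have h3 := HasDerivAt.comp_sub_const (f := fun r => ∫ x in E, jacobian Φ (t + r) x) t t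
      (by rwa [sub_self])
    simpa using h3
  have hconst : ∀ t ∈ Ioo (-δ) δ, ∫ x in E, jacobian Φ t x = ∫ _ in E, (1 : ℝ) := by
    intro t ht
    have := isOpen_Ioo.is_const_of_deriv_eq_zero (isPreconnected_Ioo)
      (f := fun t => ∫ x in E, jacobian Φ t x)
      (fun t ht => (hderiv t ht).differentiableAt.differentiableWithinAt)
      (fun t ht => (hderiv t ht).deriv) ht hfam.zero_mem
    simp only [hfam.jacobian_zero] at this
    exact this
  -- No correction is needed: `s = 0` makes the second flow, here that of `T` again, the identity.
  refine h.firstVariation_eq_zero hcrit hT hT hTt hTt hΦ hΦ hfam hfam hfam.pos le_rfl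
    (s := fun _ => 0) contDiffOn_const rfl (hasDerivAt_const _ _) (fun _ _ => hfam.zero_mem)
    fun t ht => ?_
  simp only [hΦ.zero, hfam.jacobian_zero, mul_one]
  exact hconst t ht

/-- The function `V (t, s)` gives the volume of `Φ t (Ψ s E)` by Jacobians. Its partial derivatives
at the origin are `∫_E div S = 0` and `∫_E div T ≠ 0`, so the level set through the origin is a
graph `s t` with `s'(0) = 0`. -/
theorem firstVariation_eq_zero_of_divergence {m : ℝ} (h : IsAdmissible K₁ K₂ Λ β₁ β₂ g Ω E)
    (hcrit : IsVolumeConstrainedCritical K₁ K₂ σ g Ω m E) {S T : Space n → Space n}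
    (hS : IsTestField S) (hT : IsTestField T)
    (hSt : IsTangentToBoundary Ω S) (hTt : IsTangentToBoundary Ω T)
    (hSd : ∫ x in E, divergence S x = 0) (hTd : ∫ x in E, divergence T x ≠ 0) :
    firstVariation K₁ K₂ σ g Ω E S = 0 := by
  obtain ⟨Φ, hΦ⟩ := hS.exists_flow
  obtain ⟨Ψ, hΨ⟩ := hT.exists_flow
  obtain ⟨δ₁, hΦf⟩ := hΦ.isSmoothFamily hS
  obtain ⟨δ₂, hΨf⟩ := hΨ.isSmoothFamily hT
  let U : Set (ℝ × ℝ) := Ioo (-δ₁) δ₁ ×ˢ Ioo (-δ₂) δ₂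
  have hU : IsOpen U := isOpen_Ioo.prod isOpen_Ioo
  let u : ℝ × ℝ → Space n → ℝ := fun p x => jacobian Φ p.1 (Ψ p.2 x) * jacobian Ψ p.2 x
  let V : ℝ × ℝ → ℝ := fun p => ∫ x in E, u p x
  have husm : ContDiffOn ℝ ∞ (fun q : (ℝ × ℝ) × Space n => u q.1 q.2) (U ×ˢ univ) := by
    have h1 : ContDiffOn ℝ ∞ (fun q : (ℝ × ℝ) × Space n => (q.1.2, q.2)) (U ×ˢ univ) := by
      fun_prop
    have h2 : ContDiffOn ℝ ∞ (fun q : (ℝ × ℝ) × Space n => Ψ q.1.2 q.2) (U ×ˢ univ) :=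
      hΨf.smooth.comp h1 fun q hq => ⟨hq.1.2, trivial⟩
    have h3 : ContDiffOn ℝ ∞ (fun q : (ℝ × ℝ) × Space n => q.1.1) (U ×ˢ univ) := by fun_prop
    exact (hΦf.contDiffOn_jacobian.comp (h3.prodMk h2) fun q hq => ⟨hq.1.1, trivial⟩).mul
      (hΨf.contDiffOn_jacobian.comp h1 fun q hq => ⟨hq.1.2, trivial⟩)
  have hVsm : ContDiffOn ℝ ∞ V U := by
    -- Off the two supports the Jacobians are 1; subtracting 1 makes the integrand compactly
    -- supported in `x`.
    have h1 : ContDiffOn ℝ ∞ (fun p => ∫ x in E, (u p x - 1)) U := by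
      refine contDiffOn_setIntegral hU (hΦf.isCompact.union hΨf.isCompact) (fun p hp x hx => ?_)
        (husm.sub contDiffOn_const) h.measurableSet
      have hxΨ : x ∉ tsupport T := fun hh => hx (Or.inr hh)
      simp only [u, hΨf.eq_self _ hp.2 x hxΨ, hΨf.jacobian_eq_one hp.2 hxΨ,
        hΦf.jacobian_eq_one hp.1 fun hh => hx (Or.inl hh), mul_one, sub_self]
    refine (h1.add (contDiffOn_const (c := ∫ _ in E, (1 : ℝ)))).congr fun p hp => ?_
    have h2 : Continuous (u p) := by
      have h3 : ContDiffOn ℝ ∞ (fun x : Space n => (p, x)) univ :=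
        (contDiff_const.prodMk contDiff_id).contDiffOn
      exact (contDiffOn_univ.1 (husm.comp h3 fun x _ => ⟨hp, trivial⟩)).continuous
    simp only [V]
    have h3 : Continuous fun x => u p x - 1 := h2.sub continuous_const
    rw [← integral_add (h.integrableOn_of_continuous h3)
      (h.integrableOn_of_continuous continuous_const)]
    simp only [sub_add_cancel]
  have h00 : ((0 : ℝ), (0 : ℝ)) ∈ U := ⟨hΦf.zero_mem, hΨf.zero_mem⟩
  have hVd : HasFDerivAt V (fderiv ℝ V (0, 0)) (0, 0) :=
    ((hVsm.contDiffAt (hU.mem_nhds h00)).differentiableAt (by simp)).hasFDerivAt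
  have hV1 : fderiv ℝ V (0, 0) (1, 0) = 0 := by
    have d1 := HasFDerivAt.comp_hasDerivAt (f := fun t : ℝ => (t, (0 : ℝ))) (0 : ℝ) hVd
      ((hasDerivAt_id' (0 : ℝ)).prodMk (hasDerivAt_const (0 : ℝ) (0 : ℝ)))
    have d2 := h.hasDerivAt_integral_jacobian hΦf
    rw [hΦ.velocity_zero hΦf, hSd] at d2
    refine d1.unique (d2.congr_of_eventuallyEq (Eventually.of_forall fun t => ?_))
    simp only [V, u, Function.comp, hΨ.zero, hΨf.jacobian_zero, mul_one]
  have hV2 : fderiv ℝ V (0, 0) (0, 1) ≠ 0 := by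
    have d1 := HasFDerivAt.comp_hasDerivAt (f := fun t : ℝ => ((0 : ℝ), t)) (0 : ℝ) hVd
      ((hasDerivAt_const (0 : ℝ) (0 : ℝ)).prodMk (hasDerivAt_id' (0 : ℝ)))
    have d2 := h.hasDerivAt_integral_jacobian hΨf
    rw [hΨ.velocity_zero hΨf] at d2
    rw [d1.unique (d2.congr_of_eventuallyEq (Eventually.of_forall fun t => ?_))]
    · exact hTd
    · simp only [V, u, Function.comp, hΦf.jacobian_zero, one_mul]
  obtain ⟨δ, hδ, s, hs, hs0, hsd, hsV⟩ := exists_contDiffOn_implicit hU h00 hVsm hV1 hV2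
  -- Otherwise `t = δ₁` would be admissible and `(δ₁, s δ₁)` would lie in `U`.
  have hδ₁ : δ ≤ δ₁ := by
    by_contra! hlt
    have := (hsV δ₁ ⟨by linarith [hΦf.pos], hlt⟩).1.1.2
    exact lt_irrefl _ this
  refine h.firstVariation_eq_zero hcrit hS hT hSt hTt hΦ hΨ hΦf hΨf hδ hδ₁ hs hs0 hsd
    (fun t ht => (hsV t ht).1.2) fun t ht => ?_
  have := (hsV t ht).2
  simp only [V, u, hΨ.zero, hΨf.jacobian_zero, hΦf.jacobian_zero, mul_one] at this
  exact this

/-- The weak form of the Euler–Lagrange equation. -/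
theorem exists_firstVariation_eq {m : ℝ} (h : IsAdmissible K₁ K₂ Λ β₁ β₂ g Ω E)
    (hcrit : IsVolumeConstrainedCritical K₁ K₂ σ g Ω m E) :
    ∃ c : ℝ, ∀ T : Space n → Space n, IsTestField T → IsTangentToBoundary Ω T →
      firstVariation K₁ K₂ σ g Ω E T = c * ∫ x in E, divergence T x := by
  by_cases hdiv : ∀ T : Space n → Space n, IsTestField T → IsTangentToBoundary Ω T →
      ∫ x in E, divergence T x = 0
  · exact ⟨0, fun T hT hTt => by
      rw [h.firstVariation_eq_zero_of_forall hcrit hdiv hT hTt, zero_mul]⟩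
  · push Not at hdiv
    obtain ⟨T₀, hT₀, hT₀t, hne⟩ := hdiv
    refine ⟨firstVariation K₁ K₂ σ g Ω E T₀ / ∫ x in E, divergence T₀ x, fun T hT hTt => ?_⟩
    -- This multiple makes `T - a • T₀` have total divergence zero on `E`, so the first variation
    -- vanishes on it; linearity does the rest.
    set a := (∫ x in E, divergence T x) / ∫ x in E, divergence T₀ x with ha
    have dT : Differentiable ℝ T := hT.contDiff.differentiable (by simp)
    have dT₀ : Differentiable ℝ T₀ := hT₀.contDiff.differentiable (by simp)
    have hint : ∀ {X : Space n → Space n}, IsTestField X → IntegrableOn (divergence X) E :=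
      fun hX => h.integrableOn_of_continuous
        (continuous_divergence (hX.contDiff.of_le (by exact_mod_cast le_top)))
    have hS : IsTestField fun x => T x + (-a) • T₀ x := hT.add (hT₀.smul contDiff_const)
    have hSd : ∫ x in E, divergence (fun x => T x + (-a) • T₀ x) x = 0 := by
      have e : ∀ x, divergence (fun x => T x + (-a) • T₀ x) x =
          divergence T x + (-a) * divergence T₀ x := fun x => by
        rw [divergence_add (dT x) ((dT₀ x).fun_const_smul _), divergence_const_smul _ (dT₀ x)]
      simp_rw [e]
      rw [integral_add (hint hT) ((hint hT₀).const_mul _), integral_const_mul, ha]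
      field_simp
      ring
    have h0 := h.firstVariation_eq_zero_of_divergence hcrit hS hT₀ (hTt.add (hT₀t.smul _)) hT₀t
      hSd hne
    rw [h.firstVariation_add_smul hT hT₀] at h0
    rw [show firstVariation K₁ K₂ σ g Ω E T = a * firstVariation K₁ K₂ σ g Ω E T₀ by linarith, ha]
    ring

end IsAdmissible

end WeakEquation

end NonlocalCapillarity

namespace NonlocalCapillarity

/-! ### The set near a regular boundary point as a sublevel set. -/

section LocalGraph

variable {n : ℕ}

/-- Near `x` the set `E` is, up to a null set, the sublevel set `{φ < 0}` of a function of class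
`C^{1,α}` that increases in the direction `e`. -/
structure IsLocalGraph (E : Set (Space n)) (x : Space n) (φ : Space n → ℝ) (e : Space n)
    (r c C α : ℝ) : Prop where
  r_pos : 0 < r
  c_pos : 0 < c
  C_nonneg : 0 ≤ C
  norm_le : ‖e‖ ≤ 1
  contDiffOn : ContDiffOn ℝ 1 φ (Metric.ball x r)
  apply_eq_zero : φ x = 0
  lower : ∀ y ∈ Metric.ball x r, c ≤ fderiv ℝ φ y e
  taylor : ∀ y ∈ Metric.ball x r, ∀ z ∈ Metric.ball x r,
    |φ z - φ y - fderiv ℝ φ y (z - y)| ≤ C * ‖z - y‖ ^ (1 + α)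
  ae_mem_iff : ∀ᵐ y, y ∈ Metric.ball x r → (y ∈ E ↔ φ y < 0)

/-- The set is star-shaped about `p = x + (ρ / 2) • e`. On the segment from `y` to `p`, if `L (y -
x)` is at least `c ρ / 4` below `L (p - x)`, the growth of `L` absorbs the error and `φ` stays at
least `φ y`. Otherwise `L (z - x) ≥ c ρ / 4` along the segment, which beats the error `c ρ / 8`
measured from `x`. -/
theorem isPreconnected_pos_inter_ball {φ : Space n → ℝ} {L : Space n →L[ℝ] ℝ} {x e : Space n}
    {ρ c : ℝ} (hρ : 0 < ρ) (hc : 0 < c) (he : ‖e‖ ≤ 1) (hL : c ≤ L e) (hx : φ x = 0)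
    (happ : ∀ z ∈ Metric.ball x ρ, ∀ y ∈ Metric.ball x ρ,
      |φ z - φ y - L (z - y)| ≤ c / 8 * ‖z - y‖) :
    IsPreconnected {y | y ∈ Metric.ball x ρ ∧ 0 < φ y} := by
  set p := x + (ρ / 2) • e with hp
  have hpx : p - x = (ρ / 2) • e := by rw [hp]; abel
  have hpb : p ∈ Metric.ball x ρ := by
    rw [Metric.mem_ball, dist_eq_norm, hpx, norm_smul, Real.norm_of_nonneg (by positivity)]
    nlinarith
  have hLp : c * (ρ / 2) ≤ L (p - x) := by
    rw [hpx, map_smul, smul_eq_mul]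
    nlinarith
  have hxb : x ∈ Metric.ball x ρ := Metric.mem_ball_self hρ
  refine isPreconnected_of_forall p fun y hy => ⟨segment ℝ p y, fun z hz => ?_,
    left_mem_segment ℝ p y, right_mem_segment ℝ p y, (convex_segment p y).isPreconnected⟩
  have hzb : z ∈ Metric.ball x ρ := (convex_ball x ρ).segment_subset hpb hy.1 hz
  refine ⟨hzb, ?_⟩
  rw [segment_symm, segment_eq_image'] at hz
  obtain ⟨θ, hθ, rfl⟩ := hz
  simp only at hzb ⊢
  have h1 : ‖y - x‖ < ρ := by rw [← dist_eq_norm]; exact hy.1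
  have h2 : ‖p - x‖ < ρ := by rw [← dist_eq_norm]; exact hpb
  have h3 : ‖p - y‖ ≤ 2 * ρ := by
    have := norm_sub_le (p - x) (y - x)
    rw [sub_sub_sub_cancel_right] at this
    linarith
  rcases le_total (L (y - x)) (L (p - x) - c / 4 * ρ) with h | h
  · have ha := (abs_le.1 (happ _ hzb y hy.1)).1
    have e1 : y + θ • (p - y) - y = θ • (p - y) := by abel
    rw [e1, map_smul, smul_eq_mul, norm_smul, Real.norm_of_nonneg hθ.1,
      ← sub_sub_sub_cancel_right p y x, map_sub, sub_sub_sub_cancel_right] at ha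
    have h4 : c / 4 * ρ ≤ L (p - x) - L (y - x) := by linarith
    have h5 : θ * (c / 4 * ρ) ≤ θ * (L (p - x) - L (y - x)) := mul_le_mul_of_nonneg_left h4 hθ.1
    have h6 : c / 8 * (θ * ‖p - y‖) ≤ θ * (c / 4 * ρ) := by
      have : c / 8 * (θ * ‖p - y‖) ≤ c / 8 * (θ * (2 * ρ)) := by
        have := hθ.1
        gcongr
      linarith
    linarith [hy.2]
  · have ha := (abs_le.1 (happ _ hzb x hxb)).1
    have h4 : ‖y + θ • (p - y) - x‖ < ρ := by rw [← dist_eq_norm]; exact hzb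
    have e1 : L (y + θ • (p - y) - x) = L (y - x) + θ * (L (p - x) - L (y - x)) := by
      have : y + θ • (p - y) - x = (y - x) + θ • ((p - x) - (y - x)) := by
        rw [sub_sub_sub_cancel_right]; abel
      rw [this, map_add, map_smul, map_sub L (p - x), smul_eq_mul]
    rw [e1, hx] at ha
    have h5 : c / 8 * ‖y + θ • (p - y) - x‖ ≤ c / 8 * ρ := by gcongr
    have h6 : L (p - x) - c / 4 * ρ ≤ L (y - x) + θ * (L (p - x) - L (y - x)) := by
      have h7 : 0 ≤ (1 - θ) * (L (y - x) - (L (p - x) - c / 4 * ρ)) :=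
        mul_nonneg (by linarith [hθ.2]) (by linarith)
      have h8 : 0 ≤ θ * (c / 4 * ρ) := mul_nonneg hθ.1 (by positivity)
      nlinarith
    nlinarith

theorem isClosed_boundary (E : Set (Space n)) : IsClosed (boundary E) := by
  rw [← isOpen_compl_iff, Metric.isOpen_iff]
  intro x hx
  simp only [boundary, mem_compl_iff, mem_ofPred_eq, not_forall] at hx
  obtain ⟨r, hr, hx⟩ := hx
  refine ⟨r / 2, by positivity, fun y hy hyb => hx ?_⟩
  have hsub : Metric.ball y (r / 2) ⊆ Metric.ball x r := by
    refine Metric.ball_subset_ball' ?_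
    linarith [Metric.mem_ball.1 hy]
  obtain ⟨h1, h2⟩ := hyb (r / 2) (by positivity)
  exact ⟨h1.trans_le (measure_mono (inter_subset_inter_right _ hsub)),
    h2.trans_le (measure_mono (inter_subset_inter_right _ hsub))⟩

/-- Off `boundary E` each point has a ball where `E` or its complement is null. These two
alternatives define disjoint open sets, so a connected `P` lies in one of them, and a locally null
set is null. -/
theorem volume_inter_eq_zero_or_of_isPreconnected {E P : Set (Space n)}
    (hconn : IsPreconnected P) (hdisj : Disjoint P (boundary E)) :
    volume (E ∩ P) = 0 ∨ volume (Eᶜ ∩ P) = 0 := by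
  let N : Set (Space n) → Set (Space n) := fun A => {y | ∃ r > 0, volume (A ∩ Metric.ball y r) = 0}
  have hNo : ∀ A, IsOpen (N A) := by
    intro A
    rw [Metric.isOpen_iff]
    rintro y ⟨r, hr, h0⟩
    refine ⟨r / 2, by positivity, fun z hz => ⟨r / 2, by positivity, measure_mono_null
      (inter_subset_inter_right _ (Metric.ball_subset_ball' ?_)) h0⟩⟩
    linarith [Metric.mem_ball.1 hz]
  have hcov : P ⊆ N E ∪ N Eᶜ := by
    intro y hy
    have := Set.disjoint_left.1 hdisj hy
    simp only [boundary, mem_ofPred_eq, not_forall, not_and_or, not_lt, nonpos_iff_eq_zero] at this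
    obtain ⟨r, hr, h | h⟩ := this
    · exact Or.inl ⟨r, hr, h⟩
    · exact Or.inr ⟨r, hr, h⟩
  have hnull : ∀ A, P ⊆ N A → volume (A ∩ P) = 0 := by
    intro A hA
    refine measure_null_of_locally_null _ fun y hy => ?_
    obtain ⟨r, hr, h0⟩ := hA hy.2
    exact ⟨A ∩ P ∩ Metric.ball y r,
      inter_mem_nhdsWithin _ (Metric.ball_mem_nhds y hr),
      measure_mono_null (inter_subset_inter_left _ inter_subset_left) h0⟩
  have hdj : Disjoint (N E) (N Eᶜ) := by
    rw [Set.disjoint_left]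
    rintro y ⟨r, hr, h1⟩ ⟨t, ht, h2⟩
    have h3 : 0 < volume (Metric.ball y (min r t)) := Metric.measure_ball_pos _ _ (lt_min hr ht)
    refine h3.ne' (measure_mono_null (t := E ∩ Metric.ball y r ∪ Eᶜ ∩ Metric.ball y t) ?_
      (measure_union_null h1 h2))
    intro z hz
    by_cases hzE : z ∈ E
    · exact Or.inl ⟨hzE, Metric.ball_subset_ball (min_le_left _ _) hz⟩
    · exact Or.inr ⟨hzE, Metric.ball_subset_ball (min_le_right _ _) hz⟩
  rcases isPreconnected_iff_subset_of_disjoint.1 hconn _ _ (hNo E) (hNo Eᶜ) hcov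
    (by rw [hdj.inter_eq, inter_empty]) with h | h
  · exact Or.inl (hnull _ h)
  · exact Or.inr (hnull _ h)

/-- A function of class `C¹` increases along a direction in which its differential is bounded
below. -/
theorem add_le_of_fderiv_lower {φ : Space n → ℝ} {x e : Space n} {r c : ℝ}
    (hφ : ContDiffOn ℝ 1 φ (Metric.ball x r)) (hc : ∀ y ∈ Metric.ball x r, c ≤ fderiv ℝ φ y e)
    {y : Space n} {t : ℝ} (ht : 0 ≤ t) (hy : y ∈ Metric.ball x r)
    (hyt : y + t • e ∈ Metric.ball x r) : φ y + c * t ≤ φ (y + t • e) := by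
  have hseg : ∀ u ∈ Icc 0 t, y + u • e ∈ Metric.ball x r := by
    intro u hu
    rcases ht.eq_or_lt with rfl | ht
    · rw [le_antisymm hu.2 hu.1]; exact hyt
    · have := (convex_ball x r).add_smul_mem hy hyt (t := u / t)
        ⟨div_nonneg hu.1 ht.le, div_le_one_of_le₀ hu.2 ht.le⟩
      rwa [smul_smul, div_mul_cancel₀ _ ht.ne'] at this
  have hd : ∀ u ∈ Icc 0 t, HasDerivAt (fun u : ℝ => φ (y + u • e))
      (fderiv ℝ φ (y + u • e) e) u := by
    intro u hu
    have h1 : HasDerivAt (fun u : ℝ => y + u • e) e u := by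
      simpa using ((hasDerivAt_id' u).smul_const e).const_add y
    exact (((hφ.contDiffAt (Metric.isOpen_ball.mem_nhds (hseg u hu))).differentiableAt
      one_ne_zero).hasFDerivAt).comp_hasDerivAt u h1
  have := (convex_Icc (0 : ℝ) t).mul_sub_le_image_sub_of_le_deriv (C := c)
    (fun u hu => (hd u hu).continuousAt.continuousWithinAt)
    (fun u hu => (hd u (interior_subset hu)).differentiableAt.differentiableWithinAt)
    (fun u hu => by
      rw [(hd u (interior_subset hu)).deriv]
      exact hc _ (hseg u (interior_subset hu))) 0 ⟨le_rfl, ht⟩ t ⟨ht, le_rfl⟩ ht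
  simp only [zero_smul, add_zero, sub_zero] at this
  linarith

/-- The level set is thin at every scale `τ > 0`; let `τ` tend to 0. -/
theorem volume_eq_zero_of_fderiv_lower {φ : Space n → ℝ} {x e : Space n} {r c : ℝ} (hr : 0 < r)
    (hcpos : 0 < c) (he : ‖e‖ ≤ 1)
    (hφ : ContDiffOn ℝ 1 φ (Metric.ball x r)) (hc : ∀ y ∈ Metric.ball x r, c ≤ fderiv ℝ φ y e) :
    volume {y | y ∈ Metric.ball x r ∧ φ y = 0} = 0 := by
  have hS : MeasurableSet {y | y ∈ Metric.ball x r ∧ φ y = 0} := by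
    have h1 := hφ.continuousOn.isOpen_inter_preimage Metric.isOpen_ball
      (isOpen_compl_singleton (x := (0 : ℝ)))
    have h2 : {y | y ∈ Metric.ball x r ∧ φ y = 0} =
        Metric.ball x r \ (Metric.ball x r ∩ φ ⁻¹' {0}ᶜ) := by
      ext y
      simp only [mem_ofPred_eq, Set.mem_sdiff, mem_inter_iff, mem_preimage, mem_compl_iff,
        mem_singleton_iff]
      tauto
    rw [h2]
    exact Metric.isOpen_ball.measurableSet.diff h1.measurableSet
  have hle : ∀ τ : ℝ, 0 < τ → volume {y | y ∈ Metric.ball x r ∧ φ y = 0} ≤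
      ENNReal.ofReal (τ / r) * volume (Metric.ball x (2 * r)) := by
    intro τ hτ
    refine volume_le_of_thin hS hr hτ he (fun y hy => hy.1) fun y hy t ht hyt => ?_
    have := add_le_of_fderiv_lower hφ hc (hτ.le.trans ht) hy.1 hyt.1
    rw [hy.2, hyt.2] at this
    nlinarith
  refine le_antisymm (ge_of_tendsto (f := fun τ : ℝ => ENNReal.ofReal (τ / r) *
    volume (Metric.ball x (2 * r))) (x := 𝓝[>] 0) ?_ ?_) (zero_le)
  · have h1 : Tendsto (fun τ : ℝ => ENNReal.ofReal (τ / r)) (𝓝[>] 0) (𝓝 0) := by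
      have : Tendsto (fun τ : ℝ => ENNReal.ofReal (τ / r)) (𝓝 0) (𝓝 (ENNReal.ofReal (0 / r))) :=
        (ENNReal.continuous_ofReal.comp (continuous_id.div_const r)).tendsto 0
      rw [zero_div, ENNReal.ofReal_zero] at this
      exact this.mono_left nhdsWithin_le_nhds
    have h2 := ENNReal.Tendsto.mul_const h1 (b := volume (Metric.ball x (2 * r)))
      (Or.inr measure_ball_lt_top.ne)
    rwa [zero_mul] at h2
  · filter_upwards [self_mem_nhdsWithin] with τ hτ using hle τ hτ

/-- In a small ball `{φ > 0}` and `{φ < 0}` are connected and miss the boundary, so each lies, up to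
a null set, in `E` or in its complement. Since `{φ = 0}` is null and both `E` and `Eᶜ` charge every
ball around `x`, the two lie on opposite sides; replacing `φ` by `-φ` if needed puts `E` where the
function is negative. The Taylor estimate comes from the Hölder bound on the differential. -/
theorem exists_isLocalGraph_of_boundary_eq {E : Set (Space n)} {x : Space n} {φ : Space n → ℝ}
    {α : ℝ≥0} {U : Set (Space n)} (hU : IsOpen U) (hxU : x ∈ U) (hφ : IsC1HolderOn α φ U)
    (hne : fderiv ℝ φ x ≠ 0) (hb : boundary E ∩ U = {y | y ∈ U ∧ φ y = 0}) (hx : x ∈ boundary E) :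
    ∃ (φ' : Space n → ℝ) (e : Space n) (r c C : ℝ), Metric.ball x r ⊆ U ∧
      IsLocalGraph E x φ' e r c C α := by
  obtain ⟨hφ1, C, hC⟩ := hφ
  have hφx : φ x = 0 := ((Set.ext_iff.1 hb x).1 ⟨hx, hxU⟩).2
  have hat : ContDiffAt ℝ 1 φ x := hφ1.contDiffAt (hU.mem_nhds hxU)
  obtain ⟨e, he, c, hc, L, -, hev⟩ := exists_ball_fderiv_bounds hat hne
  -- Strict differentiability with constant `c / 8`, the error allowed by
  -- `isPreconnected_pos_inter_ball`.
  obtain ⟨S, hS, happ⟩ := (hat.hasStrictFDerivAt one_ne_zero).approximates_deriv_on_nhds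
    (c := (c / 8).toNNReal) (Or.inr (Real.toNNReal_pos.2 (by positivity)))
  have hc8 : ((c / 8).toNNReal : ℝ) = c / 8 := Real.coe_toNNReal _ (by positivity)
  obtain ⟨r, hr, hball⟩ := Metric.eventually_nhds_iff_ball.1
    (hev.and ((hU.eventually_mem hxU).and (eventually_mem_set.2 hS)))
  have hrU : Metric.ball x r ⊆ U := fun y hy => (hball y hy).2.1
  have hφr := hφ1.mono hrU
  have hcr : ∀ y ∈ Metric.ball x r, c ≤ fderiv ℝ φ y e := fun y hy => (hball y hy).1.2.1
  have hT : ∀ y ∈ Metric.ball x r, ∀ z ∈ Metric.ball x r,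
      |φ z - φ y - fderiv ℝ φ y (z - y)| ≤ C * ‖z - y‖ ^ (1 + (α : ℝ)) := by
    intro y hy z hz
    have hsub := (convex_ball x r).segment_subset hy hz
    have h1 := (convex_segment y z).norm_image_sub_le_of_norm_hasFDerivWithin_le' (f := φ)
      (f' := fderiv ℝ φ) (φ := fderiv ℝ φ y) (C := C * ‖z - y‖ ^ (α : ℝ))
      (fun w hw => (((hφr.contDiffAt (Metric.isOpen_ball.mem_nhds
        (hsub hw))).differentiableAt one_ne_zero).hasFDerivAt).hasFDerivWithinAt)
      (fun w hw => by
        have h2 := hC.dist_le (hrU (hsub hw)) (hrU hy)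
        rw [dist_eq_norm] at h2
        refine h2.trans ?_
        gcongr
        rw [dist_eq_norm]
        rw [segment_eq_image'] at hw
        obtain ⟨θ, hθ, rfl⟩ := hw
        rw [add_sub_cancel_left, norm_smul, Real.norm_of_nonneg hθ.1]
        exact mul_le_of_le_one_left (norm_nonneg _) hθ.2)
      (left_mem_segment ℝ y z) (right_mem_segment ℝ y z)
    rw [Real.norm_eq_abs] at h1
    refine h1.trans (le_of_eq ?_)
    rw [add_comm (1 : ℝ)]
    rcases (norm_nonneg (z - y)).eq_or_lt with h0 | h0
    · rw [← h0, mul_zero, Real.zero_rpow (by positivity), mul_zero]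
    · rw [Real.rpow_add_one h0.ne']
      ring
  have hzero := volume_eq_zero_of_fderiv_lower hr hc he hφr hcr
  have hab : ∀ z ∈ Metric.ball x r, ∀ y ∈ Metric.ball x r,
      |φ z - φ y - fderiv ℝ φ x (z - y)| ≤ c / 8 * ‖z - y‖ := fun z hz y hy => by
    have := happ z (hball z hz).2.2 y (hball y hy).2.2
    rwa [hc8] at this
  have hcx := hcr x (Metric.mem_ball_self hr)
  have hpos := isPreconnected_pos_inter_ball hr hc he hcx hφx hab
  have hneg : IsPreconnected {y | y ∈ Metric.ball x r ∧ 0 < -φ y} := by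
    refine isPreconnected_pos_inter_ball (φ := fun y => -φ y) (L := -fderiv ℝ φ x) (e := -e) hr hc
      (by rwa [norm_neg]) (by simpa using hcx) (by simp [hφx]) fun z hz y hy => ?_
    have := hab z hz y hy
    rw [← abs_neg] at this
    convert this using 2
    simp only [neg_apply]
    ring
  have hdisj : ∀ u : Space n → ℝ, (∀ y, 0 < u y → φ y ≠ 0) →
      Disjoint {y | y ∈ Metric.ball x r ∧ 0 < u y} (boundary E) := by
    intro u hu
    rw [Set.disjoint_left]
    rintro y ⟨hy, hy0⟩ hyb
    exact hu y hy0 ((Set.ext_iff.1 hb y).1 ⟨hyb, hrU hy⟩).2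
  have h1 := volume_inter_eq_zero_or_of_isPreconnected hpos
    (hdisj _ fun y hy => hy.ne')
  have h2 := volume_inter_eq_zero_or_of_isPreconnected hneg
    (hdisj _ fun y hy h0 => by simp [h0] at hy)
  have hnot : ∀ A : Set (Space n), 0 < volume (A ∩ Metric.ball x r) →
      ¬ (volume (A ∩ {y | y ∈ Metric.ball x r ∧ 0 < φ y}) = 0 ∧
        volume (A ∩ {y | y ∈ Metric.ball x r ∧ 0 < -φ y}) = 0) := by
    rintro A hA ⟨ha, hb⟩
    refine hA.ne' (measure_mono_null (fun y hy => ?_)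
      (measure_union_null (measure_union_null ha hb) hzero))
    rcases lt_trichotomy (φ y) 0 with h | h | h
    · exact Or.inl (Or.inr ⟨hy.1, hy.2, neg_pos.2 h⟩)
    · exact Or.inr ⟨hy.2, h⟩
    · exact Or.inl (Or.inl ⟨hy.1, hy.2, h⟩)
  obtain ⟨hxE, hxEc⟩ := hx r hr
  have hae : ∀ {A : Set (Space n)}, volume A = 0 → ∀ᵐ y, y ∉ A := fun h => measure_eq_zero_iff_ae_notMem.1 h
  rcases h1 with h1 | h1 <;> rcases h2 with h2 | h2
  · exact absurd ⟨h1, h2⟩ (hnot E hxE)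
  · refine ⟨φ, e, r, c, C, hrU, ⟨hr, hc, C.2, he, hφr, hφx, hcr, hT, ?_⟩⟩
    filter_upwards [hae h1, hae h2, hae hzero] with y a1 a2 a3 hy
    rcases lt_trichotomy (φ y) 0 with h | h | h
    · exact iff_of_true (by_contra fun hE => a2 ⟨hE, hy, neg_pos.2 h⟩) h
    · exact absurd ⟨hy, h⟩ a3
    · exact iff_of_false (fun hE => a1 ⟨hE, hy, h⟩) h.not_gt
  · have hf : ∀ y, fderiv ℝ (fun y => -φ y) y = -fderiv ℝ φ y := fun y => fderiv_fun_neg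
    refine ⟨fun y => -φ y, -e, r, c, C, hrU, ⟨hr, hc, C.2, by rwa [norm_neg], hφr.neg,
      by simp [hφx], fun y hy => ?_, fun y hy z hz => ?_, ?_⟩⟩
    · rw [hf]
      simpa using hcr y hy
    · have := hT y hy z hz
      rw [← abs_neg] at this
      convert this using 2
      rw [hf, neg_apply]
      ring
    · filter_upwards [hae h1, hae h2, hae hzero] with y a1 a2 a3 hy
      rcases lt_trichotomy (φ y) 0 with h | h | h
      · exact iff_of_false (fun hE => a2 ⟨hE, hy, neg_pos.2 h⟩) (by linarith)
      · exact absurd ⟨hy, h⟩ a3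
      · exact iff_of_true (by_contra fun hE => a1 ⟨hE, hy, h⟩) (by linarith)
  · exact absurd ⟨h1, h2⟩ (hnot Eᶜ hxEc)

/-- A regular point inside `Ω` is not on the edge of the hypersurface, because edge points lie on
the frontier of the open set `Ω`. So `ψ > 0` near `x` and only the equation `φ = 0` remains. -/
theorem exists_isLocalGraph {s : ℝ} {Ω E : Set (Space n)} (hΩo : IsOpen Ω) {x : Space n}
    (hx : x ∈ Ω ∩ regularSet s Ω E) :
    ∃ (φ : Space n → ℝ) (e : Space n) (r c C α : ℝ), s < α ∧ α < 1 ∧ Metric.ball x r ⊆ Ω ∧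
      IsLocalGraph E x φ e r c C α := by
  obtain ⟨hxΩ, hxcl, ρ, hρ, α, hsα, hα, hM⟩ := hx
  have hxb : x ∈ boundary E :=
    (isClosed_boundary E).closure_subset_iff.2 inter_subset_right hxcl
  obtain ⟨U, hU, hxU, φ, hφ, hcase⟩ := hM x ⟨Metric.mem_ball_self hρ, hxb⟩
  suffices h : fderiv ℝ φ x ≠ 0 ∧ ∃ V, IsOpen V ∧ x ∈ V ∧ V ⊆ U ∧ V ⊆ Metric.ball x ρ ∧
      boundary E ∩ V = {y | y ∈ V ∧ φ y = 0} by
    obtain ⟨hne, V, hV, hxV, hVU, -, hbV⟩ := h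
    obtain ⟨φ', e, r, c, C, hr, H⟩ := exists_isLocalGraph_of_boundary_eq (U := V ∩ Ω)
      (hV.inter hΩo) ⟨hxV, hxΩ⟩
      ⟨hφ.1.mono (inter_subset_left.trans hVU), hφ.2.imp fun C hC => hC.mono
        (inter_subset_left.trans hVU)⟩ hne
      (by
        ext y
        have := Set.ext_iff.1 hbV y
        simp only [mem_inter_iff, mem_ofPred_eq] at this ⊢
        tauto) hxb
    exact ⟨φ', e, r, c, C, α, hsα, by exact_mod_cast hα, hr.trans inter_subset_right, H⟩
  have hxM : x ∈ Metric.ball x ρ ∩ boundary E := ⟨Metric.mem_ball_self hρ, hxb⟩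
  rcases hcase with ⟨hne, hMU⟩ | ⟨ψ, hψ, hlin, hMU, hΓ⟩
  · refine ⟨hne x hxU, U ∩ Metric.ball x ρ, hU.inter Metric.isOpen_ball,
      ⟨hxU, Metric.mem_ball_self hρ⟩, inter_subset_left, inter_subset_right, ?_⟩
    ext y
    have := Set.ext_iff.1 hMU y
    simp only [mem_inter_iff, mem_ofPred_eq] at this ⊢
    tauto
  · have hxφ := (Set.ext_iff.1 hMU x).1 ⟨hxM, hxU⟩
    have hψx : 0 < ψ x := by
      refine lt_of_le_of_ne hxφ.2.2 fun h => ?_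
      have h1 : x ∈ frontier Ω := hΓ ⟨hxU, hxφ.2.1, h.symm⟩
      rw [hΩo.frontier_eq] at h1
      exact h1.2 hxΩ
    refine ⟨fun h => (hlin x hxU).ne_zero 0 (by simpa using h),
      (U ∩ ψ ⁻¹' Ioi 0) ∩ Metric.ball x ρ,
      (hψ.1.continuousOn.isOpen_inter_preimage hU isOpen_Ioi).inter Metric.isOpen_ball,
      ⟨⟨hxU, hψx⟩, Metric.mem_ball_self hρ⟩, fun y hy => hy.1.1, inter_subset_right, ?_⟩
    ext y
    have := Set.ext_iff.1 hMU y
    simp only [mem_inter_iff, mem_ofPred_eq, mem_preimage, mem_Ioi] at this ⊢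
    constructor
    · rintro ⟨h1, ⟨h2, h3⟩, h4⟩
      exact ⟨⟨⟨h2, h3⟩, h4⟩, (this.1 ⟨⟨h4, h1⟩, h2⟩).2.1⟩
    · rintro ⟨⟨⟨h2, h3⟩, h4⟩, h5⟩
      exact ⟨(this.2 ⟨h2, h5, le_of_lt h3⟩).1.2, ⟨h2, h3⟩, h4⟩

end LocalGraph

end NonlocalCapillarity

namespace NonlocalCapillarity

/-! ### Cancellation of the singular integral at boundary points. -/

section Cancellation

variable {n : ℕ}

/-- Dyadic shells: on the `k`-th one, at radius about `r / 2 ^ k`, the weight is at most `(r / 2 ^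
(k + 1)) ^ (-β)` and the volume at most `A * (r / 2 ^ k) ^ γ`, so the sum is a geometric series of
ratio `(1 / 2) ^ (γ - β)`. -/
theorem lintegral_rpow_le_of_volume_le {S : Set (Space n)} (hS : MeasurableSet S)
    {β γ A r : ℝ} (hβ : 0 < β) (hβγ : β < γ) (hA : 0 ≤ A) (hr : 0 < r)
    (hvol : ∀ t, 0 < t → volume (S ∩ Metric.closedBall 0 t) ≤ ENNReal.ofReal (A * t ^ γ)) :
    ∫⁻ w in S ∩ Metric.closedBall 0 r, ENNReal.ofReal (‖w‖ ^ (-β)) ≤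
      ENNReal.ofReal (A * 2 ^ β * (1 - (1 / 2 : ℝ) ^ (γ - β))⁻¹ * r ^ (γ - β)) := by
  let ρ : ℕ → ℝ := fun k => r * (1 / 2 : ℝ) ^ k
  have hρ : ∀ k, 0 < ρ k := fun k => by positivity
  have hm : ∀ k, MeasurableSet (S ∩ Metric.closedBall 0 (ρ k)) := fun k =>
    hS.inter Metric.isClosed_closedBall.measurableSet
  have hpt : ∀ w, (S ∩ Metric.closedBall 0 r).indicator (fun w => ENNReal.ofReal (‖w‖ ^ (-β))) w ≤
      ∑' k, (S ∩ Metric.closedBall 0 (ρ k)).indicator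
        (fun _ => ENNReal.ofReal (ρ (k + 1) ^ (-β))) w := by
    intro w
    by_cases hw : w ∈ S ∩ Metric.closedBall 0 r
    · rw [indicator_of_mem hw]
      rcases eq_or_ne w 0 with rfl | hw0
      -- The origin lies in no shell, but there the real power `0 ^ (-β)` is 0 by convention.
      · simp [Real.zero_rpow (neg_ne_zero.2 hβ.ne')]
      have hwp : 0 < ‖w‖ := norm_pos_iff.2 hw0
      have hwr : ‖w‖ ≤ r := by simpa using hw.2
      obtain ⟨k, hk1, hk2⟩ := exists_nat_pow_near_of_lt_one (x := ‖w‖ / r) (y := (1 / 2 : ℝ))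
        (by positivity) ((div_le_one hr).2 hwr) (by norm_num) (by norm_num)
      rw [lt_div_iff₀ hr] at hk1
      rw [div_le_iff₀ hr] at hk2
      refine le_trans ?_ (ENNReal.le_tsum k)
      rw [indicator_of_mem (show w ∈ S ∩ Metric.closedBall 0 (ρ k) from
        ⟨hw.1, by simpa [ρ, mul_comm] using hk2⟩)]
      refine ENNReal.ofReal_le_ofReal (Real.rpow_le_rpow_of_nonpos (hρ _) ?_ (by linarith))
      simp only [ρ]
      linarith
    · rw [indicator_of_notMem hw]
      exact zero_le
  have hq : (1 / 2 : ℝ) ^ (γ - β) < 1 :=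
    Real.rpow_lt_one (by norm_num) (by norm_num) (by linarith)
  have hterm : ∀ k, ENNReal.ofReal (ρ (k + 1) ^ (-β)) * volume (S ∩ Metric.closedBall 0 (ρ k)) ≤
      ENNReal.ofReal (A * 2 ^ β * r ^ (γ - β) * ((1 / 2 : ℝ) ^ (γ - β)) ^ k) := by
    intro k
    refine (mul_le_mul_right (hvol _ (hρ k)) _).trans ?_
    rw [← ENNReal.ofReal_mul (by positivity)]
    refine ENNReal.ofReal_le_ofReal (le_of_eq ?_)
    have h1 : ρ (k + 1) = ρ k * (1 / 2) := by simp only [ρ]; ring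
    have h2 : ((1 / 2 : ℝ)) ^ (-β) = 2 ^ β := by
      rw [Real.rpow_neg (by norm_num), one_div, Real.inv_rpow (by norm_num), inv_inv]
    have h3 : ρ k ^ (-β) * ρ k ^ γ = ρ k ^ (γ - β) := by
      rw [← Real.rpow_add (hρ k)]; congr 1; ring
    have h4 : ρ k ^ (γ - β) = r ^ (γ - β) * ((1 / 2 : ℝ) ^ (γ - β)) ^ k := by
      simp only [ρ]
      rw [Real.mul_rpow hr.le (by positivity), ← Real.rpow_natCast, ← Real.rpow_mul (by norm_num),
        ← Real.rpow_natCast, ← Real.rpow_mul (by norm_num), mul_comm (k : ℝ)]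
    rw [h1, Real.mul_rpow (hρ k).le (by norm_num), h2]
    calc ρ k ^ (-β) * 2 ^ β * (A * ρ k ^ γ) = A * 2 ^ β * (ρ k ^ (-β) * ρ k ^ γ) := by ring
      _ = _ := by rw [h3, h4]; ring
  rw [← lintegral_indicator (hS.inter Metric.isClosed_closedBall.measurableSet)]
  refine (lintegral_mono hpt).trans ?_
  rw [lintegral_tsum fun k => (measurable_const.indicator (hm k)).aemeasurable]
  simp_rw [lintegral_indicator_const (hm _)]
  refine (ENNReal.tsum_le_tsum hterm).trans ?_
  have hsum := (summable_geometric_of_lt_one (r := (1 / 2 : ℝ) ^ (γ - β)) (by positivity) hq)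
  rw [← ENNReal.ofReal_tsum_of_nonneg (fun k => by positivity) (hsum.mul_left _), tsum_mul_left,
    tsum_geometric_of_lt_one (by positivity) hq]
  refine ENNReal.ofReal_le_ofReal (le_of_eq ?_)
  ring

/-- Within radius `t` the slab satisfies `|ℓ w| ≤ C * t ^ (1 + α)` while `ℓ` grows at rate at least
`c` along `e`; so it is thin at scale `t ^ (1 + α) / c`, which gains the factor `t ^ α` over the
volume of the ball. -/
theorem volume_slab_le {ℓ : Space n →L[ℝ] ℝ} {e : Space n} {c C α : ℝ} (hc : 0 < c) (hC : 0 ≤ C)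
    (hα : 0 ≤ α) (he : ‖e‖ ≤ 1) (hℓ : c ≤ ℓ e) {t : ℝ} (ht : 0 < t) :
    volume ({w | |ℓ w| ≤ C * ‖w‖ ^ (1 + α)} ∩ Metric.closedBall 0 t) ≤
      ENNReal.ofReal (3 * (C + 1) / (2 * c) * 4 ^ n * (volume (Metric.ball (0 : Space n) 1)).toReal
        * t ^ (n + α)) := by
  -- The difference of two values of `ℓ` on the slab is at most `2 * C * t ^ (1 + α)`; the factor `3
  -- * (C + 1)` exceeds this strictly and stays positive when `C = 0`.
  set τ := 3 * (C + 1) * t ^ (1 + α) / c with hτ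
  have hτ0 : 0 < τ := by positivity
  have hmeas : MeasurableSet ({w : Space n | |ℓ w| ≤ C * ‖w‖ ^ (1 + α)} ∩ Metric.closedBall 0 t) := by
    refine (measurableSet_le ?_ ?_).inter Metric.isClosed_closedBall.measurableSet
    · exact (continuous_abs.comp ℓ.continuous).measurable
    · fun_prop
  refine (volume_le_of_thin (x₀ := 0) (ρ := 2 * t) (τ := τ) hmeas (by positivity) hτ0 he ?_ ?_).trans ?_
  · exact inter_subset_right.trans (Metric.closedBall_subset_ball (by linarith))
  · rintro w ⟨hw, hwt⟩ u hu ⟨hwu, hwut⟩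
    have hb : ∀ z : Space n, |ℓ z| ≤ C * ‖z‖ ^ (1 + α) → z ∈ Metric.closedBall 0 t →
        |ℓ z| ≤ C * t ^ (1 + α) := by
      intro z h1 h2
      refine h1.trans ?_
      have : ‖z‖ ≤ t := by simpa using h2
      gcongr
    have h1 := abs_le.1 (hb _ hw hwt)
    have h2 := abs_le.1 (hb _ hwu hwut)
    rw [map_add, map_smul, smul_eq_mul] at h2
    have h3 : c * τ ≤ u * ℓ e := by
      have := hτ0.le
      nlinarith
    have h4 : c * τ = 3 * (C + 1) * t ^ (1 + α) := by rw [hτ]; field_simp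
    have h5 : 0 < t ^ (1 + α) := by positivity
    nlinarith [h1.1, h2.2]
  · rw [Measure.addHaar_ball_of_pos volume _ (by positivity : 0 < 2 * (2 * t)), finrank_euclideanSpace_fin]
    have hV : volume (Metric.ball (0 : Space n) 1) =
        ENNReal.ofReal (volume (Metric.ball (0 : Space n) 1)).toReal :=
      (ENNReal.ofReal_toReal measure_ball_lt_top.ne).symm
    set v := (volume (Metric.ball (0 : Space n) 1)).toReal with hv
    have hv0 : 0 ≤ v := ENNReal.toReal_nonneg
    rw [hV, ← ENNReal.ofReal_mul (by positivity), ← ENNReal.ofReal_mul (by positivity)]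
    refine ENNReal.ofReal_le_ofReal (le_of_eq ?_)
    rw [hτ, Real.rpow_add ht, Real.rpow_add ht, Real.rpow_natCast, Real.rpow_one,
      show 2 * (2 * t) = 4 * t by ring, mul_pow]
    field_simp

/-- The singular integral of a slab-like region. -/
theorem exists_lintegral_slab_le {c C α s : ℝ} (hc : 0 < c) (hC : 0 ≤ C) (hs : 0 < s)
    (hsα : s < α) : ∃ A : ℝ, 0 ≤ A ∧ ∀ (ℓ : Space n →L[ℝ] ℝ) (e : Space n), ‖e‖ ≤ 1 → c ≤ ℓ e →
      ∀ r, 0 < r → ∫⁻ w in {w | |ℓ w| ≤ C * ‖w‖ ^ (1 + α)} ∩ Metric.closedBall 0 r,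
        ENNReal.ofReal (‖w‖ ^ (-((n : ℝ) + s))) ≤ ENNReal.ofReal (A * r ^ (α - s)) := by
  have hq : (1 / 2 : ℝ) ^ ((n : ℝ) + α - (n + s)) < 1 :=
    Real.rpow_lt_one (by norm_num) (by norm_num) (by linarith)
  have hq' := (sub_pos.2 hq).le
  refine ⟨3 * (C + 1) / (2 * c) * 4 ^ n * (volume (Metric.ball (0 : Space n) 1)).toReal *
    2 ^ ((n : ℝ) + s) * (1 - (1 / 2 : ℝ) ^ ((n : ℝ) + α - (n + s)))⁻¹, by positivity,
    fun ℓ e he hℓ r hr => ?_⟩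
  have hmeas : MeasurableSet {w : Space n | |ℓ w| ≤ C * ‖w‖ ^ (1 + α)} := by
    refine measurableSet_le (continuous_abs.comp ℓ.continuous).measurable ?_
    fun_prop
  have h := lintegral_rpow_le_of_volume_le hmeas (β := (n : ℝ) + s) (γ := n + α) (by positivity)
    (by linarith) (by positivity) hr
    fun t ht => volume_slab_le hc hC (by linarith) he hℓ ht
  rwa [show (n : ℝ) + α - (n + s) = α - s by ring] at h ⊢

/-- Cancellation at a boundary point of a set of class `C^{1,α}`: the contributions of the two
sides of the boundary to the integral of an even singular kernel compensate each other. -/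
theorem IsLocalGraph.exists_cancellation {E : Set (Space n)} {x : Space n} {φ : Space n → ℝ}
    {e : Space n} {r c C α s : ℝ} (h : IsLocalGraph E x φ e r c C α) (hs : 0 < s) (hsα : s < α) :
    ∃ A : ℝ, 0 ≤ A ∧ ∀ χ : Space n → ℝ, (∀ z, |χ z| ≤ 1) →
      (∀ z ∈ Metric.ball x r, χ z = Eᶜ.indicator 1 z - E.indicator 1 z) →
      ∀ y ∈ Metric.ball x (r / 2), φ y = 0 → ∀ (κ : Space n → ℝ) (Λ ρ : ℝ), 0 ≤ Λ → 0 < ρ →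
        ρ < r / 2 → (∀ w, κ (-w) = κ w) → (∀ w, |κ w| ≤ Λ * ‖w‖ ^ (-((n : ℝ) + s))) →
        (∀ w, ρ < ‖w‖ → κ w = 0) → Integrable (fun z => κ (y - z) * χ z) →
        |∫ z, κ (y - z) * χ z| ≤ Λ * A * ρ ^ (α - s) := by
  obtain ⟨A, hA, H⟩ := exists_lintegral_slab_le (n := n) h.c_pos h.C_nonneg hs hsα
  refine ⟨A, hA, fun χ hχ1 hχ y hy hφy κ Λ ρ hΛ hρ hρr heven hκ hκ0 hint => ?_⟩
  have hyr : y ∈ Metric.ball x r :=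
    Metric.ball_subset_ball (by linarith [h.r_pos]) hy
  set I := ∫ z, κ (y - z) * χ z with hI
  have hI1 : I = ∫ w, κ w * χ (y - w) := by
    rw [hI, ← integral_sub_left_eq_self (fun z => κ (y - z) * χ z) volume y]
    simp only [sub_sub_cancel]
  have hI2 : I = ∫ w, κ w * χ (y + w) := by
    rw [hI1, ← integral_neg_eq_self]
    simp only [heven, sub_neg_eq_add]
  have i1 : Integrable fun w => κ w * χ (y - w) := by
    have := hint.comp_sub_left y
    simpa only [sub_sub_cancel] using this
  have i2 : Integrable fun w => κ w * χ (y + w) := by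
    have := i1.comp_neg
    simpa only [heven, sub_neg_eq_add] using this
  -- Average over `w` and `-w`, using that `κ` is even: only pairs of opposite points on the same
  -- side contribute.
  have h2I : 2 * I = ∫ w, κ w * (χ (y - w) + χ (y + w)) := by
    rw [two_mul]
    nth_rewrite 1 [hI1]
    rw [hI2, ← integral_add i1 i2]
    simp only [mul_add]
  set S : Set (Space n) := {w | |fderiv ℝ φ y w| ≤ C * ‖w‖ ^ (1 + α)} with hS
  have hae1 : ∀ᵐ w, y + w ∈ Metric.ball x r → (y + w ∈ E ↔ φ (y + w) < 0) :=
    (measurePreserving_add_left volume y).quasiMeasurePreserving.ae h.ae_mem_iff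
  have hae2 : ∀ᵐ w, y - w ∈ Metric.ball x r → (y - w ∈ E ↔ φ (y - w) < 0) :=
    (Measure.measurePreserving_sub_left volume y).quasiMeasurePreserving.ae h.ae_mem_iff
  have hSm : MeasurableSet (S ∩ Metric.closedBall 0 ρ) := by
    refine MeasurableSet.inter ?_ Metric.isClosed_closedBall.measurableSet
    refine measurableSet_le (continuous_abs.comp (fderiv ℝ φ y).continuous).measurable ?_
    fun_prop
  have hbound : ∀ᵐ w, ‖κ w * (χ (y - w) + χ (y + w))‖ₑ ≤
      (S ∩ Metric.closedBall 0 ρ).indicator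
        (fun w => ENNReal.ofReal (2 * Λ) * ENNReal.ofReal (‖w‖ ^ (-((n : ℝ) + s)))) w := by
    filter_upwards [hae1, hae2] with w h1 h2
    by_cases hwρ : ρ < ‖w‖
    · rw [hκ0 w hwρ, zero_mul, enorm_zero]
      exact zero_le
    push Not at hwρ
    have hball : ∀ v : Space n, ‖v‖ ≤ ρ → y + v ∈ Metric.ball x r := by
      intro v hv
      have h3 : dist (y + v) y ≤ ρ := by simpa [dist_eq_norm] using hv
      rw [Metric.mem_ball] at hy ⊢
      linarith [dist_triangle (y + v) y x]
    have hb1 := hball w hwρ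
    have hb2 : y - w ∈ Metric.ball x r := by
      rw [sub_eq_add_neg]; exact hball (-w) (by rwa [norm_neg])
    by_cases hwS : w ∈ S
    · rw [indicator_of_mem (show w ∈ S ∩ Metric.closedBall 0 ρ from ⟨hwS, by simpa using hwρ⟩),
        ← ENNReal.ofReal_mul (by positivity), Real.enorm_eq_ofReal_abs]
      refine ENNReal.ofReal_le_ofReal ?_
      rw [abs_mul]
      have h4 : |χ (y - w) + χ (y + w)| ≤ 2 :=
        (abs_add_le _ _).trans (by linarith [hχ1 (y - w), hχ1 (y + w)])
      have h5 := hκ w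
      have h6 : 0 ≤ Λ * ‖w‖ ^ (-((n : ℝ) + s)) := by positivity
      calc |κ w| * |χ (y - w) + χ (y + w)| ≤ Λ * ‖w‖ ^ (-((n : ℝ) + s)) * 2 := by gcongr
        _ = _ := by ring
    -- Off the slab the linear term dominates the Taylor remainder, so `φ` has opposite signs at `y
    -- + w` and `y - w`: exactly one of them is in `E`.
    · have hz : χ (y - w) + χ (y + w) = 0 := by
        have t1 := abs_le.1 (h.taylor y hyr _ hb1)
        have t2 := abs_le.1 (h.taylor y hyr _ hb2)
        rw [add_sub_cancel_left, hφy] at t1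
        rw [sub_sub_cancel_left, hφy, map_neg, norm_neg] at t2
        simp only [hS, mem_ofPred_eq, not_le] at hwS
        rw [hχ _ hb1, hχ _ hb2]
        rcases lt_abs.1 hwS with hpos | hneg
        · have n1 : y + w ∉ E := fun hE => by linarith [(h1 hb1).1 hE]
          have n2 : y - w ∈ E := (h2 hb2).2 (by linarith)
          simp [n1, n2]
        · have n1 : y + w ∈ E := (h1 hb1).2 (by linarith)
          have n2 : y - w ∉ E := fun hE => by linarith [(h2 hb2).1 hE]
          simp [n1, n2]
      rw [hz, mul_zero, enorm_zero]
      exact zero_le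
  have hfin : ‖2 * I‖ₑ ≤ ENNReal.ofReal (2 * Λ * (A * ρ ^ (α - s))) := by
    rw [h2I]
    refine (enorm_integral_le_lintegral_enorm _).trans ((lintegral_mono_ae hbound).trans ?_)
    rw [lintegral_indicator hSm, lintegral_const_mul' _ _ ENNReal.ofReal_ne_top,
      ENNReal.ofReal_mul (by positivity : 0 ≤ 2 * Λ)]
    exact mul_le_mul_right (H _ e h.norm_le (h.lower y hyr) ρ hρ) _
  rw [Real.enorm_eq_ofReal_abs, ENNReal.ofReal_le_ofReal_iff (by positivity), abs_mul,
    abs_of_pos (by norm_num : (0 : ℝ) < 2)] at hfin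
  linarith

end Cancellation

end NonlocalCapillarity

namespace NonlocalCapillarity

/-! ### Smooth truncation of the kernel with bounds uniform in the scale. -/

section Regularization

variable {n : ℕ}

/-- A smooth even cut-off function, equal to `1` on the unit ball and vanishing off the ball of
radius `2`. -/
noncomputable def cutoff (n : ℕ) : ContDiffBump (0 : Space n) := ⟨1, 2, one_pos, one_lt_two⟩

/-- The kernel `K` with its singularity cut off at the scale `ε`. -/
noncomputable def regularize (K : Space n → ℝ) (ε : ℝ) (z : Space n) : ℝ :=
  K z * (1 - cutoff n (ε⁻¹ • z))

theorem regularize_of_le (K : Space n → ℝ) {ε : ℝ} (hε : 0 < ε) {z : Space n}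
    (hz : 2 * ε ≤ ‖z‖) : regularize K ε z = K z := by
  have : cutoff n (ε⁻¹ • z) = 0 := by
    refine (cutoff n).zero_of_le_dist ?_
    rw [dist_zero_right, norm_smul, Real.norm_of_nonneg (by positivity)]
    change 2 ≤ ε⁻¹ * ‖z‖
    rwa [le_inv_mul_iff₀ hε, mul_comm]
  rw [regularize, this, sub_zero, mul_one]

theorem regularize_of_norm_le (K : Space n → ℝ) {ε : ℝ} (hε : 0 < ε) {z : Space n}
    (hz : ‖z‖ ≤ ε) : regularize K ε z = 0 := by
  have : cutoff n (ε⁻¹ • z) = 1 := by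
    refine (cutoff n).one_of_mem_closedBall ?_
    rw [mem_closedBall_zero_iff, norm_smul, Real.norm_of_nonneg (by positivity)]
    change ε⁻¹ * ‖z‖ ≤ 1
    rwa [inv_mul_le_iff₀ hε, mul_one]
  rw [regularize, this, sub_self, mul_zero]

theorem abs_regularize_le (K : Space n → ℝ) (ε : ℝ) (z : Space n) :
    |regularize K ε z| ≤ |K z| := by
  rw [regularize, abs_mul]
  refine mul_le_of_le_one_right (abs_nonneg _) ?_
  have h1 := (cutoff n).nonneg' (ε⁻¹ • z)
  have h2 := (cutoff n).le_one (x := ε⁻¹ • z)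
  rw [abs_of_nonneg (by linarith)]
  linarith

theorem regularize_neg {K : Space n → ℝ} (hK : ∀ z, z ≠ 0 → K (-z) = K z) (ε : ℝ) (z : Space n) :
    regularize K ε (-z) = regularize K ε z := by
  have : K (-z) = K z := by
    rcases eq_or_ne z 0 with rfl | h
    · rw [neg_zero]
    · exact hK z h
  rw [regularize, regularize, this, smul_neg, (cutoff n).neg]

theorem contDiff_cutoff_smul (ε : ℝ) : ContDiff ℝ 1 fun z : Space n => 1 - cutoff n (ε⁻¹ • z) :=
  contDiff_const.sub ((cutoff n).contDiff.comp (contDiff_const_smul ε⁻¹))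

theorem IsSingularKernel.contDiff_regularize {K : Space n → ℝ} {Λ β : ℝ}
    (hK : IsSingularKernel K Λ β) {ε : ℝ} (hε : 0 < ε) : ContDiff ℝ 1 (regularize K ε) := by
  rw [contDiff_iff_contDiffAt]
  intro z
  rcases eq_or_ne z 0 with rfl | hz
  · refine (contDiffAt_const (c := (0 : ℝ))).congr_of_eventuallyEq ?_
    filter_upwards [Metric.ball_mem_nhds (0 : Space n) hε] with w hw
    exact regularize_of_norm_le K hε (mem_ball_zero_iff.1 hw).le
  · exact (hK.contDiffOn.contDiffAt (isOpen_compl_singleton.mem_nhds hz)).mul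
      (contDiff_cutoff_smul ε).contDiffAt

theorem IsSingularKernel.exists_isSingularKernel_regularize {K : Space n → ℝ} {Λ β : ℝ}
    (hK : IsSingularKernel K Λ β) :
    ∃ Λ', ∀ ε, 0 < ε → IsSingularKernel (regularize K ε) Λ' β := by
  obtain ⟨M, hM⟩ := ((cutoff n).hasCompactSupport.fderiv ℝ).exists_bound_of_continuous
    ((cutoff n).contDiff.continuous_fderiv (n := 1) one_ne_zero)
  have hM0 : 0 ≤ M := (norm_nonneg _).trans (hM 0)
  have hΛ := hK.nonneg
  refine ⟨Λ * (1 + 2 * M), fun ε hε => ⟨by positivity,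
    (hK.contDiff_regularize hε).contDiffOn, fun z hz => ?_, fun z hz => ?_⟩⟩
  · refine (abs_regularize_le K ε z).trans ((hK.bound z hz).trans ?_)
    have : 0 ≤ ‖z‖ ^ (-β) := by positivity
    nlinarith [mul_nonneg (mul_nonneg hΛ hM0) this]
  · have hzp : 0 < ‖z‖ := norm_pos_iff.2 hz
    rcases lt_or_ge (2 * ε) ‖z‖ with h | h
    · have : fderiv ℝ (regularize K ε) z = fderiv ℝ K z := by
        refine Filter.EventuallyEq.fderiv_eq ?_
        filter_upwards [continuous_norm.continuousAt.eventually (lt_mem_nhds h)] with w hw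
        exact regularize_of_le K hε hw.le
      rw [this]
      refine (hK.fderiv_bound z hz).trans ?_
      have : 0 ≤ ‖z‖ ^ (-β - 1) := by positivity
      nlinarith [mul_nonneg (mul_nonneg hΛ hM0) this]
    · have hd1 := (hK.differentiableAt hz).hasFDerivAt
      have hd2 : HasFDerivAt (fun z : Space n => 1 - cutoff n (ε⁻¹ • z))
          (-(ε⁻¹ • fderiv ℝ (cutoff n) (ε⁻¹ • z))) z := by
        have h1 : HasFDerivAt (cutoff n) (fderiv ℝ (cutoff n) (ε⁻¹ • z)) (ε⁻¹ • z) :=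
          ((cutoff n).contDiff.differentiable (n := 1) one_ne_zero _).hasFDerivAt
        have h2 : HasFDerivAt (fun z : Space n => ε⁻¹ • z) (ε⁻¹ • ContinuousLinearMap.id ℝ _) z :=
          (hasFDerivAt_id z).const_smul ε⁻¹
        have h3 : HasFDerivAt (fun z : Space n => 1 - cutoff n (ε⁻¹ • z))
            (-(fderiv ℝ (cutoff n) (ε⁻¹ • z) ∘L (ε⁻¹ • ContinuousLinearMap.id ℝ (Space n)))) z :=
          (h1.comp z h2).const_sub 1
        rwa [ContinuousLinearMap.comp_smul, ContinuousLinearMap.comp_id] at h3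
      have hd := HasFDerivAt.mul (c := K) hd1 hd2
      have he : fderiv ℝ (regularize K ε) z = _ := hd.fderiv
      rw [he]
      have hb1 := (cutoff n).nonneg' (ε⁻¹ • z)
      have hb2 := (cutoff n).le_one (x := ε⁻¹ • z)
      have t1 : ‖(1 - cutoff n (ε⁻¹ • z)) • fderiv ℝ K z‖ ≤ Λ * ‖z‖ ^ (-β - 1) := by
        rw [norm_smul, Real.norm_of_nonneg (by linarith)]
        exact (mul_le_of_le_one_left (norm_nonneg _) (by linarith)).trans (hK.fderiv_bound z hz)
      have t2 : ‖K z • (-(ε⁻¹ • fderiv ℝ (cutoff n) (ε⁻¹ • z)))‖ ≤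
          Λ * ‖z‖ ^ (-β - 1) * (2 * M) := by
        rw [norm_smul, norm_neg, norm_smul, Real.norm_of_nonneg (by positivity : (0 : ℝ) ≤ ε⁻¹),
          Real.norm_eq_abs]
        -- In the remaining case `‖z‖ ≤ 2 * ε`, so the factor `ε⁻¹` from differentiating the cut-off
        -- costs one power of `‖z‖`, as the differential of `K` does; hence the constant is
        -- independent of `ε`.
        have h3 : ε⁻¹ ≤ 2 * ‖z‖⁻¹ := by
          rw [← div_eq_mul_inv, le_div_iff₀ hzp, inv_mul_le_iff₀ hε]
          linarith
        calc |K z| * (ε⁻¹ * ‖fderiv ℝ (cutoff n) (ε⁻¹ • z)‖)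
            ≤ Λ * ‖z‖ ^ (-β) * (2 * ‖z‖⁻¹ * M) := by
              gcongr
              · exact hK.bound z hz
              · exact hM _
          _ = _ := by
              rw [Real.rpow_sub_one hzp.ne']
              ring
      refine (norm_add_le _ _).trans ((add_le_add t2 t1).trans (le_of_eq ?_))
      ring

end Regularization

/-! ### Differentiation of potentials. -/

section Potential

variable {n : ℕ}

/-- Differentiation of the potential of a kernel. -/
theorem contDiffOn_integral_kernel {κ χ b : Space n → ℝ} {B N V : Set (Space n)} (hN : IsOpen N)
    (hB : MeasurableSet B) (hV : IsOpen V) (hκ : ContDiffOn ℝ 1 κ V) (hκm : Measurable κ)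
    (hsub : ∀ x ∈ N, ∀ y ∈ B, x - y ∈ V) (hχm : Measurable χ) (hχ : ∀ y, |χ y| ≤ 1)
    (hint : ∀ x ∈ N, IntegrableOn (fun y => κ (x - y)) B) (hb : IntegrableOn b B)
    (hbound : ∀ x ∈ N, ∀ y ∈ B, ‖fderiv ℝ κ (x - y)‖ ≤ b y) :
    ContDiffOn ℝ 1 (fun x => ∫ y in B, κ (x - y) * χ y) N ∧
      ∀ x ∈ N, ∀ v, IntegrableOn (fun y => fderiv ℝ κ (x - y) v * χ y) B ∧
        fderiv ℝ (fun x => ∫ y in B, κ (x - y) * χ y) x v =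
          ∫ y in B, fderiv ℝ κ (x - y) v * χ y := by
  have hd : ∀ x ∈ N, ∀ y ∈ B, HasFDerivAt (fun x => κ (x - y) * χ y)
      (χ y • fderiv ℝ κ (x - y)) x := by
    intro x hx y hy
    have h1 : HasFDerivAt κ (fderiv ℝ κ (x - y)) (x - y) :=
      ((hκ.contDiffAt (hV.mem_nhds (hsub x hx y hy))).differentiableAt one_ne_zero).hasFDerivAt
    have h2 : HasFDerivAt (fun x : Space n => x - y) (ContinuousLinearMap.id ℝ (Space n)) x :=
      (hasFDerivAt_id x).sub_const y
    exact (h1.comp x h2).mul_const (χ y)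
  have hFm : ∀ x, Measurable fun y => κ (x - y) * χ y := fun x =>
    (hκm.comp (measurable_const.sub measurable_id)).mul hχm
  have hF'm : ∀ x, Measurable fun y => χ y • fderiv ℝ κ (x - y) := fun x =>
    hχm.smul ((measurable_fderiv ℝ κ).comp (measurable_const.sub measurable_id))
  have hFi : ∀ x ∈ N, IntegrableOn (fun y => κ (x - y) * χ y) B := fun x hx =>
    (hint x hx).mul_bdd (c := 1) hχm.aestronglyMeasurable
      (Eventually.of_forall fun y => by rw [Real.norm_eq_abs]; exact hχ y)
  have hbd : ∀ᵐ y ∂(volume.restrict B), ∀ x ∈ N, ‖χ y • fderiv ℝ κ (x - y)‖ ≤ b y := by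
    refine (ae_restrict_iff' hB).2 (Eventually.of_forall fun y hy x hx => ?_)
    rw [norm_smul, Real.norm_eq_abs]
    exact (mul_le_of_le_one_left (norm_nonneg _) (hχ y)).trans (hbound x hx y hy)
  have hF'i : ∀ x ∈ N, Integrable (fun y => χ y • fderiv ℝ κ (x - y)) (volume.restrict B) :=
    fun x hx => hb.mono' (hF'm x).aestronglyMeasurable (hbd.mono fun y h => h x hx)
  have key : ∀ x ∈ N, HasFDerivAt (fun x => ∫ y in B, κ (x - y) * χ y)
      (∫ y in B, χ y • fderiv ℝ κ (x - y)) x := by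
    intro x hx
    exact hasFDerivAt_integral_of_dominated_of_fderiv_le (𝕜 := ℝ) (s := N)
      (F := fun x y => κ (x - y) * χ y) (F' := fun x y => χ y • fderiv ℝ κ (x - y))
      (hN.mem_nhds hx) (Eventually.of_forall fun x => (hFm x).aestronglyMeasurable) (hFi x hx)
      (hF'm x).aestronglyMeasurable hbd hb
      ((ae_restrict_iff' hB).2 (Eventually.of_forall fun y hy x hx => hd x hx y hy))
  constructor
  · rw [show (1 : WithTop ℕ∞) = 0 + 1 by rw [zero_add], contDiffOn_succ_iff_fderiv_of_isOpen hN]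
    refine ⟨fun x hx => (key x hx).differentiableAt.differentiableWithinAt, by simp, ?_⟩
    rw [contDiffOn_zero]
    refine ContinuousOn.congr (f := fun x => ∫ y in B, χ y • fderiv ℝ κ (x - y)) ?_
      fun x hx => (key x hx).fderiv
    refine continuousOn_of_dominated (bound := b) (fun x _ => (hF'm x).aestronglyMeasurable)
      (fun x hx => hbd.mono fun y h => h x hx) hb
      ((ae_restrict_iff' hB).2 (Eventually.of_forall fun y hy => ?_))
    refine (continuousOn_const (c := χ y)).smul ?_
    exact (hκ.continuousOn_fderiv_of_isOpen hV le_rfl).comp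
      (continuous_id.sub continuous_const).continuousOn fun x hx => hsub x hx y hy
  · intro x hx v
    have e : ∀ y, (χ y • fderiv ℝ κ (x - y)) v = fderiv ℝ κ (x - y) v * χ y := fun y => by
      rw [smul_apply, smul_eq_mul, mul_comm]
    refine ⟨?_, ?_⟩
    · have := (hF'i x hx).apply_continuousLinearMap v
      simp only [e] at this
      exact this
    · rw [(key x hx).fderiv, ContinuousLinearMap.integral_apply (hF'i x hx)]
      simp only [e]

/-- Off the support of `η` both sides vanish, so the formula holds everywhere although the potential
is controlled only on `N`. -/
theorem fderiv_mul_potential {κ χ : Space n → ℝ} {B N : Set (Space n)} (hN : IsOpen N)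
    (hχm : Measurable χ) (hχ : ∀ y, |χ y| ≤ 1)
    (hint : ∀ x ∈ N, IntegrableOn (fun y => κ (x - y)) B)
    (h : ContDiffOn ℝ 1 (fun x => ∫ y in B, κ (x - y) * χ y) N ∧
      ∀ x ∈ N, ∀ v, IntegrableOn (fun y => fderiv ℝ κ (x - y) v * χ y) B ∧
        fderiv ℝ (fun x => ∫ y in B, κ (x - y) * χ y) x v =
          ∫ y in B, fderiv ℝ κ (x - y) v * χ y)
    {η : Space n → ℝ} (hη : ContDiff ℝ 1 η) (hηN : tsupport η ⊆ N) (x v : Space n) :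
    fderiv ℝ (fun x => η x * ∫ y in B, κ (x - y) * χ y) x v =
      ∫ y in B, (fderiv ℝ η x v * κ (x - y) + η x * fderiv ℝ κ (x - y) v) * χ y := by
  by_cases hx : x ∈ tsupport η
  · have hxN := hηN hx
    have d1 : HasFDerivAt η (fderiv ℝ η x) x := (hη.differentiable one_ne_zero x).hasFDerivAt
    have d2 := ((h.1.contDiffAt (hN.mem_nhds hxN)).differentiableAt one_ne_zero).hasFDerivAt
    obtain ⟨i2, e2⟩ := h.2 x hxN v
    have i1 : IntegrableOn (fun y => κ (x - y) * χ y) B :=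
      (hint x hxN).mul_bdd (c := 1) hχm.aestronglyMeasurable
        (Eventually.of_forall fun y => by rw [Real.norm_eq_abs]; exact hχ y)
    rw [(d1.fun_mul d2).fderiv, add_apply, smul_apply, smul_apply, smul_eq_mul, smul_eq_mul, e2,
      ← integral_const_mul, mul_comm _ (fderiv ℝ η x v), ← integral_const_mul,
      ← integral_add (i2.const_mul _) (i1.const_mul _)]
    congr 1
    funext y
    ring
  · have h0 : η =ᶠ[𝓝 x] 0 := notMem_tsupport_iff_eventuallyEq.1 hx
    have h1 : (fun x => η x * ∫ y in B, κ (x - y) * χ y) =ᶠ[𝓝 x] fun _ => 0 := by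
      filter_upwards [h0] with y hy
      rw [hy, Pi.zero_apply, zero_mul]
    have h2 : fderiv ℝ η x = 0 := by rw [h0.fderiv_eq]; exact fderiv_const_apply 0
    rw [h1.fderiv_eq, fderiv_const_apply, h2, h0.self_of_nhds]
    simp

end Potential

end NonlocalCapillarity

namespace NonlocalCapillarity

/-! ### The first variation along fields of constant direction. -/

section LocalVariation

variable {n : ℕ}

/-- The function equal to `1` off `E` and to `-1` on `E`. -/
noncomputable def sideSign (E : Set (Space n)) (y : Space n) : ℝ :=
  Eᶜ.indicator 1 y - E.indicator 1 y

theorem sideSign_of_mem {E : Set (Space n)} {y : Space n} (hy : y ∈ E) : sideSign E y = -1 := by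
  simp [sideSign, hy]

theorem sideSign_of_notMem {E : Set (Space n)} {y : Space n} (hy : y ∉ E) : sideSign E y = 1 := by
  simp [sideSign, hy]

theorem abs_sideSign_le (E : Set (Space n)) (y : Space n) : |sideSign E y| ≤ 1 := by
  by_cases hy : y ∈ E
  · simp [sideSign_of_mem hy]
  · simp [sideSign_of_notMem hy]

theorem measurable_sideSign {E : Set (Space n)} (hE : MeasurableSet E) :
    Measurable (sideSign E) :=
  (measurable_one.indicator hE.compl).sub (measurable_one.indicator hE)

theorem integral_fderiv_eq_zero {q : Space n → ℝ} (hq : ContDiff ℝ 1 q)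
    (hqc : HasCompactSupport q) (e : Space n) : ∫ x, fderiv ℝ q x e = 0 := by
  have hi : Integrable fun x => fderiv ℝ q x e :=
    Continuous.integrable_of_hasCompactSupport
      ((hq.continuous_fderiv one_ne_zero).clm_apply continuous_const)
      (hqc.fderiv_apply ℝ e)
  have h := integral_bilinear_hasFDerivAt_right_eq_neg_left_of_integrable
    (μ := (volume : Measure (Space n))) (f := fun _ : Space n => (1 : ℝ)) (f' := fun _ => 0) (g := q)
    (g' := fderiv ℝ q) (v := e) (B := ContinuousLinearMap.mul ℝ ℝ)
    (by simp) (by simpa using hi)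
    (by simpa using hq.continuous.integrable_of_hasCompactSupport hqc)
    (fun x _ => hasFDerivAt_const _ _)
    (fun x _ => (hq.differentiable one_ne_zero x).hasFDerivAt)
  simpa using h

theorem divergence_smul_const {η : Space n → ℝ} (hη : ContDiff ℝ 1 η) (e x : Space n) :
    divergence (fun x => η x • e) x = fderiv ℝ η x e := by
  rw [divergence_smul (X := fun _ => e) (hη.differentiable one_ne_zero x)
    (differentiableAt_const e)]
  simp [divergence, fderiv_const_apply]

theorem fderiv_neg_of_even {κ : Space n → ℝ} (h : ∀ z, κ (-z) = κ z) (z : Space n) :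
    fderiv ℝ κ (-z) = -fderiv ℝ κ z := by
  have h1 : κ ∘ ContinuousLinearEquiv.neg ℝ (M := Space n) = κ := funext h
  have h2 := (ContinuousLinearEquiv.neg ℝ (M := Space n)).comp_right_fderiv (f := κ) (x := z)
  rw [h1] at h2
  rw [h2]
  ext v
  simp

theorem divergence_kernelField_smul_const {κ η : Space n → ℝ} (hη : ContDiff ℝ 1 η) (e : Space n)
    {p : Space n × Space n} (hκ : DifferentiableAt ℝ κ (p.1 - p.2)) :
    divergence (kernelField κ fun x => η x • e) p =
      (fderiv ℝ η p.1 e * κ (p.1 - p.2) + η p.1 * fderiv ℝ κ (p.1 - p.2) e) +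
      (fderiv ℝ η p.2 e * κ (p.1 - p.2) - η p.2 * fderiv ℝ κ (p.1 - p.2) e) := by
  rw [divergence_kernelField hκ ((hη.differentiable one_ne_zero).smul_const e),
    divergence_smul_const hη, divergence_smul_const hη, map_sub, map_smul, map_smul, smul_eq_mul,
    smul_eq_mul]
  ring

/-- The first variation of a regular interaction as the integral of a derivative. -/
theorem setIntegral_divergence_kernelField_eq {κ η : Space n → ℝ} (hκ : ContDiff ℝ 1 κ)
    (heven : ∀ z, κ (-z) = κ z) (hη : ContDiff ℝ 1 η) (hηc : HasCompactSupport η)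
    {Ω E : Set (Space n)} (hΩo : IsOpen Ω) (hΩb : Bornology.IsBounded Ω) (hE : MeasurableSet E)
    (hEΩ : E ⊆ Ω) (hηΩ : tsupport η ⊆ Ω) (e : Space n) :
    ContDiffOn ℝ 1 (fun x => ∫ y in Ω, κ (x - y) * sideSign E y) Ω ∧
    ∫ p in E ×ˢ (Eᶜ ∩ Ω), divergence (kernelField κ fun x => η x • e) p =
      ∫ x in E, fderiv ℝ (fun x => η x * ∫ y in Ω, κ (x - y) * sideSign E y) x e := by
  have hEb : Bornology.IsBounded E := hΩb.subset hEΩ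
  have hF : MeasurableSet (Eᶜ ∩ Ω) := hE.compl.inter hΩo.measurableSet
  have hFb : Bornology.IsBounded (Eᶜ ∩ Ω) := hΩb.subset inter_subset_right
  have hκ' := hκ.continuous_fderiv one_ne_zero
  have hint : ∀ x ∈ Ω, IntegrableOn (fun y => κ (x - y)) Ω := fun x _ =>
    ((hκ.continuous.comp (continuous_const.sub continuous_id)).continuousOn.integrableOn_compact
      hΩb.isCompact_closure).mono_set subset_closure
  obtain ⟨M, hM⟩ := ((hΩb.isCompact_closure.prod hΩb.isCompact_closure).exists_bound_of_continuousOn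
    (f := fun p : Space n × Space n => fderiv ℝ κ (p.1 - p.2))
    (hκ'.comp (continuous_fst.sub continuous_snd)).continuousOn)
  have hpot := contDiffOn_integral_kernel (κ := κ) (χ := sideSign E) (b := fun _ => M) (B := Ω)
    (N := Ω) (V := univ) hΩo hΩo.measurableSet isOpen_univ hκ.contDiffOn hκ.continuous.measurable
    (fun _ _ _ _ => mem_univ _) (measurable_sideSign hE) (abs_sideSign_le E) hint
    (integrableOn_const hΩb.measure_lt_top.ne)
    (fun x hx y hy => hM (x, y) ⟨subset_closure hx, subset_closure hy⟩)
  refine ⟨hpot.1, ?_⟩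
  simp_rw [fderiv_mul_potential hΩo (measurable_sideSign hE) (abs_sideSign_le E) hint hpot hη hηΩ]
  -- `G (x, y)` is the derivative along `e` in `x` of `η x * κ (x - y)`; by evenness of `κ` the
  -- divergence is `G (x, y) + G (y, x)`.
  let G : Space n × Space n → ℝ := fun p =>
    fderiv ℝ η p.1 e * κ (p.1 - p.2) + η p.1 * fderiv ℝ κ (p.1 - p.2) e
  have hη' := hη.continuous_fderiv one_ne_zero
  have hG : Continuous G := by
    have h1 : Continuous fun p : Space n × Space n => p.1 - p.2 := continuous_fst.sub continuous_snd
    exact (((hη'.comp continuous_fst).clm_apply continuous_const).mul (hκ.continuous.comp h1)).add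
      ((hη.continuous.comp continuous_fst).mul ((hκ'.comp h1).clm_apply continuous_const))
  have hGi : ∀ {G : Space n × Space n → ℝ}, Continuous G → ∀ {A B : Set (Space n)},
      Bornology.IsBounded A → Bornology.IsBounded B → IntegrableOn G (A ×ˢ B) := by
    intro G hG A B hA hB
    exact (hG.continuousOn.integrableOn_compact (hA.isCompact_closure.prod
      hB.isCompact_closure)).mono_set (prod_mono subset_closure subset_closure)
  have hGs : ∀ x, ∀ {A : Set (Space n)}, Bornology.IsBounded A →
      IntegrableOn (fun y => G (x, y)) A := fun x A hA =>
    ((hG.comp (continuous_const.prodMk continuous_id)).continuousOn.integrableOn_compact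
      hA.isCompact_closure).mono_set subset_closure
  have hGs' : ∀ y, ∀ {A : Set (Space n)}, Bornology.IsBounded A →
      IntegrableOn (fun x => G (x, y)) A := fun y A hA =>
    ((hG.comp (continuous_id.prodMk continuous_const)).continuousOn.integrableOn_compact
      hA.isCompact_closure).mono_set subset_closure
  have hsplit : ∀ p, divergence (kernelField κ fun x => η x • e) p = G p + G p.swap := by
    intro p
    rw [divergence_kernelField_smul_const hη e (hκ.differentiable one_ne_zero _)]
    simp only [G, Prod.fst_swap, Prod.snd_swap]
    rw [← neg_sub p.1 p.2, heven, fderiv_neg_of_even heven, neg_apply]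
    ring
  have hzero : ∀ y, ∫ x in Ω, G (x, y) = 0 := by
    intro y
    have hq : ContDiff ℝ 1 fun x => η x * κ (x - y) :=
      hη.mul (hκ.comp (contDiff_id.sub contDiff_const))
    have hqG : ∀ x, fderiv ℝ (fun x => η x * κ (x - y)) x e = G (x, y) := by
      intro x
      have d1 : HasFDerivAt η (fderiv ℝ η x) x := (hη.differentiable one_ne_zero x).hasFDerivAt
      have d2 : HasFDerivAt (fun x => κ (x - y)) (fderiv ℝ κ (x - y)) x :=
        (hκ.differentiable one_ne_zero (x - y)).hasFDerivAt.comp x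
          ((hasFDerivAt_id x).sub_const y)
      rw [(d1.fun_mul d2).fderiv]
      simp only [add_apply, smul_apply, smul_eq_mul, G]
      ring
    rw [setIntegral_eq_integral_of_forall_compl_eq_zero]
    · simp_rw [← hqG]
      exact integral_fderiv_eq_zero hq hηc.mul_right e
    · intro x hx
      have hxs : x ∉ tsupport η := fun h => hx (hηΩ h)
      have h0 : η =ᶠ[𝓝 x] 0 := notMem_tsupport_iff_eventuallyEq.1 hxs
      have h2 : fderiv ℝ η x = 0 := by rw [h0.fderiv_eq]; exact fderiv_const_apply 0
      simp [G, h2, h0.self_of_nhds]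
  have hdecomp : ∀ {u : Space n → ℝ}, IntegrableOn u Ω →
      ∫ x in Ω, u x = (∫ x in Eᶜ ∩ Ω, u x) + ∫ x in E, u x := by
    intro u hu
    have hun : Ω = (Eᶜ ∩ Ω) ∪ E := by
      ext z
      by_cases hz : z ∈ E
      · simp [hz, hEΩ hz]
      · simp [hz]
    have hdj : Disjoint (Eᶜ ∩ Ω) E := disjoint_compl_left.mono_left inter_subset_left
    nth_rewrite 1 [hun]
    exact setIntegral_union hdj hE (hu.mono_set inter_subset_right) (hu.mono_set hEΩ)
  -- The full integral over `Ω` vanishes, as `η` is supported there. So the term `G (y, x)`, with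
  -- `y` in `Eᶜ ∩ Ω`, becomes minus an integral over `E ×ˢ E`; the two terms then combine into an
  -- integral against `sideSign E`.
  have hGF : ∀ y, ∫ x in Eᶜ ∩ Ω, G (x, y) = -∫ x in E, G (x, y) := by
    intro y
    have := hdecomp (hGs' y hΩb)
    rw [hzero y] at this
    linarith
  have hiF : IntegrableOn (fun x => ∫ y in Eᶜ ∩ Ω, G (x, y)) E := by
    have := hGi hG hEb hFb
    rw [IntegrableOn, Measure.volume_eq_prod, ← Measure.prod_restrict] at this
    exact this.integral_prod_left
  have hiE' : Integrable G ((volume.restrict E).prod (volume.restrict E)) := by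
    have := hGi hG hEb hEb
    rwa [IntegrableOn, Measure.volume_eq_prod, ← Measure.prod_restrict] at this
  have hGsw : Continuous fun p : Space n × Space n => G p.swap := hG.comp continuous_swap
  calc ∫ p in E ×ˢ (Eᶜ ∩ Ω), divergence (kernelField κ fun x => η x • e) p
      = (∫ p in E ×ˢ (Eᶜ ∩ Ω), G p) + ∫ p in E ×ˢ (Eᶜ ∩ Ω), G p.swap := by
        simp_rw [hsplit]
        exact integral_add (hGi hG hEb hFb) (hGi hGsw hEb hFb)
    _ = (∫ x in E, ∫ y in Eᶜ ∩ Ω, G (x, y)) + ∫ x in E, ∫ y in Eᶜ ∩ Ω, G (y, x) := by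
        congr 1
        · exact setIntegral_prod _ (hGi hG hEb hFb)
        · exact setIntegral_prod _ (hGi hGsw hEb hFb)
    _ = (∫ x in E, ∫ y in Eᶜ ∩ Ω, G (x, y)) - ∫ x in E, ∫ y in E, G (x, y) := by
        simp_rw [hGF]
        rw [integral_neg, ← sub_eq_add_neg, integral_integral_swap (f := fun x y => G (y, x)) hiE'.swap]
    _ = ∫ x in E, ((∫ y in Eᶜ ∩ Ω, G (x, y)) - ∫ y in E, G (x, y)) :=
        (integral_sub hiF hiE'.integral_prod_left).symm
    _ = ∫ x in E, ∫ y in Ω, (fderiv ℝ η x e * κ (x - y) + η x * fderiv ℝ κ (x - y) e) *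
          sideSign E y := by
        congr 1
        funext x
        have hi : IntegrableOn (fun y => G (x, y) * sideSign E y) Ω :=
          (hGs x hΩb).mul_bdd (c := 1) (measurable_sideSign hE).aestronglyMeasurable
            (Eventually.of_forall fun y => by rw [Real.norm_eq_abs]; exact abs_sideSign_le E y)
        have h1 : ∫ y in Eᶜ ∩ Ω, G (x, y) * sideSign E y = ∫ y in Eᶜ ∩ Ω, G (x, y) :=
          setIntegral_congr_fun hF fun y hy => by
            simp only [sideSign_of_notMem hy.1, mul_one]
        have h2 : ∫ y in E, G (x, y) * sideSign E y = -∫ y in E, G (x, y) := by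
          rw [← integral_neg]
          exact setIntegral_congr_fun hE fun y hy => by
            simp only [sideSign_of_mem hy, mul_neg, mul_one]
        have h3 := hdecomp hi
        rw [h1, h2] at h3
        rw [sub_eq_add_neg, ← h3]

/-- The first variation of the interaction with the exterior of the domain. -/
theorem setIntegral_divergence_kernelField_compl {K : Space n → ℝ} {Λ β r : ℝ}
    (hK : IsSingularKernel K Λ β) (hβ : n < β) {Ω E : Set (Space n)} (hΩo : IsOpen Ω)
    (hEΩ : E ⊆ Ω) {x₀ : Space n} (hr : 0 < r)
    (hball : Metric.ball x₀ r ⊆ Ω) :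
    (∀ x ∈ Metric.ball x₀ (r / 2), IntegrableOn (fun y => K (x - y)) Ωᶜ) ∧
    ContDiffOn ℝ 1 (fun x => ∫ y in Ωᶜ, K (x - y)) (Metric.ball x₀ (r / 2)) ∧
    ∀ (η : Space n → ℝ) (e : Space n), ContDiff ℝ 1 η → tsupport η ⊆ Metric.ball x₀ (r / 2) →
      MeasurableSet E →
      IntegrableOn (divergence (kernelField K fun x => η x • e)) (E ×ˢ Ωᶜ) →
      ∫ p in E ×ˢ Ωᶜ, divergence (kernelField K fun x => η x • e) p =
        ∫ x in E, fderiv ℝ (fun x => η x * ∫ y in Ωᶜ, K (x - y)) x e := by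
  have hβ0 : 0 < β := lt_of_le_of_lt (by positivity) hβ
  -- For `x` in the half ball, `‖x - y‖` may be replaced by `‖x₀ - y‖ / 2`, which provides a
  -- majorant independent of `x`.
  have hdist : ∀ x ∈ Metric.ball x₀ (r / 2), ∀ y ∈ Ωᶜ, 0 < ‖x₀ - y‖ / 2 ∧ ‖x₀ - y‖ / 2 ≤ ‖x - y‖ := by
    intro x hx y hy
    have h1 : r ≤ ‖x₀ - y‖ := by
      by_contra! hlt
      exact hy (hball (by rwa [Metric.mem_ball, dist_comm, dist_eq_norm]))
    have h2 : ‖x - x₀‖ < r / 2 := by rwa [← dist_eq_norm]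
    have h3 : ‖x₀ - y‖ ≤ ‖x - y‖ + ‖x - x₀‖ := by
      have := norm_sub_le (x - y) (x - x₀)
      rwa [sub_sub_sub_cancel_left] at this
    exact ⟨by linarith, by linarith⟩
  have hcompl : Ωᶜ ⊆ (Metric.ball x₀ r)ᶜ := compl_subset_compl.2 hball
  have hb : ∀ γ : ℝ, n < γ → IntegrableOn (fun y => Λ * (‖x₀ - y‖ / 2) ^ (-γ)) Ωᶜ := by
    intro γ hγ
    have := ((integrableOn_rpow_compl_ball_center hγ hr x₀).mono_set hcompl).const_mul
      (Λ * 2⁻¹ ^ (-γ))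
    refine this.congr (Eventually.of_forall fun y => ?_)
    simp only
    rw [div_eq_mul_inv, Real.mul_rpow (norm_nonneg _) (by norm_num)]
    ring
  have hmono : ∀ γ : ℝ, 0 < γ → ∀ x ∈ Metric.ball x₀ (r / 2), ∀ y ∈ Ωᶜ,
      Λ * ‖x - y‖ ^ (-γ) ≤ Λ * (‖x₀ - y‖ / 2) ^ (-γ) := by
    intro γ hγ x hx y hy
    obtain ⟨h1, h2⟩ := hdist x hx y hy
    exact mul_le_mul_of_nonneg_left (Real.rpow_le_rpow_of_nonpos h1 h2 (by linarith)) hK.nonneg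
  have hne : ∀ x ∈ Metric.ball x₀ (r / 2), ∀ y ∈ Ωᶜ, x - y ≠ 0 := fun x hx y hy =>
    norm_pos_iff.1 ((hdist x hx y hy).1.trans_le (hdist x hx y hy).2)
  have hΩm : MeasurableSet Ωᶜ := hΩo.measurableSet.compl
  have hint : ∀ x ∈ Metric.ball x₀ (r / 2), IntegrableOn (fun y => K (x - y)) Ωᶜ := by
    intro x hx
    refine Integrable.mono' (hb β hβ)
      (hK.measurable.comp (measurable_const.sub measurable_id)).aestronglyMeasurable
      ((ae_restrict_iff' hΩm).2 (Eventually.of_forall fun y hy => ?_))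
    rw [Real.norm_eq_abs]
    exact (hK.bound _ (hne x hx y hy)).trans (hmono β hβ0 x hx y hy)
  have hpot := contDiffOn_integral_kernel (κ := K) (χ := fun _ => 1) (B := Ωᶜ)
    (b := fun y => Λ * (‖x₀ - y‖ / 2) ^ (-(β + 1)))
    (N := Metric.ball x₀ (r / 2)) (V := {0}ᶜ) Metric.isOpen_ball hΩm isOpen_compl_singleton
    hK.contDiffOn hK.measurable hne measurable_const (fun _ => by simp) hint
    (hb (β + 1) (by linarith)) (fun x hx y hy => by
      have := hK.fderiv_bound _ (hne x hx y hy)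
      rw [show -β - 1 = -(β + 1) by ring] at this
      exact this.trans (hmono (β + 1) (by linarith) x hx y hy))
  refine ⟨hint, by simpa only [mul_one] using hpot.1, fun η e hη hηs hE hdiv => ?_⟩
  have hfd := fun x => fderiv_mul_potential Metric.isOpen_ball measurable_const
    (fun _ => by simp) hint hpot hη hηs x e
  simp only [mul_one] at hfd
  simp_rw [hfd]
  rw [Measure.volume_eq_prod, setIntegral_prod _ hdiv]
  refine setIntegral_congr_fun hE fun x hx => setIntegral_congr_fun hΩm fun y hy => ?_
  have hxy : x - y ≠ 0 := sub_ne_zero.2 fun h => hy (h ▸ hEΩ hx)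
  -- For `y` outside `Ω` the field vanishes near `y`, so only the derivative in `x` remains.
  have hys : y ∉ tsupport η := fun h =>
    hy (hball (Metric.ball_subset_ball (by linarith) (hηs h)))
  have h0 : η =ᶠ[𝓝 y] 0 := notMem_tsupport_iff_eventuallyEq.1 hys
  have h2 : fderiv ℝ η y = 0 := by rw [h0.fderiv_eq]; exact fderiv_const_apply 0
  rw [divergence_kernelField_smul_const (p := (x, y)) hη e (hK.differentiableAt hxy)]
  simp [h2, h0.self_of_nhds]

end LocalVariation

end NonlocalCapillarity

namespace NonlocalCapillarity

/-! ### Sign of the flux through the boundary, by translation. -/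

section Monotonicity

variable {n : ℕ}

/-- This presents the flux `∫_E ∂_e q` as the derivative of an integral over the translates of `E`,
the substitute for the divergence theorem below. For times within 1 of `t` all supports lie in one
ball, where a constant dominates. -/
theorem hasDerivAt_integral_translate {q : Space n → ℝ} (hq : ContDiff ℝ 1 q)
    (hqc : HasCompactSupport q) (E : Set (Space n)) {e : Space n} (he : ‖e‖ ≤ 1) (t : ℝ) :
    HasDerivAt (fun t : ℝ => ∫ z in E, q (z + t • e)) (∫ z in E, fderiv ℝ q (z + t • e) e) t := by
  have hq' := hq.continuous_fderiv one_ne_zero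
  have hc : ∀ s : ℝ, Continuous fun z : Space n => z + s • e := fun s => by fun_prop
  obtain ⟨M, hM⟩ := (hqc.fderiv ℝ).exists_bound_of_continuous hq'
  have hM0 : 0 ≤ M := (norm_nonneg _).trans (hM 0)
  obtain ⟨R, hR⟩ := hqc.isBounded.subset_closedBall (0 : Space n)
  refine (hasDerivAt_integral_of_dominated_loc_of_deriv_le (𝕜 := ℝ) (μ := volume.restrict E)
    (F := fun s z => q (z + s • e)) (F' := fun s z => fderiv ℝ q (z + s • e) e)
    (x₀ := t) (s := Metric.ball t 1)
    (bound := (Metric.closedBall 0 (R + |t| + 1)).indicator fun _ => M)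
    (Metric.ball_mem_nhds t one_pos) ?_ ?_ ?_ ?_ ?_ ?_).2
  · exact Eventually.of_forall fun s => (hq.continuous.comp (hc s)).aestronglyMeasurable
  · have h1 : Integrable fun z : Space n => q (z + t • e) :=
      (hq.continuous.integrable_of_hasCompactSupport hqc).comp_add_right (t • e)
    exact h1.integrableOn
  · exact ((hq'.comp (hc t)).clm_apply continuous_const).aestronglyMeasurable
  · refine Eventually.of_forall fun z s hs => ?_
    by_cases hz : z ∈ Metric.closedBall (0 : Space n) (R + |t| + 1)
    · rw [indicator_of_mem hz]
      exact (ContinuousLinearMap.le_opNorm_of_le _ he).trans (by rw [mul_one]; exact hM _)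
    · rw [indicator_of_notMem hz]
      have h0 : z + s • e ∉ tsupport q := by
        intro h
        apply hz
        have h1 : ‖z + s • e‖ ≤ R := by simpa using hR h
        have h2 : ‖s • e‖ ≤ |t| + 1 := by
          rw [norm_smul, Real.norm_eq_abs]
          have h3 : |s - t| < 1 := by simpa [Real.dist_eq] using hs
          have h4 : |s| ≤ |t| + 1 := by
            have := abs_add_le t (s - t)
            rw [add_sub_cancel] at this
            linarith
          exact (mul_le_of_le_one_right (abs_nonneg s) he).trans h4
        have h5 : ‖z‖ ≤ ‖z + s • e‖ + ‖s • e‖ := by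
          have := norm_sub_le (z + s • e) (s • e)
          rwa [add_sub_cancel_right] at this
        rw [mem_closedBall_zero_iff]
        linarith
      have h1 : fderiv ℝ q (z + s • e) = 0 := by
        rw [(notMem_tsupport_iff_eventuallyEq.1 h0).fderiv_eq]
        exact fderiv_const_apply 0
      simp [h1]
  · exact ((integrable_indicator_iff Metric.isClosed_closedBall.measurableSet).2
      (integrableOn_const (isCompact_closedBall _ _).measure_lt_top.ne)).integrableOn
  · refine Eventually.of_forall fun z s _ => ?_
    have h1 : HasDerivAt (fun s : ℝ => z + s • e) e s := by
      simpa using ((hasDerivAt_id' s).smul_const e).const_add z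
    exact (hq.differentiable one_ne_zero (z + s • e)).hasFDerivAt.comp_hasDerivAt s h1

namespace IsLocalGraph

variable {E : Set (Space n)} {x : Space n} {φ : Space n → ℝ} {e : Space n} {r c C α : ℝ}

/-- A function that is nonnegative on the boundary of `E` has a nonnegative outward flux. -/
theorem integral_fderiv_nonneg (h : IsLocalGraph E x φ e r c C α) (hE : MeasurableSet E)
    {q : Space n → ℝ} (hq : ContDiff ℝ 1 q) (hqc : HasCompactSupport q)
    (hqs : tsupport q ⊆ Metric.ball x r) (hq0 : ∀ y ∈ Metric.ball x r, φ y = 0 → 0 ≤ q y) :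
    0 ≤ ∫ z in E, fderiv ℝ q z e := by
  obtain ⟨δ, hδ, hthick⟩ := hqc.isCompact.exists_thickening_subset_open Metric.isOpen_ball hqs
  obtain ⟨L, hL⟩ := hq.lipschitzWith_of_hasCompactSupport hqc one_ne_zero
  have hball : ∀ z ∈ tsupport q, ∀ t : ℝ, 0 ≤ t → t < δ → z - t • e ∈ Metric.ball x r := by
    intro z hz t ht htδ
    refine hthick (Metric.mem_thickening_iff.2 ⟨z, hz, ?_⟩)
    rw [dist_eq_norm, sub_sub_cancel_left, norm_neg, norm_smul, Real.norm_of_nonneg ht]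
    exact (mul_le_of_le_one_right ht h.norm_le).trans_lt htδ
  set V := (volume (Metric.ball x (2 * r))).toReal with hV
  have hr := h.r_pos
  -- Near the support of `q` the set `E` is contained in `E + t • e` up to a null set, and the
  -- difference lies in the layer `D`. This layer has volume `O(t)` and `q ≥ -(L * t)` on it, so the
  -- increment is bounded below by `-O(t ^ 2)`.
  have key : ∀ t : ℝ, 0 < t → t < δ →
      -(L * t * (t / r * V)) ≤ (∫ z in E, q (z + t • e)) - ∫ z in E, q z := by
    intro t ht htδ
    let D : Set (Space n) := {z | z ∈ tsupport q ∧ 0 ≤ φ z ∧ φ (z - t • e) < 0}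
    have hφc := h.contDiffOn.continuousOn
    have hD : MeasurableSet D := by
      have c1 : IsClosed (tsupport q ∩ φ ⁻¹' Ici 0) :=
        (hφc.mono hqs).preimage_isClosed_of_isClosed (isClosed_tsupport q) isClosed_Ici
      have c2 : IsClosed (tsupport q ∩ (fun z => φ (z - t • e)) ⁻¹' Ici 0) := by
        refine ContinuousOn.preimage_isClosed_of_isClosed ?_ (isClosed_tsupport q) isClosed_Ici
        exact hφc.comp (by fun_prop) fun z hz => hball z hz t ht.le htδ
      have : D = (tsupport q ∩ φ ⁻¹' Ici 0) \ (tsupport q ∩ (fun z => φ (z - t • e)) ⁻¹' Ici 0) := by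
        ext z
        simp only [D, mem_ofPred_eq, Set.mem_sdiff, mem_inter_iff, mem_preimage, mem_Ici, not_and,
          not_le]
        tauto
      rw [this]
      exact c1.measurableSet.diff c2.measurableSet
    have hDvol : volume D ≤ ENNReal.ofReal (t / r * V) := by
      have := volume_le_of_thin hD hr ht h.norm_le (fun z hz => hqs hz.1) fun z hz u hu hzu => by
        have hb : z + (u - t) • e ∈ Metric.ball x r := by
          have := hball _ hzu.1 t ht.le htδ
          rwa [add_sub_assoc, ← sub_smul] at this
        have h1 := add_le_of_fderiv_lower h.contDiffOn h.lower (sub_nonneg.2 hu) (hqs hz.1) hb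
        have h2 := hzu.2.2
        rw [add_sub_assoc, ← sub_smul] at h2
        have h3 := mul_nonneg h.c_pos.le (sub_nonneg.2 hu)
        linarith [hz.2.1]
      rwa [← ENNReal.ofReal_toReal (measure_ball_lt_top (μ := volume) (x := x) (r := 2 * r)).ne,
        ← ENNReal.ofReal_mul (by positivity)] at this
    have hqi : Integrable q := hq.continuous.integrable_of_hasCompactSupport hqc
    have hshift : ∫ z in E, q (z + t • e) = ∫ z, E.indicator 1 (z - t • e) * q z := by
      rw [← integral_indicator hE, ← integral_sub_right_eq_self _ (t • e)]
      congr 1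
      funext z
      by_cases hz : z - t • e ∈ E
      · simp [hz]
      · simp [hz]
    have hself : ∫ z in E, q z = ∫ z, E.indicator 1 z * q z := by
      rw [← integral_indicator hE]
      congr 1
      funext z
      by_cases hz : z ∈ E
      · simp [hz]
      · simp [hz]
    have hind : Measurable (E.indicator (1 : Space n → ℝ)) := measurable_one.indicator hE
    have hindb : ∀ z, ‖E.indicator (1 : Space n → ℝ) z‖ ≤ 1 := fun z => by
      by_cases hz : z ∈ E <;> simp [hz]
    have i1 : Integrable fun z => E.indicator 1 (z - t • e) * q z :=
      hqi.bdd_mul (c := 1) (hind.comp (measurable_id.sub_const _)).aestronglyMeasurable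
        (Eventually.of_forall fun z => hindb _)
    have i2 : Integrable fun z => E.indicator 1 z * q z :=
      hqi.bdd_mul (c := 1) hind.aestronglyMeasurable (Eventually.of_forall hindb)
    have hae : ∀ᵐ z, z - t • e ∈ Metric.ball x r → (z - t • e ∈ E ↔ φ (z - t • e) < 0) :=
      (measurePreserving_sub_right volume (t • e)).quasiMeasurePreserving.ae h.ae_mem_iff
    have hpt : ∀ᵐ z, D.indicator (fun _ => -(L * t)) z ≤
        E.indicator 1 (z - t • e) * q z - E.indicator 1 z * q z := by
      filter_upwards [hae, h.ae_mem_iff] with z h1 h2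
      by_cases hz : z ∈ tsupport q
      · have hb := hball z hz t ht.le htδ
        have hzb := hqs hz
        have hmono := add_le_of_fderiv_lower h.contDiffOn h.lower ht.le hb
          (by rwa [sub_add_cancel])
        rw [sub_add_cancel] at hmono
        have hct := mul_pos h.c_pos ht
        by_cases hzE : z ∈ E
        · have a1 := (h2 hzb).1 hzE
          have a2 : z - t • e ∈ E := (h1 hb).2 (by linarith)
          have a3 : z ∉ D := fun hD => by linarith [hD.2.1]
          simp [hzE, a2, a3]
        · have a1 : 0 ≤ φ z := not_lt.1 fun hlt => hzE ((h2 hzb).2 hlt)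
          by_cases hzt : z - t • e ∈ E
          · have a2 := (h1 hb).1 hzt
            have a3 : z ∈ D := ⟨hz, a1, a2⟩
            have hcont : ContinuousOn (fun u : ℝ => φ (z - u • e)) (Icc 0 t) :=
              hφc.comp (by fun_prop) fun u hu => hball z hz u hu.1 (hu.2.trans_lt htδ)
            -- Between `z` and `z - t • e` the function `φ` has a zero, where `q ≥ 0`; the Lipschitz
            -- bound carries this to `z`.
            obtain ⟨u, hu, hu0⟩ := intermediate_value_Icc' ht.le hcont
              (show (0 : ℝ) ∈ Icc (φ (z - t • e)) (φ (z - (0 : ℝ) • e)) from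
                ⟨a2.le, by simpa using a1⟩)
            have a4 := hq0 _ (hball z hz u hu.1 (hu.2.trans_lt htδ)) hu0
            have a5 := hL.dist_le_mul (z - u • e) z
            rw [Real.dist_eq, dist_eq_norm, sub_sub_cancel_left, norm_neg, norm_smul,
              Real.norm_of_nonneg hu.1] at a5
            have a6 : L * (u * ‖e‖) ≤ L * t :=
              mul_le_mul_of_nonneg_left ((mul_le_of_le_one_right hu.1 h.norm_le).trans hu.2) L.2
            simp only [indicator_of_mem a3, indicator_of_mem hzt, indicator_of_notMem hzE,
              Pi.one_apply, one_mul, zero_mul, sub_zero]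
            linarith [(abs_le.1 a5).2]
          · have a3 : z ∉ D := fun hD => hzt ((h1 hb).2 hD.2.2)
            simp [hzE, hzt, a3]
      · have a1 : q z = 0 := image_eq_zero_of_notMem_tsupport hz
        have a3 : z ∉ D := fun hD => hz hD.1
        simp [a1, a3]
    have hDfin : volume D ≠ ⊤ := (hDvol.trans_lt ENNReal.ofReal_lt_top).ne
    rw [hshift, hself, ← integral_sub i1 i2]
    refine le_trans ?_ (integral_mono_ae ((integrable_indicator_iff hD).2
      (integrableOn_const hDfin)) (i1.sub i2) hpt)
    rw [integral_indicator hD, setIntegral_const, smul_eq_mul, Measure.real]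
    have hV0 : 0 ≤ t / r * V := by positivity
    have := ENNReal.toReal_le_of_le_ofReal hV0 hDvol
    have hLt : 0 ≤ L * t := by positivity
    nlinarith
  have hd := hasDerivAt_integral_translate hq hqc E h.norm_le 0
  simp only [zero_smul, add_zero] at hd
  have hs := hd.tendsto_slope_zero_right
  simp only [zero_add, zero_smul, add_zero, smul_eq_mul] at hs
  have hlow : Tendsto (fun t : ℝ => -(L * (t / r * V))) (𝓝[>] 0) (𝓝 0) := by
    have : Tendsto (fun t : ℝ => -(L * (t / r * V))) (𝓝 0) (𝓝 (-(L * (0 / r * V)))) :=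
      Continuous.tendsto (by fun_prop) 0
    rw [zero_div, zero_mul, mul_zero, neg_zero] at this
    exact this.mono_left nhdsWithin_le_nhds
  refine le_of_tendsto_of_tendsto hlow hs ?_
  filter_upwards [Ioo_mem_nhdsGT hδ] with t ht
  have := key t ht.1 ht.2
  rw [le_inv_mul_iff₀ ht.1]
  linarith

/-- Slide a bump along `e`. At `x - a • e` it lies in `E` almost everywhere and has positive
integral over `E`; at `x + a • e` that integral is zero. By the mean value theorem some intermediate
translate has positive flux. -/
theorem exists_integral_fderiv_pos (h : IsLocalGraph E x φ e r c C α) (hE : MeasurableSet E) {δ : ℝ}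
    (hδ : 0 < δ) (hδr : δ ≤ r) : ∃ η : Space n → ℝ, ContDiff ℝ ∞ η ∧ HasCompactSupport η ∧
      (∀ z, 0 ≤ η z) ∧ tsupport η ⊆ Metric.ball x δ ∧ 0 < ∫ z in E, fderiv ℝ η z e := by
  -- Centers within `a` of `x` and bumps of radius at most `a` keep every translate in the closed
  -- ball of radius `2 * a < δ`.
  set a := δ / 4 with ha
  have ha0 : 0 < a := by positivity
  have hnorm : ∀ u : ℝ, ‖u • e‖ ≤ |u| := fun u => by
    rw [norm_smul, Real.norm_eq_abs]
    exact mul_le_of_le_one_right (abs_nonneg u) h.norm_le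
  have hmem : ∀ u : ℝ, |u| ≤ a → x + u • e ∈ Metric.ball x r := fun u hu => by
    rw [Metric.mem_ball, dist_eq_norm, add_sub_cancel_left]
    linarith [hnorm u]
  have hca := mul_pos h.c_pos ha0
  have hp : φ (x + (-a) • e) < 0 := by
    have := add_le_of_fderiv_lower h.contDiffOn h.lower (y := x + (-a) • e) ha0.le
      (hmem (-a) (by rw [abs_neg, abs_of_pos ha0]))
      (by
        have := Metric.mem_ball_self (x := x) h.r_pos
        simpa using this)
    have e1 : x + (-a) • e + a • e = x := by rw [neg_smul]; abel
    rw [e1, h.apply_eq_zero] at this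
    linarith
  have hpp : 0 < φ (x + a • e) := by
    have := add_le_of_fderiv_lower h.contDiffOn h.lower ha0.le (Metric.mem_ball_self h.r_pos)
      (hmem a (by rw [abs_of_pos ha0]))
    rw [h.apply_eq_zero] at this
    linarith
  have hcont := h.contDiffOn.continuousOn
  have hb1 := hmem (-a) (by rw [abs_neg, abs_of_pos ha0])
  have hb2 := hmem a (by rw [abs_of_pos ha0])
  obtain ⟨ρ₁, hρ₁, H₁⟩ := Metric.eventually_nhds_iff_ball.1
    (((hcont.continuousAt (Metric.isOpen_ball.mem_nhds hb1)).eventually (gt_mem_nhds hp)).and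
      (Metric.isOpen_ball.eventually_mem hb1))
  obtain ⟨ρ₂, hρ₂, H₂⟩ := Metric.eventually_nhds_iff_ball.1
    (((hcont.continuousAt (Metric.isOpen_ball.mem_nhds hb2)).eventually (lt_mem_nhds hpp)).and
      (Metric.isOpen_ball.eventually_mem hb2))
  set ρ := min (min ρ₁ ρ₂) a with hρ
  have hρ0 : 0 < ρ := lt_min (lt_min hρ₁ hρ₂) ha0
  have hρ1 : ρ ≤ ρ₁ := (min_le_left _ _).trans (min_le_left _ _)
  have hρ2 : ρ ≤ ρ₂ := (min_le_left _ _).trans (min_le_right _ _)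
  have hρa : ρ ≤ a := min_le_right _ _
  let ζ : ContDiffBump (x + (-a) • e) := ⟨ρ / 2, ρ, by positivity, by linarith⟩
  have hζc : ContDiff ℝ ∞ ζ := ζ.contDiff
  have hζ0 : ∀ z, ρ ≤ dist z (x + (-a) • e) → ζ z = 0 := fun z hz => ζ.zero_of_le_dist hz
  set Q : ℝ → ℝ := fun t => ∫ z in E, ζ (z + t • e) with hQ
  have hQd : ∀ t, HasDerivAt Q (∫ z in E, fderiv ℝ ζ (z + t • e) e) t :=
    hasDerivAt_integral_translate (hζc.of_le (by exact_mod_cast le_top)) ζ.hasCompactSupport E h.norm_le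
  have hQ0 : 0 < Q 0 := by
    have : Q 0 = ∫ z, ζ z := by
      simp only [hQ, zero_smul, add_zero]
      rw [← integral_indicator hE]
      refine integral_congr_ae ?_
      filter_upwards [h.ae_mem_iff] with z hz
      by_cases hzρ : dist z (x + (-a) • e) < ρ
      · have hzb := H₁ z (Metric.ball_subset_ball hρ1 hzρ)
        rw [indicator_of_mem ((hz hzb.2).2 hzb.1)]
      · rw [indicator_apply_eq_self.2 fun _ => hζ0 z (not_lt.1 hzρ)]
    rw [this]
    exact ζ.integral_pos
  have hQ1 : Q (-(2 * a)) = 0 := by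
    simp only [hQ]
    rw [← integral_indicator hE]
    refine integral_eq_zero_of_ae ?_
    filter_upwards [h.ae_mem_iff] with z hz
    by_cases hzρ : dist (z + (-(2 * a)) • e) (x + (-a) • e) < ρ
    · have e1 : dist (z + (-(2 * a)) • e) (x + (-a) • e) = dist z (x + a • e) := by
        rw [dist_eq_norm, dist_eq_norm]
        congr 1
        module
      rw [e1] at hzρ
      have hzb := H₂ z (Metric.ball_subset_ball hρ2 hzρ)
      rw [indicator_of_notMem fun hE => by linarith [(hz hzb.2).1 hE, hzb.1]]
      rfl
    · have h0 := hζ0 _ (not_lt.1 hzρ)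
      by_cases hzE : z ∈ E
      · rw [indicator_of_mem hzE]
        exact h0
      · rw [indicator_of_notMem hzE]
        rfl
  obtain ⟨t, ht, hts⟩ := exists_hasDerivAt_eq_slope Q
    (fun t => ∫ z in E, fderiv ℝ ζ (z + t • e) e) (by linarith : -(2 * a) < 0)
    (fun t _ => (hQd t).continuousAt.continuousWithinAt) (fun t _ => hQd t)
  have hηc : ContDiff ℝ ∞ fun z : Space n => ζ (z + t • e) :=
    hζc.comp (contDiff_id.add contDiff_const)
  have hsupp : tsupport (fun z : Space n => ζ (z + t • e)) ⊆ Metric.closedBall x (2 * a) := by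
    refine closure_minimal (fun z hz => ?_) Metric.isClosed_closedBall
    have h1 : dist (z + t • e) (x + (-a) • e) < ρ := by
      by_contra! hlt
      exact hz (hζ0 _ hlt)
    have e1 : z - x = (z + t • e - (x + (-a) • e)) + (-(t + a)) • e := by module
    rw [Metric.mem_closedBall, dist_eq_norm, e1]
    rw [dist_eq_norm] at h1
    have h2 : |-(t + a)| ≤ a := by
      rw [abs_neg, abs_le]
      exact ⟨by linarith [ht.1], by linarith [ht.2]⟩
    linarith [norm_add_le (z + t • e - (x + (-a) • e)) ((-(t + a)) • e), hnorm (-(t + a))]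
  refine ⟨fun z => ζ (z + t • e), hηc,
    (isCompact_closedBall x (2 * a)).of_isClosed_subset (isClosed_tsupport _) hsupp,
    fun z => ζ.nonneg, hsupp.trans (Metric.closedBall_subset_ball (by linarith)), ?_⟩
  have e1 : ∀ z, fderiv ℝ (fun z : Space n => ζ (z + t • e)) z = fderiv ℝ ζ (z + t • e) := fun z =>
    fderiv_comp_add_right (t • e)
  simp_rw [e1]
  rw [hts, hQ1]
  have : 0 < 0 - -(2 * a) := by linarith
  rw [sub_zero]
  positivity

end IsLocalGraph

end Monotonicity

end NonlocalCapillarity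

namespace NonlocalCapillarity

/-! ### Convergence of truncated potentials at boundary points. -/

section PrincipalValue

variable {n : ℕ}

/-- The kernel `κ` coincides with the even kernel `K` away from the origin and vanishes near the
origin, the transition taking place at the scale `ε`. -/
structure IsCutoffKernel (K κ : Space n → ℝ) (ε : ℝ) : Prop where
  measurable : Measurable κ
  even : ∀ w, κ (-w) = κ w
  eq_zero : ∀ w, ‖w‖ < ε → κ w = 0
  eq_self : ∀ w, 2 * ε ≤ ‖w‖ → κ w = K w
  abs_le : ∀ w, |κ w| ≤ |K w|

theorem IsSingularKernel.isCutoffKernel_regularize {K : Space n → ℝ} {Λ β : ℝ}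
    (hK : IsSingularKernel K Λ β) (heven : ∀ z, z ≠ 0 → K (-z) = K z) {ε : ℝ} (hε : 0 < ε) :
    IsCutoffKernel K (regularize K ε) ε where
  measurable := (hK.contDiff_regularize hε).continuous.measurable
  even := regularize_neg heven ε
  eq_zero _ hw := regularize_of_norm_le K hε hw.le
  eq_self _ hw := regularize_of_le K hε hw
  abs_le := abs_regularize_le K ε

/-- The sharp truncation of the principal value. Sharing the interface of the smooth one, it can be
compared with it by the same cancellation. -/
theorem IsSingularKernel.isCutoffKernel_indicator {K : Space n → ℝ} {Λ β : ℝ}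
    (hK : IsSingularKernel K Λ β) (heven : ∀ z, z ≠ 0 → K (-z) = K z) {ε : ℝ} (hε : 0 < ε) :
    IsCutoffKernel K ((Metric.ball 0 ε)ᶜ.indicator K) ε where
  measurable := hK.measurable.indicator measurableSet_ball.compl
  even w := by
    by_cases hw : w ∈ Metric.ball (0 : Space n) ε
    · have : -w ∈ Metric.ball (0 : Space n) ε := by simpa using hw
      rw [indicator_of_notMem (not_not.2 this), indicator_of_notMem (not_not.2 hw)]
    · have : -w ∉ Metric.ball (0 : Space n) ε := by simpa using hw
      rw [indicator_of_mem (mem_compl this), indicator_of_mem (mem_compl hw)]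
      exact heven w fun h => hw (by simpa [h] using hε)
  eq_zero w hw := indicator_of_notMem (not_not.2 (by simpa using hw)) K
  eq_self w hw := indicator_of_mem (by
    rw [mem_compl_iff, mem_ball_zero_iff]
    linarith) K
  abs_le w := by
    by_cases hw : w ∈ (Metric.ball (0 : Space n) ε)ᶜ
    · rw [indicator_of_mem hw]
    · rw [indicator_of_notMem hw, abs_zero]
      exact abs_nonneg _

theorem IsCutoffKernel.integrableOn {K κ : Space n → ℝ} {Λ β ε : ℝ} (h : IsCutoffKernel K κ ε)
    (hε : 0 < ε) (hK : IsSingularKernel K Λ β) (hβ : 0 ≤ β) {Ω : Set (Space n)}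
    (hΩb : Bornology.IsBounded Ω) {χ : Space n → ℝ} (hχm : Measurable χ) (hχ : ∀ y, |χ y| ≤ 1)
    (y : Space n) : IntegrableOn (fun z => κ (y - z) * χ z) Ω := by
  have hbound : ∀ w, |κ w| ≤ Λ * ε ^ (-β) := by
    intro w
    have hΛ := hK.nonneg
    rcases lt_or_ge ‖w‖ ε with hw | hw
    · rw [h.eq_zero w hw, abs_zero]
      positivity
    · refine (h.abs_le w).trans ((hK.bound w (norm_pos_iff.1 (hε.trans_le hw))).trans ?_)
      exact mul_le_mul_of_nonneg_left (Real.rpow_le_rpow_of_nonpos hε hw (by linarith)) hΛ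
  refine Integrable.mono' (g := fun _ => Λ * ε ^ (-β)) (integrableOn_const hΩb.measure_lt_top.ne)
    ((h.measurable.comp (measurable_const.sub measurable_id)).mul hχm).aestronglyMeasurable
    (Eventually.of_forall fun z => ?_)
  rw [norm_mul, Real.norm_eq_abs, Real.norm_eq_abs]
  exact (mul_le_of_le_one_right (abs_nonneg _) (hχ z)).trans (hbound _)

/-- The potential of a cut-off kernel at a boundary point converges as the cut-off is removed,
with a rate that does not depend on the shape of the cut-off. -/
theorem IsLocalGraph.exists_potential_sub_le {Ω E : Set (Space n)} {x : Space n} {φ : Space n → ℝ}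
    {e : Space n} {r c C α s : ℝ} (h : IsLocalGraph E x φ e r c C α) (hs : 0 < s) (hsα : s < α)
    (hE : MeasurableSet E) (hΩb : Bornology.IsBounded Ω) (hΩ : MeasurableSet Ω)
    (hball : Metric.ball x r ⊆ Ω) {K : Space n → ℝ} {Λ : ℝ}
    (hK : IsSingularKernel K Λ ((n : ℝ) + s)) :
    ∃ A : ℝ, 0 ≤ A ∧ ∀ y ∈ Metric.ball x (r / 2), φ y = 0 → ∀ (κ₁ κ₂ : Space n → ℝ) (ε₁ ε₂ : ℝ),
      0 < ε₁ → ε₁ ≤ ε₂ → 2 * ε₂ < r / 2 → IsCutoffKernel K κ₁ ε₁ → IsCutoffKernel K κ₂ ε₂ →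
      |(∫ z in Ω, κ₁ (y - z) * sideSign E z) - ∫ z in Ω, κ₂ (y - z) * sideSign E z| ≤
        A * ε₂ ^ (α - s) := by
  obtain ⟨A, hA, H⟩ := h.exists_cancellation hs hsα
  have hΛ := hK.nonneg
  have hβ : (0 : ℝ) ≤ n + s := by positivity
  refine ⟨2 * Λ * A * 2 ^ (α - s), by positivity, fun y hy hφy κ₁ κ₂ ε₁ ε₂ hε₁ hε hε₂ h₁ h₂ => ?_⟩
  have hε₂0 := hε₁.trans_le hε
  have i₁ := h₁.integrableOn hε₁ hK hβ hΩb (measurable_sideSign hE) (abs_sideSign_le E) y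
  have i₂ := h₂.integrableOn hε₂0 hK hβ hΩb (measurable_sideSign hE) (abs_sideSign_le E) y
  -- The difference is even, bounded by `2 * Λ` times the singular weight and zero beyond `2 * ε₂`,
  -- as the cancellation estimate requires; that radius is below `r / 2`, so nothing is lost by
  -- integrating over the whole space.
  set κ : Space n → ℝ := fun w => κ₁ w - κ₂ w with hκ
  have hκ0 : ∀ w, 2 * ε₂ < ‖w‖ → κ w = 0 := fun w hw => by
    simp only [hκ]
    rw [h₁.eq_self w (by linarith), h₂.eq_self w hw.le, sub_self]
  have hout : ∀ z ∉ Ω, κ (y - z) * sideSign E z = 0 := by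
    intro z hz
    rw [hκ0, zero_mul]
    by_contra! hle
    refine hz (hball ?_)
    rw [Metric.mem_ball] at hy ⊢
    have h3 : dist z y ≤ 2 * ε₂ := by rwa [dist_comm, dist_eq_norm]
    linarith [dist_triangle z y x]
  have i₃ : IntegrableOn (fun z => κ (y - z) * sideSign E z) Ω :=
    (i₁.sub i₂).congr (Eventually.of_forall fun z => by simp only [Pi.sub_apply, hκ]; ring)
  have hint : Integrable fun z => κ (y - z) * sideSign E z := by
    rw [← integrable_indicator_iff hΩ] at i₃
    refine i₃.congr (Eventually.of_forall fun z => ?_)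
    by_cases hz : z ∈ Ω
    · rw [indicator_of_mem hz]
    · rw [indicator_of_notMem hz]
      exact (hout z hz).symm
  have heq : (∫ z in Ω, κ₁ (y - z) * sideSign E z) - ∫ z in Ω, κ₂ (y - z) * sideSign E z =
      ∫ z, κ (y - z) * sideSign E z := by
    rw [← integral_sub i₁ i₂, ← setIntegral_eq_integral_of_forall_compl_eq_zero hout]
    simp only [hκ, sub_mul]
  rw [heq]
  have := H (sideSign E) (abs_sideSign_le E) (fun _ _ => rfl) y hy hφy κ (2 * Λ) (2 * ε₂)
    (by positivity) (by positivity) hε₂ (fun w => by simp only [hκ, h₁.even, h₂.even])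
    (fun w => ?_) hκ0 hint
  · rw [Real.mul_rpow (by norm_num) hε₂0.le] at this
    linarith
  · rcases eq_or_ne w 0 with rfl | hw
    · simp only [hκ]
      rw [h₁.eq_zero 0 (by simpa using hε₁), h₂.eq_zero 0 (by simpa using hε₂0), sub_zero, abs_zero]
      positivity
    · have b1 := (h₁.abs_le w).trans (hK.bound w hw)
      have b2 := (h₂.abs_le w).trans (hK.bound w hw)
      have b3 := abs_sub (κ₁ w) (κ₂ w)
      simp only [hκ]
      linarith

/-- Dominated convergence: the bounds on the regularized kernels are uniform in `ε`, and at each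
pair of distinct points the integrand is that of `K` once `2 * ε < ‖p.1 - p.2‖`. -/
theorem tendsto_setIntegral_divergence_regularize {K : Space n → ℝ} {Λ β : ℝ}
    (hK : IsSingularKernel K Λ β) (hβ : 0 ≤ β) {A B : Set (Space n)} (hA : MeasurableSet A)
    (hB : MeasurableSet B) (hAB : Disjoint A B)
    (hint : IntegrableOn (fun p : Space n × Space n => ‖p.1 - p.2‖ ^ (-β)) (A ×ˢ B))
    {T : Space n → Space n} (hT : IsTestField T) :
    Tendsto (fun ε => ∫ p in A ×ˢ B, divergence (kernelField (regularize K ε) T) p) (𝓝[>] 0)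
      (𝓝 (∫ p in A ×ˢ B, divergence (kernelField K T) p)) := by
  obtain ⟨Λ', hΛ'⟩ := hK.exists_isSingularKernel_regularize
  obtain ⟨L, hL⟩ := hT.exists_lipschitzWith
  obtain ⟨Φ, hΦ⟩ := hT.exists_flow
  obtain ⟨δ, hfam⟩ := hΦ.isSmoothFamily hT
  have hT1 : ContDiff ℝ 1 T := hT.contDiff.of_le (by exact_mod_cast le_top)
  have hTd : Differentiable ℝ T := hT1.differentiable one_ne_zero
  obtain ⟨M, hM⟩ := (hasCompactSupport_divergence hT.hasCompactSupport).exists_bound_of_continuous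
    (continuous_divergence hT1)
  have hne : ∀ p ∈ A ×ˢ B, p.1 ≠ p.2 := fun p hp heq =>
    Set.disjoint_left.1 hAB hp.1 (heq ▸ hp.2)
  have hAB' : MeasurableSet (A ×ˢ B) := hA.prod hB
  refine tendsto_integral_filter_of_dominated_convergence
    (fun p => Λ' * (L + 2 * M) * ‖p.1 - p.2‖ ^ (-β)) ?_ ?_ (hint.const_mul _) ?_
  · filter_upwards [self_mem_nhdsWithin] with ε hε
    have := (hfam.hasDerivAt_integral_kernel hβ (hΛ' ε hε) hA hB hAB hint).1
    rw [hΦ.velocity_zero hfam] at this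
    exact this.aestronglyMeasurable
  · filter_upwards [self_mem_nhdsWithin] with ε hε
    refine (ae_restrict_iff' hAB').2 (Eventually.of_forall fun p hp => ?_)
    have hκ := hΛ' ε hε
    have h0 : p.1 - p.2 ≠ 0 := sub_ne_zero.2 (hne p hp)
    have hpos : 0 < ‖p.1 - p.2‖ := norm_pos_iff.2 h0
    rw [divergence_kernelField (hκ.differentiableAt h0) hTd]
    have t1 : |fderiv ℝ (regularize K ε) (p.1 - p.2) (T p.1 - T p.2)| ≤
        Λ' * L * ‖p.1 - p.2‖ ^ (-β) := by
      have h1 := (fderiv ℝ (regularize K ε) (p.1 - p.2)).le_opNorm (T p.1 - T p.2)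
      have h2 := hκ.fderiv_bound _ h0
      have h3 : ‖T p.1 - T p.2‖ ≤ L * ‖p.1 - p.2‖ := by
        simpa [dist_eq_norm] using hL.dist_le_mul p.1 p.2
      rw [← Real.norm_eq_abs]
      refine h1.trans ((mul_le_mul h2 h3 (norm_nonneg _)
        ((norm_nonneg _).trans h2)).trans (le_of_eq ?_))
      rw [Real.rpow_sub_one hpos.ne']
      field_simp
    have t2 : |regularize K ε (p.1 - p.2) * (divergence T p.1 + divergence T p.2)| ≤
        Λ' * ‖p.1 - p.2‖ ^ (-β) * (2 * M) := by
      rw [abs_mul]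
      have h2 := hκ.bound _ h0
      have h4 : |divergence T p.1 + divergence T p.2| ≤ 2 * M :=
        (abs_add_le _ _).trans (by
          have a1 := hM p.1
          have a2 := hM p.2
          rw [Real.norm_eq_abs] at a1 a2
          linarith)
      exact mul_le_mul h2 h4 (abs_nonneg _) ((abs_nonneg _).trans h2)
    rw [Real.norm_eq_abs]
    refine (abs_add_le _ _).trans ((add_le_add t1 t2).trans (le_of_eq ?_))
    ring
  · refine (ae_restrict_iff' hAB').2 (Eventually.of_forall fun p hp => ?_)
    have h0 : p.1 - p.2 ≠ 0 := sub_ne_zero.2 (hne p hp)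
    have hpos : 0 < ‖p.1 - p.2‖ := norm_pos_iff.2 h0
    refine tendsto_const_nhds.congr' ?_
    filter_upwards [Ioo_mem_nhdsGT (show 0 < ‖p.1 - p.2‖ / 2 by positivity)] with ε hε
    have hloc : regularize K ε =ᶠ[𝓝 (p.1 - p.2)] K := by
      filter_upwards [continuous_norm.continuousAt.eventually
        (lt_mem_nhds (show 2 * ε < ‖p.1 - p.2‖ by linarith [hε.2]))] with w hw
      exact regularize_of_le K hε.1 hw.le
    rw [divergence_kernelField (hK.differentiableAt h0) hTd,
      divergence_kernelField ((hΛ' ε hε.1).differentiableAt h0) hTd, hloc.fderiv_eq,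
      hloc.self_of_nhds]

end PrincipalValue

end NonlocalCapillarity

namespace NonlocalCapillarity

/-! ### The Euler–Lagrange equation at regular points. -/

section PointwiseEquation

variable {n : ℕ}

theorem contDiff_mul_of_tsupport_subset {η u : Space n → ℝ} {N : Set (Space n)} (hN : IsOpen N)
    (hη : ContDiff ℝ 1 η) (hηN : tsupport η ⊆ N) (hu : ContDiffOn ℝ 1 u N) :
    ContDiff ℝ 1 fun z => η z * u z := by
  rw [contDiff_iff_contDiffAt]
  intro z
  by_cases hz : z ∈ tsupport η
  · exact hη.contDiffAt.mul (hu.contDiffAt (hN.mem_nhds (hηN hz)))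
  · refine (contDiffAt_const (c := (0 : ℝ))).congr_of_eventuallyEq ?_
    filter_upwards [notMem_tsupport_iff_eventuallyEq.1 hz] with y hy
    rw [hy, Pi.zero_apply, zero_mul]

theorem isTangentToBoundary_of_tsupport_subset {Ω : Set (Space n)} (hΩ : IsOpen Ω)
    {T : Space n → Space n} (hT : tsupport T ⊆ Ω) : IsTangentToBoundary Ω T := by
  intro x hx ν _
  rw [hΩ.frontier_eq] at hx
  rw [image_eq_zero_of_notMem_tsupport fun h => hx.2 (hT h), inner_zero_left]

theorem isTestField_smul_const {η : Space n → ℝ} (hη : ContDiff ℝ ∞ η) (hηc : HasCompactSupport η)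
    (e : Space n) : IsTestField fun z => η z • e :=
  ⟨ContDiff.smul hη contDiff_const, HasCompactSupport.smul_right (f := η) (f' := fun _ => e) hηc⟩

namespace IsAdmissible

variable {K₁ K₂ : Space n → ℝ} {Λ s₁ s₂ σ c : ℝ} {g : Space n → ℝ} {Ω E : Set (Space n)}

/-- The weak equation, tested with a field of constant direction, in terms of the regularized
curvature. -/
theorem tendsto_integral_fderiv_mul
    (h : IsAdmissible K₁ K₂ Λ ((n : ℝ) + s₁) ((n : ℝ) + s₂) g Ω E) (hs₂ : 0 < s₂)
    (heven : ∀ z, z ≠ 0 → K₁ (-z) = K₁ z)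
    (hweak : ∀ T : Space n → Space n, IsTestField T → IsTangentToBoundary Ω T →
      firstVariation K₁ K₂ σ g Ω E T = c * ∫ x in E, divergence T x)
    {x : Space n} {r : ℝ} (hr : 0 < r) (hball : Metric.ball x r ⊆ Ω)
    {η : Space n → ℝ} (hη : ContDiff ℝ ∞ η) (hηc : HasCompactSupport η)
    (hηs : tsupport η ⊆ Metric.ball x (r / 2)) (e : Space n) :
    Tendsto (fun ε => ∫ z in E, fderiv ℝ (fun z => η z *
      ((∫ y in Ω, regularize K₁ ε (z - y) * sideSign E y) + σ * (∫ y in Ωᶜ, K₂ (z - y)) + g z - c))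
        z e) (𝓝[>] 0) (𝓝 0) := by
  have hη1 : ContDiff ℝ 1 η := hη.of_le (by exact_mod_cast le_top)
  have hsubΩ : Metric.ball x (r / 2) ⊆ Ω :=
    (Metric.ball_subset_ball (by linarith)).trans hball
  have hT := isTestField_smul_const hη hηc e
  have hTs : tsupport (fun z => η z • e) ⊆ Ω :=
    (closure_mono (Function.support_smul_subset_left η fun _ => e)).trans (hηs.trans hsubΩ)
  have hw := hweak _ hT (isTangentToBoundary_of_tsupport_subset h.isOpen hTs)
  have hlim := (tendsto_setIntegral_divergence_regularize h.singular₁ h.β₁_nonneg h.measurableSet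
    h.measurableSet₁ disjoint₁ h.integrableOn₁ hT)
  obtain ⟨-, hk2c, hk2⟩ := setIntegral_divergence_kernelField_compl h.singular₂
    (by linarith : (n : ℝ) < n + s₂) h.isOpen h.subset hr hball
  have hB := hk2 η e hη1 hηs h.measurableSet (h.integrableOn_divergence hT).2.1
  have hG : ∀ z, divergence (fun z => g z • η z • e) z = fderiv ℝ (fun z => η z * g z) z e := by
    intro z
    rw [← divergence_smul_const (hη1.mul h.contDiff) e z]
    simp only [smul_smul, mul_comm]
  have cg := hη1.mul h.contDiff
  have ck := contDiff_mul_of_tsupport_subset Metric.isOpen_ball hη1 hηs hk2c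
  have hi : ∀ {u : Space n → ℝ}, ContDiff ℝ 1 u → IntegrableOn (fun z => fderiv ℝ u z e) E :=
    fun hu => h.integrableOn_of_continuous
      ((hu.continuous_fderiv one_ne_zero).clm_apply continuous_const)
  rw [firstVariation, hB] at hw
  simp_rw [hG, divergence_smul_const hη1] at hw
  have hlim' := ((hlim.add_const
    (σ * ∫ z in E, fderiv ℝ (fun z => η z * ∫ y in Ωᶜ, K₂ (z - y)) z e)).add_const
    (∫ z in E, fderiv ℝ (fun z => η z * g z) z e)).sub_const (c * ∫ z in E, fderiv ℝ η z e)
  -- The limit of the regularized quantities is the weak equation itself, hence 0.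
  rw [hw, sub_self] at hlim'
  refine hlim'.congr' ?_
  filter_upwards [self_mem_nhdsWithin] with ε hε
  obtain ⟨hhc, hA⟩ := setIntegral_divergence_kernelField_eq (h.singular₁.contDiff_regularize hε)
    (regularize_neg heven ε) hη1 hηc h.isOpen h.isBounded h.measurableSet h.subset
    (hηs.trans hsubΩ) e
  have ch := contDiff_mul_of_tsupport_subset h.isOpen hη1 (hηs.trans hsubΩ) hhc
  have i₁ : IntegrableOn (fun z =>
      fderiv ℝ (fun z => η z * ∫ y in Ω, regularize K₁ ε (z - y) * sideSign E y) z e +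
      σ * fderiv ℝ (fun z => η z * ∫ y in Ωᶜ, K₂ (z - y)) z e) E :=
    (hi ch).add ((hi ck).const_mul σ)
  have i₂ : IntegrableOn (fun z =>
      fderiv ℝ (fun z => η z * ∫ y in Ω, regularize K₁ ε (z - y) * sideSign E y) z e +
      σ * fderiv ℝ (fun z => η z * ∫ y in Ωᶜ, K₂ (z - y)) z e +
      fderiv ℝ (fun z => η z * g z) z e) E := i₁.add (hi cg)
  rw [hA, ← integral_const_mul, ← integral_const_mul, ← integral_add (hi ch) ((hi ck).const_mul σ),
    ← integral_add i₁ (hi cg), ← integral_sub i₂ ((hi hη1).const_mul c)]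
  refine setIntegral_congr_fun h.measurableSet fun z _ => ?_
  have d : ∀ {u : Space n → ℝ}, ContDiff ℝ 1 u → HasFDerivAt u (fderiv ℝ u z) z :=
    fun hu => (hu.differentiable one_ne_zero z).hasFDerivAt
  have hd := (((d ch).fun_add ((d ck).const_mul σ)).fun_add (d cg)).fun_sub ((d hη1).const_mul c)
  have hfun : (fun z => η z * ((∫ y in Ω, regularize K₁ ε (z - y) * sideSign E y) +
      σ * (∫ y in Ωᶜ, K₂ (z - y)) + g z - c)) = fun z =>
      η z * (∫ y in Ω, regularize K₁ ε (z - y) * sideSign E y) +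
      σ * (η z * (∫ y in Ωᶜ, K₂ (z - y))) + η z * g z - c * η z := by
    funext z
    ring
  rw [hfun, hd.fderiv]
  simp [smul_eq_mul]

/-- The Euler–Lagrange equation cannot be violated at a regular boundary point. -/
theorem not_pos_of_isLocalGraph
    (h : IsAdmissible K₁ K₂ Λ ((n : ℝ) + s₁) ((n : ℝ) + s₂) g Ω E) (hs₁ : 0 < s₁) (hs₂ : 0 < s₂)
    (heven : ∀ z, z ≠ 0 → K₁ (-z) = K₁ z)
    (hweak : ∀ T : Space n → Space n, IsTestField T → IsTangentToBoundary Ω T →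
      firstVariation K₁ K₂ σ g Ω E T = c * ∫ x in E, divergence T x)
    {x : Space n} {φ : Space n → ℝ} {e : Space n} {r b C α : ℝ}
    (hG : IsLocalGraph E x φ e r b C α) (hsα : s₁ < α) (hball : Metric.ball x r ⊆ Ω) {w : ℝ}
    (hw : Tendsto (fun ε => ∫ y in Ω, regularize K₁ ε (x - y) * sideSign E y) (𝓝[>] 0) (𝓝 w))
    (τ : ℝ) (hτ : |τ| = 1) :
    ¬ 0 < τ * (w + σ * (∫ y in Ωᶜ, K₂ (x - y)) + g x - c) := by
  intro hpos
  have hr := hG.r_pos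
  obtain ⟨A, hA, H⟩ := hG.exists_potential_sub_le hs₁ hsα h.measurableSet h.isBounded
    h.isOpen.measurableSet hball h.singular₁
  set W := τ * (w + σ * (∫ y in Ωᶜ, K₂ (x - y)) + g x - c) with hW
  let P : ℝ → Space n → ℝ := fun ε z => (∫ y in Ω, regularize K₁ ε (z - y) * sideSign E y) +
    σ * (∫ y in Ωᶜ, K₂ (z - y)) + g z - c
  have hrate : Tendsto (fun ε : ℝ => A * ε ^ (α - s₁)) (𝓝[>] 0) (𝓝 0) := by
    have h1 : Tendsto (fun ε : ℝ => A * ε ^ (α - s₁)) (𝓝 0) (𝓝 (A * 0 ^ (α - s₁))) :=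
      ((Real.continuous_rpow_const (by linarith : 0 ≤ α - s₁)).const_mul A).tendsto 0
    rw [Real.zero_rpow (by linarith), mul_zero] at h1
    exact h1.mono_left nhdsWithin_le_nhds
  have hPx : Tendsto (fun ε => τ * P ε x) (𝓝[>] 0) (𝓝 W) :=
    (((hw.add_const _).add_const _).sub_const c).const_mul τ
  -- A single scale `ε₀` at which `τ * P ε₀ x > 3 W / 4` and beyond which boundary values move by
  -- less than `W / 4`. Continuity of `P ε₀` then fixes a neighbourhood of `x` that serves for all
  -- smaller `ε`.
  obtain ⟨ε₀, ⟨⟨hε₀r, hε₀A⟩, hε₀P⟩, hε₀⟩ := (((eventually_mem_set.2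
    (Ioo_mem_nhdsGT (show 0 < r / 4 by positivity))).and
    (hrate.eventually (gt_mem_nhds (show 0 < W / 4 by positivity)))).and
    (hPx.eventually (lt_mem_nhds (show W * (3 / 4) < W by linarith)))).and
    self_mem_nhdsWithin |>.exists
  replace hε₀ : 0 < ε₀ := hε₀
  obtain ⟨-, hk2c, -⟩ := setIntegral_divergence_kernelField_compl h.singular₂
    (by linarith : (n : ℝ) < n + s₂) h.isOpen h.subset hr hball
  have hsubΩ : Metric.ball x (r / 2) ⊆ Ω :=
    (Metric.ball_subset_ball (by linarith)).trans hball
  have hPc : ∀ ε, 0 < ε → ContDiffOn ℝ 1 (P ε) (Metric.ball x (r / 2)) := by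
    intro ε hε
    obtain ⟨hhc, -⟩ := setIntegral_divergence_kernelField_eq (κ := regularize K₁ ε)
      (η := fun _ => 0) (h.singular₁.contDiff_regularize hε) (regularize_neg heven ε)
      contDiff_const HasCompactSupport.zero h.isOpen h.isBounded h.measurableSet h.subset
      (by simp [tsupport]) e
    exact (((hhc.mono hsubΩ).add (contDiffOn_const.mul hk2c)).add h.contDiff.contDiffOn).sub
      contDiffOn_const
  have hxb : x ∈ Metric.ball x (r / 2) := Metric.mem_ball_self (by positivity)
  obtain ⟨δ', hδ', hδP⟩ := Metric.eventually_nhds_iff_ball.1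
    ((((hPc ε₀ hε₀).continuousOn.continuousAt (Metric.isOpen_ball.mem_nhds hxb)).const_mul
      τ).eventually (lt_mem_nhds (show W * (3 / 4) < τ * P ε₀ x from hε₀P)))
  set δ := min δ' (r / 2) with hδ
  have hδ0 : 0 < δ := lt_min hδ' (by positivity)
  have hδr : δ ≤ r / 2 := min_le_right _ _
  obtain ⟨η, hη, hηc, hη0, hηs, hηpos⟩ := hG.exists_integral_fderiv_pos h.measurableSet hδ0
    (hδr.trans (by linarith))
  have hη1 : ContDiff ℝ 1 η := hη.of_le (by exact_mod_cast le_top)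
  have hηr : tsupport η ⊆ Metric.ball x (r / 2) := hηs.trans (Metric.ball_subset_ball hδr)
  have hlim := (h.tendsto_integral_fderiv_mul hs₂ heven hweak hr hball hη hηc hηr e).const_mul τ
  rw [mul_zero] at hlim
  have hle : ∀ᶠ ε in 𝓝[>] (0 : ℝ), W / 4 * (∫ z in E, fderiv ℝ η z e) ≤
      τ * ∫ z in E, fderiv ℝ (fun z => η z * P ε z) z e := by
    filter_upwards [Ioo_mem_nhdsGT hε₀] with ε hε
    have cP := contDiff_mul_of_tsupport_subset Metric.isOpen_ball hη1 hηr (hPc ε hε.1)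
    -- On the boundary `τ * P ε ≥ 3 W / 4 - W / 4 ≥ W / 4`, so `q = η * (τ * P ε - W / 4)` is
    -- nonnegative there and its flux is nonnegative. The flux of `η * P ε`, times `τ`, is thus at
    -- least `W / 4` times the positive flux of `η`, for every small `ε`.
    set q : Space n → ℝ := fun z => τ * (η z * P ε z) - W / 4 * η z with hq
    have cq : ContDiff ℝ 1 q := (contDiff_const.mul cP).sub (contDiff_const.mul hη1)
    have hqs : ∀ z ∉ tsupport η, q z = 0 := fun z hz => by
      simp [hq, image_eq_zero_of_notMem_tsupport hz]
    have hqsub : tsupport q ⊆ tsupport η :=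
      closure_minimal (fun z hz => by_contra fun h => hz (hqs z h)) (isClosed_tsupport η)
    have hnn := hG.integral_fderiv_nonneg h.measurableSet cq (HasCompactSupport.intro hηc hqs)
      (hqsub.trans (hηr.trans (Metric.ball_subset_ball (by linarith)))) fun y hy hφy => by
        by_cases hyη : y ∈ tsupport η
        · have hyδ := hηs hyη
          have a1 : W * (3 / 4) < τ * P ε₀ y :=
            hδP y (Metric.ball_subset_ball (min_le_left _ _) hyδ)
          have a2 := H y (hηr hyη) hφy _ _ ε ε₀ hε.1 hε.2.le (by linarith [hε₀r.2])
            (h.singular₁.isCutoffKernel_regularize heven hε.1)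
            (h.singular₁.isCutoffKernel_regularize heven hε₀)
          have a3 : |τ * P ε y - τ * P ε₀ y| ≤ W / 4 := by
            rw [← mul_sub, abs_mul, hτ, one_mul]
            refine le_trans (le_of_eq ?_) (a2.trans hε₀A.le)
            congr 1
            simp only [P]
            ring
          have a4 : W / 4 ≤ τ * P ε y := by linarith [(abs_le.1 a3).1]
          have : q y = η y * (τ * P ε y - W / 4) := by simp only [hq]; ring
          rw [this]
          exact mul_nonneg (hη0 y) (by linarith)
        · rw [hqs y hyη]
    have hi : ∀ {u : Space n → ℝ}, ContDiff ℝ 1 u → IntegrableOn (fun z => fderiv ℝ u z e) E :=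
      fun hu => h.integrableOn_of_continuous
        ((hu.continuous_fderiv one_ne_zero).clm_apply continuous_const)
    have hqd : ∀ z, fderiv ℝ q z e =
        τ * fderiv ℝ (fun z => η z * P ε z) z e - W / 4 * fderiv ℝ η z e := by
      intro z
      have d1 := ((cP.differentiable one_ne_zero z).hasFDerivAt).const_mul τ
      have d2 := ((hη1.differentiable one_ne_zero z).hasFDerivAt).const_mul (W / 4)
      rw [(d1.fun_sub d2).fderiv]
      simp [smul_eq_mul]
    simp_rw [hqd] at hnn
    rw [integral_sub ((hi cP).const_mul τ) ((hi hη1).const_mul _), integral_const_mul,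
      integral_const_mul] at hnn
    linarith
  have := ge_of_tendsto hlim hle
  have : 0 < W / 4 * ∫ z in E, fderiv ℝ η z e := by positivity
  linarith

/-- The pointwise Euler–Lagrange equation at a regular boundary point. -/
theorem exists_tendsto_of_isLocalGraph
    (h : IsAdmissible K₁ K₂ Λ ((n : ℝ) + s₁) ((n : ℝ) + s₂) g Ω E) (hs₁ : 0 < s₁) (hs₂ : 0 < s₂)
    (heven : ∀ z, z ≠ 0 → K₁ (-z) = K₁ z)
    (hweak : ∀ T : Space n → Space n, IsTestField T → IsTangentToBoundary Ω T →
      firstVariation K₁ K₂ σ g Ω E T = c * ∫ x in E, divergence T x)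
    {x : Space n} {φ : Space n → ℝ} {e : Space n} {r b C α : ℝ}
    (hG : IsLocalGraph E x φ e r b C α) (hsα : s₁ < α) (hball : Metric.ball x r ⊆ Ω) :
    ∃ w, Tendsto (fun ε => ∫ y in Ω, (Metric.ball 0 ε)ᶜ.indicator K₁ (x - y) * sideSign E y)
      (𝓝[>] 0) (𝓝 w) ∧ w + σ * (∫ y in Ωᶜ, K₂ (x - y)) + g x = c := by
  have hr := hG.r_pos
  obtain ⟨A, hA, H⟩ := hG.exists_potential_sub_le hs₁ hsα h.measurableSet h.isBounded
    h.isOpen.measurableSet hball h.singular₁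
  have hxb : x ∈ Metric.ball x (r / 2) := Metric.mem_ball_self (by positivity)
  have hcut := fun ε (hε : 0 < ε) => h.singular₁.isCutoffKernel_regularize heven hε
  have hrate : Tendsto (fun ε : ℝ => A * ε ^ (α - s₁)) (𝓝[>] 0) (𝓝 0) := by
    have h1 : Tendsto (fun ε : ℝ => A * ε ^ (α - s₁)) (𝓝 0) (𝓝 (A * 0 ^ (α - s₁))) :=
      ((Real.continuous_rpow_const (by linarith : 0 ≤ α - s₁)).const_mul A).tendsto 0
    rw [Real.zero_rpow (by linarith), mul_zero] at h1
    exact h1.mono_left nhdsWithin_le_nhds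
  let u : ℝ → ℝ := fun ε => ∫ y in Ω, regularize K₁ ε (x - y) * sideSign E y
  -- The uniform rate on the boundary, applied at `x` itself, makes the smooth truncations Cauchy.
  have hcauchy : Cauchy (map u (𝓝[>] 0)) := by
    rw [Metric.cauchy_iff]
    refine ⟨inferInstance, fun ι hι => ?_⟩
    obtain ⟨ε₀, ⟨hε₀r, hε₀A⟩, hε₀⟩ := ((eventually_mem_set.2
    (Ioo_mem_nhdsGT (show 0 < r / 4 by positivity))).and
      (hrate.eventually (gt_mem_nhds (half_pos hι)))).and self_mem_nhdsWithin |>.exists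
    replace hε₀ : 0 < ε₀ := hε₀
    have hb : ∀ ε ∈ Ioo 0 ε₀, dist (u ε) (u ε₀) < ι / 2 := fun ε hε =>
      (H x hxb hG.apply_eq_zero _ _ ε ε₀ hε.1 hε.2.le (by linarith [hε₀r.2]) (hcut ε hε.1)
        (hcut ε₀ hε₀)).trans_lt hε₀A
    refine ⟨u '' Ioo 0 ε₀, image_mem_map (Ioo_mem_nhdsGT hε₀), ?_⟩
    rintro _ ⟨ε, hε, rfl⟩ _ ⟨ε', hε', rfl⟩
    have := dist_triangle_right (u ε) (u ε') (u ε₀)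
    linarith [hb ε hε, hb ε' hε']
  obtain ⟨w, hw⟩ := cauchy_map_iff_exists_tendsto.1 hcauchy
  refine ⟨w, ?_, ?_⟩
  -- At equal scales the sharp and the smooth truncation differ by the same rate, so they share the
  -- limit.
  · have hdiff : Tendsto (fun ε => (∫ y in Ω, (Metric.ball 0 ε)ᶜ.indicator K₁ (x - y) *
        sideSign E y) - u ε) (𝓝[>] 0) (𝓝 0) := by
      refine squeeze_zero_norm' ?_ hrate
      filter_upwards [Ioo_mem_nhdsGT (show 0 < r / 4 by positivity)] with ε hε
      exact H x hxb hG.apply_eq_zero _ _ ε ε hε.1 le_rfl (by linarith [hε.2])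
        (h.singular₁.isCutoffKernel_indicator heven hε.1) (hcut ε hε.1)
    have := hdiff.add hw
    simpa using this
  · have h1 := h.not_pos_of_isLocalGraph hs₁ hs₂ heven hweak hG hsα hball hw 1 (by simp)
    have h2 := h.not_pos_of_isLocalGraph hs₁ hs₂ heven hweak hG hsα hball hw (-1) (by simp)
    linarith

end IsAdmissible

/-- Since `E ⊆ Ω`, the sign is 1 on `Ωᶜ`, and for small `ε` the removed ball lies in `Ω`; so the
exterior contributes the constant `∫_{Ωᶜ} K`. -/
theorem hasMeanCurvature_of_tendsto {K : Space n → ℝ} {Λ β : ℝ} (hK : IsSingularKernel K Λ β)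
    (hβ : n < β) {Ω E : Set (Space n)} (hΩ : IsOpen Ω) (hE : MeasurableSet E) (hEΩ : E ⊆ Ω)
    {x : Space n} {r : ℝ} (hr : 0 < r) (hball : Metric.ball x r ⊆ Ω) {w : ℝ}
    (hw : Tendsto (fun ε => ∫ y in Ω, (Metric.ball 0 ε)ᶜ.indicator K (x - y) * sideSign E y)
      (𝓝[>] 0) (𝓝 w)) : HasMeanCurvature K E x (w + ∫ y in Ωᶜ, K (x - y)) := by
  have hcurv : ∀ y, curvatureIntegrand K E x y = K (x - y) * sideSign E y := fun _ => rfl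
  have hint : ∀ ε > 0, IntegrableOn (curvatureIntegrand K E x) (Metric.ball x ε)ᶜ := by
    intro ε hε
    refine Integrable.mono' ((integrableOn_rpow_compl_ball_center hβ hε x).const_mul Λ)
      ((hK.measurable.comp (measurable_const.sub measurable_id)).mul
        (measurable_sideSign hE)).aestronglyMeasurable
      ((ae_restrict_iff' measurableSet_ball.compl).2 (Eventually.of_forall fun y hy => ?_))
    have h0 : x - y ≠ 0 := fun h => hy (by
      rw [sub_eq_zero.1 h]; exact Metric.mem_ball_self hε)
    rw [hcurv, norm_mul, Real.norm_eq_abs, Real.norm_eq_abs]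
    exact (mul_le_of_le_one_right (abs_nonneg _) (abs_sideSign_le E y)).trans (hK.bound _ h0)
  refine ⟨hint, (hw.add_const _).congr' ?_⟩
  filter_upwards [Ioo_mem_nhdsGT hr] with ε hε
  have hsub : Ωᶜ ⊆ (Metric.ball x ε)ᶜ :=
    compl_subset_compl.2 ((Metric.ball_subset_ball hε.2.le).trans hball)
  have hun : (Metric.ball x ε)ᶜ = (Metric.ball x ε)ᶜ ∩ Ω ∪ Ωᶜ := by
    ext y
    by_cases hy : y ∈ Ω
    · simp [hy]
    · simp only [mem_union, mem_inter_iff, hy, and_false, false_or, mem_compl_iff, not_false_iff,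
        iff_true]
      exact hsub hy
  have hdj : Disjoint ((Metric.ball x ε)ᶜ ∩ Ω) Ωᶜ :=
    disjoint_compl_right.mono_left inter_subset_right
  have hi := hint ε hε.1
  rw [hun, setIntegral_union hdj hΩ.measurableSet.compl (hi.mono_set inter_subset_left)
    (hi.mono_set hsub)]
  congr 1
  · rw [inter_comm, ← setIntegral_indicator measurableSet_ball.compl]
    refine setIntegral_congr_fun hΩ.measurableSet fun y _ => ?_
    have hiff : x - y ∈ (Metric.ball (0 : Space n) ε)ᶜ ↔ y ∈ (Metric.ball x ε)ᶜ := by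
      rw [mem_compl_iff, mem_compl_iff, mem_ball_zero_iff, Metric.mem_ball, dist_comm, dist_eq_norm]
    by_cases hy : y ∈ (Metric.ball x ε)ᶜ
    · simp only [indicator_of_mem hy, indicator_of_mem (hiff.2 hy), hcurv]
    · simp only [indicator_of_notMem hy, indicator_of_notMem (mt hiff.1 hy), zero_mul]
  · refine setIntegral_congr_fun hΩ.measurableSet.compl fun y hy => ?_
    rw [hcurv, sideSign_of_notMem fun h => hy (hEΩ h), mul_one]

end PointwiseEquation

end NonlocalCapillarity
theorem proposition1p2 (n : ℕ) (hn : 2 ≤ n) (s₁ s₂ lam σ m : ℝ) (ϱ : ℝ≥0∞)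
    (hs₁ : s₁ ∈ Ioo (0 : ℝ) 1) (hs₂ : s₂ ∈ Ioo (0 : ℝ) 1) (hlam : 1 ≤ lam) (hϱ : 0 < ϱ)
    (K₁ K₂ : Space n → ℝ)
    (hK₁ : IsKernelOfClass 1 n s₁ lam ϱ K₁) (hK₂ : IsKernelOfClass 1 n s₂ lam ϱ K₂)
    (Ω : Set (Space n)) (hΩo : IsOpen Ω) (hΩb : Bornology.IsBounded Ω) (hΩ : HasC1Boundary Ω)
    (hm : 0 < m) (hmΩ : ENNReal.ofReal m < volume Ω)
    (g : Space n → ℝ) (hg : ContDiff ℝ 1 g)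
    (E : Set (Space n)) (hE : IsVolumeConstrainedCritical K₁ K₂ σ g Ω m E) :
    ∃ c : ℝ,
      (∀ T : Space n → Space n, ContDiff ℝ ∞ T → HasCompactSupport T →
        IsTangentToBoundary Ω T →
        IntegrableOn (divergence (kernelField K₁ T)) (E ×ˢ (Eᶜ ∩ Ω)) ∧
        IntegrableOn (divergence (kernelField K₂ T)) (E ×ˢ Ωᶜ) ∧
        IntegrableOn (divergence (fun x => g x • T x)) E ∧
        IntegrableOn (divergence T) E ∧
        (∫ p in E ×ˢ (Eᶜ ∩ Ω), divergence (kernelField K₁ T) p)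
            + σ * (∫ p in E ×ˢ Ωᶜ, divergence (kernelField K₂ T) p)
            + (∫ x in E, divergence (fun x => g x • T x) x)
          = c * ∫ x in E, divergence T x) ∧
      (IsKernelOfClass 2 n s₁ lam ϱ K₁ → IsKernelOfClass 2 n s₂ lam ϱ K₂ →
        ∀ x ∈ Ω ∩ regularSet s₁ Ω E,
          IntegrableOn (fun y => K₁ (x - y)) Ωᶜ ∧
          IntegrableOn (fun y => K₂ (x - y)) Ωᶜ ∧
          ∃ H : ℝ, HasMeanCurvature K₁ E x H ∧
            H - (∫ y in Ωᶜ, K₁ (x - y)) + σ * (∫ y in Ωᶜ, K₂ (x - y)) + g x = c) := by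
  have hadm : IsAdmissible K₁ K₂ lam ((n : ℝ) + s₁) ((n : ℝ) + s₂) g Ω E :=
    { β₁_nonneg := add_nonneg n.cast_nonneg hs₁.1.le
      β₂_nonneg := add_nonneg n.cast_nonneg hs₂.1.le
      singular₁ := hK₁.isSingularKernel hlam
      singular₂ := hK₂.isSingularKernel hlam
      nonneg₁ := hK₁.nonneg
      nonneg₂ := hK₂.nonneg
      contDiff := hg
      isOpen := hΩo
      isBounded := hΩb
      hasC1Boundary := hΩ
      measurableSet := hE.measurableSet
      subset := hE.subset
      integrableOn₁ := hK₁.toIsKernel.integrableOn_rpow hs₁.1 hlam hϱ hE.measurableSet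
        (hE.measurableSet.compl.inter hΩo.measurableSet)
        (disjoint_compl_right.mono_right inter_subset_left)
        (hΩb.subset hE.subset).measure_lt_top.ne
        (hΩb.subset inter_subset_right).measure_lt_top.ne hE.finite_interaction
      integrableOn₂ := (integrableOn_rpow_domain (by omega) hΩo hΩb hΩ hs₂).mono_set
        (prod_mono hE.subset subset_rfl) }
  obtain ⟨c, hc⟩ := hadm.exists_firstVariation_eq hE
  refine ⟨c, fun T hT hTc hTΩ => ?_, fun _ _ x hx => ?_⟩
  · obtain ⟨i₁, i₂, i₃⟩ := hadm.integrableOn_divergence ⟨hT, hTc⟩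
    exact ⟨i₁, i₂, i₃, hadm.integrableOn_of_continuous
      (continuous_divergence (hT.of_le (by exact_mod_cast le_top))), hc T ⟨hT, hTc⟩ hTΩ⟩
  · obtain ⟨φ, e, r, b, C, α, hsα, -, hball, hG⟩ := exists_isLocalGraph hΩo hx
    have hx₀ : x ∈ Metric.ball x (r / 2) := Metric.mem_ball_self (half_pos hG.r_pos)
    have hn₁ : (n : ℝ) < n + s₁ := by linarith [hs₁.1]
    have hn₂ : (n : ℝ) < n + s₂ := by linarith [hs₂.1]
    obtain ⟨w, hw, hwc⟩ := hadm.exists_tendsto_of_isLocalGraph hs₁.1 hs₂.1 hK₁.even hc hG hsα hball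
    refine ⟨(setIntegral_divergence_kernelField_compl hadm.singular₁ hn₁ hΩo hE.subset hG.r_pos
        hball).1 x hx₀,
      (setIntegral_divergence_kernelField_compl hadm.singular₂ hn₂ hΩo hE.subset hG.r_pos
        hball).1 x hx₀,
      -- The equation was proved for the curvature integrated over `Ω` only; subtracting the
      -- exterior term in the statement leaves exactly `w`.
      w + ∫ y in Ωᶜ, K₁ (x - y), hasMeanCurvature_of_tendsto hadm.singular₁ hn₁ hΩo
        hE.measurableSet hE.subset hG.r_pos hball hw, ?_⟩
    linarith
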